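/- **Setting.** Let $V,U$ be finite-dimensional real vector spaces, $T>0$, $p\ge 1$ and $N:=\lfloor p\rfloor$. Put $T(V)=\bigoplus_{n\ge0}V^{\otimes n}$, write $a^n$ for the component of $a\in T(V)$ in $V^{\otimes n}$, and let $T^{N}(V)$ be the set of $a\in T(V)$ with $a^n=0$ for $n>N$. Let $\Delta_T=\{(s,t):0\le s\le t\le T\}$ and let $\omega$ be a control: a continuous function $\omega:\Delta_T\to[0,\infty)$ with $\omega(t,t)=0$ and $\omega(s,u)+\omega(u,t)\le\omega(s,t)$ for $s\le u\le t$. For quantities depending on $(s,t)\in\Delta_T$ (and possibly on an intermediate time $u\in[s,t]$), $a\approx_m b$ means $|a-b|\le C\,\omega(s,t)^{m/p}$ with $C$ independent of the times, and $\approx$ means $\approx_{N+1}$. For a permutation $\sigma$ of $\{1,\dots,n\}$ let $\sigma_*(v_1\otimes\cdots\otimes v_n)=v_{\sigma(1)}\otimes\cdots\otimes v_{\sigma(n)}$. Let $\mathrm{Sh}(i,j)$ be the set of permutations of $\{1,\dots,i+j\}$ that are increasing on $\{1,\dots,i\}$ and on $\{i+1,\dots,i+j\}$. For $n_1,\dots,n_m\ge1$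 let $\overline{\mathrm{Sh}}(n_1,\dots,n_m)$ be the set of permutations $\sigma$ of $\{1,\dots,n_1+\cdots+n_m\}$ that are increasing on each of the $m$ successive blocks of lengths $n_1,\dots,n_m$ and satisfy $\sigma(n_1)<\sigma(n_1+n_2)<\cdots<\sigma(n_1+\cdots+n_m)$. A *weakly geometric $p$-rough path* on $[0,T]$ with values in $V$, controlled by $\omega$, is a continuous map $\boldsymbol X:\Delta_T\to T^{N}(V)$ with $\boldsymbol X^0=1$ such that 1. (regularity) $\boldsymbol X^n_{st}\approx_n 0$ for $1\le n\le N$; 2. (multiplicativity) $(\boldsymbol X_{su}\otimes\boldsymbol X_{ut})^n=\boldsymbol X^n_{st}$ for $n\le N$ and $s\le u\le t$; 3. (integration by parts) $\boldsymbol X^i_{st}\otimes\boldsymbol X^j_{st}=\sum_{\sigma\in\mathrm{Sh}(i,j)}\sigma_*\boldsymbol X^{i+j}_{st}$ for $i+j\le N$. An *almost $p$-rough path* is defined in the same way, with $\approx$ in place of $=$ in 2 (almost multiplicative) and 3 (almost geometric). Let $\boldsymbol X$ be such a weakly geometric $p$-rough path. A *$U$-valued $\boldsymbol X$-controlled path*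 is a continuous path $\overline H:[0,T]\to\mathcal L(T^{N-1}(V),U)$ with $\overline H_t-\overline H_s\approx_1 0$ and, for $0\le n\le N-2$ and $a\in V^{\otimes n}$, $$\langle\overline H_t,a\rangle\approx_{N-n}\Big\langle\overline H_s,\sum_{k=0}^{N-1-n}\boldsymbol X^k_{st}\otimes a\Big\rangle .$$ Write $\overline H_n=\overline H|_{V^{\otimes n}}$; the trace of $\overline H$ is $H_t:=\langle\overline H_t,1\rangle\in U$. Define $\upharpoonleft_{\boldsymbol X}\!\overline H:\Delta_T\to T^{N}(U)$ by $(\upharpoonleft_{\boldsymbol X}\!\overline H)^0_{st}=1$, $(\upharpoonleft_{\boldsymbol X}\!\overline H)^1_{st}=H_t-H_s$ and, for $2\le m\le N$, $$(\upharpoonleft_{\boldsymbol X}\!\overline H)^m_{st}=\sum_{\substack{n_1,\dots,n_m\ge1\\ n:=n_1+\cdots+n_m\le N}}\Big\langle\overline H_{n_1;s}\boxtimes\cdots\boxtimes\overline H_{n_m;s},\ \sum_{\sigma\in\overline{\mathrm{Sh}}(n_1,\dots,n_m)}\sigma_*\boldsymbol X^{n}_{st}\Big\rangle\in U^{\otimes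 m}.$$ **Theorem.** Let $\boldsymbol X$ be a weakly geometric $p$-rough path with values in $V$ controlled by $\omega$, and let $\overline H$ be a $U$-valued $\boldsymbol X$-controlled path. Then $\upharpoonleft_{\boldsymbol X}\!\overline H$ is an almost $p$-rough path controlled by $\omega$; in particular it is almost multiplicative and almost geometric. Moreover, for all $(s,t)\in\Delta_T$ the limit $$(\uparrow_{\boldsymbol X}\!\overline H)_{st}=\lim_{k\to\infty}\bigotimes_{[u,v]\in\pi_k}(\upharpoonleft_{\boldsymbol X}\!\overline H)_{uv}\in T^{N}(U)$$ (products truncated at level $N$) exists along every sequence $(\pi_k)$ of partitions of $[s,t]$ with vanishing step size and does not depend on the sequence, and $\uparrow_{\boldsymbol X}\!\overline H$ is a $U$-valued weakly geometric $p$-rough path on $[0,T]$ controlled by $\omega$, with trace $H$, i.e. $(\uparrow_{\boldsymbol X}\!\overline H)^1_{st}=H_t-H_s$. -/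

import Mathlib

open scoped TensorProduct DirectSum

noncomputable section

namespace GeomRough

/-- The tensor algebra `T(V) = ⨁ₙ V^{⊗ n}`, with the ring structure (tensor product) that Mathlib
puts on a direct sum of tensor powers. For `a : TAlg V`, `a n` is the component in `V^{⊗ n}`. An
element of the truncation `T^N(V)` is an `a` with `a n = 0` for `n > N`. -/
abbrev TAlg (V : Type*) [AddCommGroup V] [Module ℝ V] : Type _ := ⨁ n : ℕ, ⨂[ℝ]^n V

section Algebra

variable {V : Type*} [AddCommGroup V] [Module ℝ V] {U : Type*} [AddCommGroup U] [Module ℝ U]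

/-- The inclusion `V^{⊗ n} → T(V)`. -/
def incl (n : ℕ) : (⨂[ℝ]^n V) →ₗ[ℝ] TAlg V :=
  DirectSum.lof ℝ ℕ (fun n => ⨂[ℝ]^n V) n

/-- A vector `v`, seen as an element of `V^{⊗ 1}`. -/
def vec (v : V) : ⨂[ℝ]^1 V := PiTensorProduct.tprod ℝ (fun _ : Fin 1 => v)

/-- The external product `V^{⊗ i} ⊠ V^{⊗ j}`, with values in `V^{⊗ (i + j)}` through the canonical
isomorphism. -/
def boxTensor {i j : ℕ} (a : ⨂[ℝ]^i V) (b : ⨂[ℝ]^j V) : ⨂[ℝ]^(i + j) V :=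
  TensorPower.mulEquiv (a ⊗ₜ[ℝ] b)

/-- The action `σ_* (v₁ ⊗ ⋯ ⊗ vₙ) = v_{σ 1} ⊗ ⋯ ⊗ v_{σ n}`. -/
def permAct {n : ℕ} (σ : Equiv.Perm (Fin n)) : (⨂[ℝ]^n V) →ₗ[ℝ] (⨂[ℝ]^n V) :=
  (PiTensorProduct.reindex ℝ (fun _ : Fin n => V) σ.symm).toLinearMap

theorem permAct_tprod {n : ℕ} (σ : Equiv.Perm (Fin n)) (v : Fin n → V) :
    permAct σ (PiTensorProduct.tprod ℝ v) = PiTensorProduct.tprod ℝ (fun i => v (σ i)) := by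
  simp [permAct]

open Classical in
/-- `Sh(i, j)`: the permutations of `i + j` letters that are increasing on the first `i` letters
and on the last `j` letters. -/
def shuffles (i j : ℕ) : Finset (Equiv.Perm (Fin (i + j))) :=
  Finset.univ.filter fun σ =>
    StrictMono (fun a : Fin i => σ (Fin.castAdd j a)) ∧
      StrictMono (fun b : Fin j => σ (Fin.natAdd i b))

/-- The position, among `ν₁ + ⋯ + νₘ` letters, of the `j`-th letter of the `i`-th block. -/
def pos {m : ℕ} (ν : Fin m → ℕ) (i : Fin m) (j : Fin (ν i)) : Fin (∑ i, ν i) :=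
  finSigmaFinEquiv ⟨i, j⟩

theorem pos_val {m : ℕ} (ν : Fin m → ℕ) (i : Fin m) (j : Fin (ν i)) :
    (pos ν i j : ℕ) = ∑ k : Fin i, ν (Fin.castLE i.2.le k) + j :=
  finSigmaFinEquiv_apply _

open Classical in
/-- The ordered shuffles of type `(ν₁, …, νₘ)`: the permutations that are increasing on each block
and send the last letters of the (non-empty) blocks to an increasing sequence. -/
def orderedShuffles {m : ℕ} (ν : Fin m → ℕ) : Finset (Equiv.Perm (Fin (∑ i, ν i))) :=
  Finset.univ.filter fun σ =>
    (∀ i, StrictMono (fun j : Fin (ν i) => σ (pos ν i j))) ∧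
      ∀ (i i' : Fin m) (j : Fin (ν i)) (j' : Fin (ν i')),
        i < i' → (j : ℕ) + 1 = ν i → (j' : ℕ) + 1 = ν i' → σ (pos ν i j) < σ (pos ν i' j')

/-- For `h : T(V) → U` linear with levels `hₙ = h|_{V^{⊗ n}}`, the linear map
`h_{ν₁} ⊠ ⋯ ⊠ h_{νₘ} : V^{⊗ (ν₁ + ⋯ + νₘ)} → U^{⊗ m}`. -/
def boxMap {m : ℕ} (h : TAlg V →ₗ[ℝ] U) (ν : Fin m → ℕ) :
    (⨂[ℝ]^(∑ i, ν i) V) →ₗ[ℝ] (⨂[ℝ]^m U) :=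
  PiTensorProduct.lift
    (((PiTensorProduct.tprod ℝ (s := fun _ : Fin m => U)).compMultilinearMap
        (fun i => (h ∘ₗ incl (ν i)).compMultilinearMap
          (PiTensorProduct.tprod ℝ (s := fun _ : Fin (ν i) => V)))).domDomCongr finSigmaFinEquiv)

theorem boxMap_tprod {m : ℕ} (h : TAlg V →ₗ[ℝ] U) (ν : Fin m → ℕ) (v : Fin (∑ i, ν i) → V) :
    boxMap h ν (PiTensorProduct.tprod ℝ v) = PiTensorProduct.tprod ℝ (fun i =>
      h (incl (ν i) (PiTensorProduct.tprod ℝ (fun j => v (pos ν i j))))) := by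
  simp only [boxMap, PiTensorProduct.lift.tprod, pos]
  rfl

/-- The multi-indices `(n₁, …, nₘ)` with all `nᵢ ≥ 1` and `n₁ + ⋯ + nₘ ≤ N`. -/
def degreeTuples (N m : ℕ) : Finset (Fin m → ℕ) :=
  (Fintype.piFinset fun _ : Fin m => Finset.Icc 1 N).filter fun ν => ∑ i, ν i ≤ N

/-- The pairing `⟨h^{⊠ m}, Δ̃^m a⟩` with the reduced iterated ordered-shuffle coproduct of an
element `a` of `T^N(V)`: its component in `V^{⊗ n₁} ⊠ ⋯ ⊠ V^{⊗ nₘ}` (all `nᵢ ≥ 1`) is the sum of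
`σ_* a^{n₁ + ⋯ + nₘ}` over the ordered shuffles `σ` of type `(n₁, …, nₘ)`. -/
def orderedShufflePairing (N m : ℕ) (h : TAlg V →ₗ[ℝ] U) (a : TAlg V) : ⨂[ℝ]^m U :=
  ∑ ν ∈ degreeTuples N m, boxMap h ν (∑ σ ∈ orderedShuffles ν, permAct σ (a (∑ i, ν i)))

end Algebra

section Analysis

/-- The simplex `{(s, t) | 0 ≤ s ≤ t ≤ T}`. -/
def simplex (T : ℝ) : Set (ℝ × ℝ) := {q | 0 ≤ q.1 ∧ q.1 ≤ q.2 ∧ q.2 ≤ T}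

/-- A control on `[0, T]`; values of `ω` outside the simplex are irrelevant. -/
structure IsControl (T : ℝ) (ω : ℝ → ℝ → ℝ) : Prop where
  nonneg : ∀ s t, 0 ≤ s → s ≤ t → t ≤ T → 0 ≤ ω s t
  continuousOn : ContinuousOn (fun q : ℝ × ℝ => ω q.1 q.2) (simplex T)
  diag : ∀ t, 0 ≤ t → t ≤ T → ω t t = 0
  superadditive : ∀ s u t, 0 ≤ s → s ≤ u → u ≤ t → t ≤ T → ω s u + ω u t ≤ ω s t

variable {V : Type*} [AddCommGroup V] [Module ℝ V] {U : Type*} [AddCommGroup U] [Module ℝ U]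

/-- `f s t = O(ω(s, t)^θ)` uniformly on the simplex, for `f` with values in a finite-dimensional
space `E`. The norm on `E` is immaterial, so the bound is stated through all linear functionals,
that is, for all coordinates. The relation `a ≈_m b` is `IsBigOControl T ω (m / p) (a - b)`. -/
def IsBigOControl {E : Type*} [AddCommGroup E] [Module ℝ E] (T : ℝ) (ω : ℝ → ℝ → ℝ) (θ : ℝ)
    (f : ℝ → ℝ → E) : Prop :=
  ∀ ℓ : Module.Dual ℝ E, ∃ C : ℝ, ∀ s t, 0 ≤ s → s ≤ t → t ≤ T → |ℓ (f s t)| ≤ C * ω s t ^ θ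

/-- A continuous map from the simplex to `T^{⌊p⌋}(V)` with zeroth component `1` and the regularity
`|X^n_{st}| = O(ω(s, t)^{n/p})` for `n = 1, …, ⌊p⌋`. Continuity is with respect to the canonical
topology of a finite-dimensional space, hence stated coordinatewise. -/
structure IsRegularFunctional (T p : ℝ) (ω : ℝ → ℝ → ℝ) (X : ℝ → ℝ → TAlg V) : Prop where
  truncated : ∀ s t, 0 ≤ s → s ≤ t → t ≤ T → ∀ n, ⌊p⌋₊ < n → X s t n = 0
  continuousOn : ∀ n ≤ ⌊p⌋₊, ∀ ℓ : Module.Dual ℝ (⨂[ℝ]^n V),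
    ContinuousOn (fun q : ℝ × ℝ => ℓ (X q.1 q.2 n)) (simplex T)
  level_zero : ∀ s t, 0 ≤ s → s ≤ t → t ≤ T → X s t 0 = (1 : TAlg V) 0
  regular : ∀ n, 1 ≤ n → n ≤ ⌊p⌋₊ → IsBigOControl T ω (n / p) (fun s t => X s t n)

/-- The failure `X^i ⊠ X^j - (Δ X)^{i,j}` of integration by parts, where `Δ` is the shuffle
coproduct. -/
def geometricDefect (X : ℝ → ℝ → TAlg V) (i j : ℕ) (s t : ℝ) : ⨂[ℝ]^(i + j) V :=
  boxTensor (X s t i) (X s t j) - ∑ σ ∈ shuffles i j, permAct σ (X s t (i + j))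

/-- `X` is a weakly geometric `p`-rough path on `[0, T]` controlled by `ω`. -/
structure IsRoughPath (T p : ℝ) (ω : ℝ → ℝ → ℝ) (X : ℝ → ℝ → TAlg V) : Prop
    extends IsRegularFunctional T p ω X where
  multiplicative : ∀ s u t, 0 ≤ s → s ≤ u → u ≤ t → t ≤ T → ∀ n ≤ ⌊p⌋₊,
    (X s u * X u t) n = X s t n
  geometric : ∀ s t, 0 ≤ s → s ≤ t → t ≤ T → ∀ i j, i + j ≤ ⌊p⌋₊ → geometricDefect X i j s t = 0

/-- `X` is an almost `p`-rough path on `[0, T]` controlled by `ω`: multiplicativity and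
integration by parts hold up to `O(ω(s, t)^{(⌊p⌋ + 1)/p})`. -/
structure IsAlmostRoughPath (T p : ℝ) (ω : ℝ → ℝ → ℝ) (X : ℝ → ℝ → TAlg V) : Prop
    extends IsRegularFunctional T p ω X where
  almost_multiplicative : ∀ n ≤ ⌊p⌋₊, ∀ ℓ : Module.Dual ℝ (⨂[ℝ]^n V), ∃ C : ℝ,
    ∀ s u t, 0 ≤ s → s ≤ u → u ≤ t → t ≤ T →
      |ℓ ((X s u * X u t) n - X s t n)| ≤ C * ω s t ^ (((⌊p⌋₊ : ℝ) + 1) / p)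
  almost_geometric : ∀ i j, i + j ≤ ⌊p⌋₊ →
    IsBigOControl T ω (((⌊p⌋₊ : ℝ) + 1) / p) (geometricDefect X i j)

/-- `H` is a `U`-valued `X`-controlled path. An element of `L(T^{⌊p⌋-1}(V), U)` is a linear map on
`T(V)` that vanishes on the levels `n ≥ ⌊p⌋`. -/
structure IsControlledPath (T p : ℝ) (ω : ℝ → ℝ → ℝ) (X : ℝ → ℝ → TAlg V)
    (H : ℝ → TAlg V →ₗ[ℝ] U) : Prop where
  truncated : ∀ t, 0 ≤ t → t ≤ T → ∀ n, ⌊p⌋₊ ≤ n → ∀ a : ⨂[ℝ]^n V, H t (incl n a) = 0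
  continuousOn : ∀ a : TAlg V, ∀ ℓ : Module.Dual ℝ U,
    ContinuousOn (fun t => ℓ (H t a)) (Set.Icc 0 T)
  regular : ∀ a : TAlg V, IsBigOControl T ω (1 / p) (fun s t => H t a - H s a)
  controlled : ∀ n, n + 2 ≤ ⌊p⌋₊ → ∀ a : ⨂[ℝ]^n V,
    IsBigOControl T ω (((⌊p⌋₊ : ℝ) - n) / p) (fun s t => H t (incl n a) -
      H s ((∑ k ∈ Finset.range (⌊p⌋₊ - n), incl k (X s t k)) * incl n a))

/-- The trace `H = H̄_0` of a controlled path. -/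
def trace (H : ℝ → TAlg V →ₗ[ℝ] U) (t : ℝ) : U := H t 1

/-- The explicit ordered-shuffle functional `↿_X H̄` with values in `T^{⌊p⌋}(U)`. -/
def partialLift (p : ℝ) (X : ℝ → ℝ → TAlg V) (H : ℝ → TAlg V →ₗ[ℝ] U) (s t : ℝ) : TAlg U :=
  1 + incl 1 (vec (trace H t - trace H s)) +
    ∑ m ∈ Finset.Icc 2 ⌊p⌋₊, incl m (orderedShufflePairing ⌊p⌋₊ m (H s) (X s t))

/-- A partition `s = t₀ ≤ t₁ ≤ ⋯ ≤ tₖ = t` of `[s, t]`. -/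
structure IntervalPartition (s t : ℝ) where
  size : ℕ
  point : ℕ → ℝ
  first : point 0 = s
  last : point size = t
  mono : ∀ i < size, point i ≤ point (i + 1)

/-- The step sizes of a sequence of partitions tend to `0`. -/
def VanishingStep {s t : ℝ} (π : ℕ → IntervalPartition s t) : Prop :=
  ∀ ε > 0, ∃ k₀, ∀ k ≥ k₀, ∀ i < (π k).size, (π k).point (i + 1) - (π k).point i < ε

/-- The product `X_{t₀ t₁} ⊗ X_{t₁ t₂} ⊗ ⋯`, in this order, over the intervals of a partition. -/
def partitionProd (X : ℝ → ℝ → TAlg U) {s t : ℝ} (π : IntervalPartition s t) : TAlg U :=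
  ((List.range π.size).map fun i => X (π.point i) (π.point (i + 1))).prod

/-- `Y` is the limit in `T^N(U)` of the truncated products of `X` along every sequence of
partitions of `[s, t]` with vanishing step size (coordinatewise convergence). -/
def IsPartitionLimit (N : ℕ) (X : ℝ → ℝ → TAlg U) (s t : ℝ) (Y : TAlg U) : Prop :=
  ∀ π : ℕ → IntervalPartition s t, VanishingStep π →
    ∀ n ≤ N, ∀ ℓ : Module.Dual ℝ (⨂[ℝ]^n U),
      Filter.Tendsto (fun k => ℓ (partitionProd X (π k) n)) Filter.atTop (nhds (ℓ (Y n)))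

end Analysis

end GeomRough

end

/-!
The proof is carried out in coordinates. Bases of `V` and `U` turn elements of the tensor algebras
into functions on words; the words are written backwards, the head of the list being the last
letter, because the recursion for ordered shuffles removes last letters. The tensor product becomes
deconcatenation of words (`wordCoord_mul`), integration by parts says that the coordinates form a
character of the shuffle algebra (`repr_geometricDefect`), and the pairing with ordered shuffles
becomes the recursively defined map `orderedShuffleCoord` (`repr_orderedShufflePairing`).

*The ordered-shuffle functional is almost a rough path.* The ordered-shuffle map of a linear map `h`
has two algebraic properties. It is a morphism for the deshuffling coproducts
(`shuffleSum_orderedShuffleCoord`), so it preserves group-like elements. For a group-like `g`, it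
sends `g a` to the product of the image of `g` and of the image of `a` under the ordered-shuffle map
of `h(g · )` (`wordSum_orderedShuffleCoord_append`). For `g = X_{su}`, `a = X_{ut}` and `h = H_s`,
the estimate in the definition of a controlled path allows one to replace `h(g · )` by `H_u`. To
compute exactly with such replacements, functions of `(s, u, t)` are considered in the ring of
bounded functions modulo the ideal of functions of order `O(ω(s, t)^{(N + 1)/p})`, filtered by the
orders `O(ω(s, t)^{m/p})`. There the two properties of almost rough paths are the identities
`IsFiltration.deconcSum_wordSum_eq` and `IsFiltration.shuffleSum_wordSum_eq`, in which the first
level, the increment of the trace, enters as a perturbation of order `N`.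

*Every almost rough path determines a rough path.* Weighted `ℓ¹` norms on coordinates make the tensor
algebra a monoid with a pseudo-distance for which multiplication is Lipschitz. The maximal inequality
`dist_pathProd_le` bounds the distance between `Y_{st}` and all products of `Y` over partitions of
`[s, t]` by a multiple of `ω(s, t)^θ` with `θ = (N + 1)/p > 1`. A limit `L` of these products along
an ultrafilter of finite sets of subdivision points is multiplicative and close to `Y`, and replacing
the factors `Y` by `L` one after the other shows that the products over all fine partitions are close
to `L` (`exists_sewing`). Continuity follows from uniform convergence. Integration by parts holds
because, by induction on the length of words, its defect is additive in time and of order `O(ω^θ)`,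
so that it vanishes (`eq_zero_of_additive_of_le`); the first level is identified in the same way.
-/

namespace GeomRough

open scoped TensorProduct DirectSum

noncomputable section

/-! ### Sums over splittings, factorizations and shuffles of words -/

section WordSums

variable {α E E' : Type*} [AddCommMonoid E] [AddCommMonoid E']

/-- The sum of `q a b` over all ways of splitting the word `w` into a subword `a` and the
complementary subword `b`; this is the deshuffling coproduct of `w`, tested against `q`. -/
def splitSum : List α → (List α → List α → E) → E
  | [], q => q [] []
  | x :: w, q => splitSum w (fun a b => q (x :: a) b) + splitSum w (fun a b => q a (x :: b))

/-- The sum of `q v u` over all factorizations `w = v ++ u`. -/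
def deconcSum : List α → (List α → List α → E) → E
  | [], q => q [] []
  | x :: w, q => q [] (x :: w) + deconcSum w (fun v u => q (x :: v) u)

/-- The sum of `y` over all shuffles of two words, with multiplicity. -/
def shuffleSum : List α → List α → (List α → E) → E
  | [], l, y => y l
  | k :: K, [], y => y (k :: K)
  | k :: K, l :: L, y =>
      shuffleSum K (l :: L) (fun M => y (k :: M)) + shuffleSum (k :: K) L (fun M => y (l :: M))
termination_by K L => K.length + L.length

theorem shuffleSum_nil_left (l : List α) (y : List α → E) : shuffleSum [] l y = y l := by
  rw [shuffleSum]

theorem shuffleSum_nil_right (K : List α) (y : List α → E) : shuffleSum K [] y = y K := by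
  cases K <;> rw [shuffleSum]

theorem shuffleSum_cons_cons (k l : α) (K L : List α) (y : List α → E) :
    shuffleSum (k :: K) (l :: L) y =
      shuffleSum K (l :: L) (fun M => y (k :: M)) +
        shuffleSum (k :: K) L (fun M => y (l :: M)) := by
  rw [shuffleSum]

theorem splitSum_congr {w : List α} {q q' : List α → List α → E}
    (h : ∀ a b, a.Sublist w → b.Sublist w → (a ++ b).Perm w → q a b = q' a b) :
    splitSum w q = splitSum w q' := by
  induction w generalizing q q' with
  | nil => exact h _ _ (List.Sublist.refl _) (List.Sublist.refl _) (by simp)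
  | cons x w ih =>
    refine congrArg₂ (· + ·) (ih fun a b ha hb hp => ?_) (ih fun a b ha hb hp => ?_)
    · exact h _ _ (ha.cons_cons x) (hb.cons x) (hp.cons x)
    · exact h _ _ (ha.cons x) (hb.cons_cons x) (List.perm_middle.trans (hp.cons x))

theorem splitSum_congr_length {w : List α} {q q' : List α → List α → E}
    (h : ∀ a b, a.length + b.length = w.length → q a b = q' a b) :
    splitSum w q = splitSum w q' :=
  splitSum_congr fun a b _ _ hp => h a b (by simpa using hp.length_eq)

theorem deconcSum_congr {w : List α} {q q' : List α → List α → E}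
    (h : ∀ v u, v ++ u = w → q v u = q' v u) :
    deconcSum w q = deconcSum w q' := by
  induction w generalizing q q' with
  | nil => exact h _ _ rfl
  | cons x w ih =>
    exact congrArg₂ (· + ·) (h _ _ rfl) (ih fun v u hvu => h _ _ (by simp [hvu]))

theorem shuffleSum_congr {K L : List α} {y y' : List α → E}
    (h : ∀ M, M.length = K.length + L.length → y M = y' M) :
    shuffleSum K L y = shuffleSum K L y' := by
  induction K generalizing L y y' with
  | nil => simpa [shuffleSum_nil_left] using h L (by simp)
  | cons k K ihK =>
    induction L generalizing y y' with
    | nil => simpa [shuffleSum_nil_right] using h (k :: K) (by simp)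
    | cons l L ihL =>
      rw [shuffleSum_cons_cons, shuffleSum_cons_cons]
      refine congrArg₂ (· + ·) (ihK fun M hM => h _ ?_) (ihL fun M hM => h _ ?_) <;>
        simp only [List.length_cons] at hM ⊢ <;> omega

theorem map_splitSum (f : E →+ E') (w : List α) (q : List α → List α → E) :
    f (splitSum w q) = splitSum w fun a b => f (q a b) := by
  induction w generalizing q with
  | nil => rfl
  | cons x w ih => simp only [splitSum, map_add, ih]

theorem map_deconcSum (f : E →+ E') (w : List α) (q : List α → List α → E) :
    f (deconcSum w q) = deconcSum w fun a b => f (q a b) := by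
  induction w generalizing q with
  | nil => rfl
  | cons x w ih => simp only [deconcSum, map_add, ih]

theorem map_shuffleSum (f : E →+ E') (K L : List α) (y : List α → E) :
    f (shuffleSum K L y) = shuffleSum K L fun M => f (y M) := by
  induction K generalizing L y with
  | nil => simp [shuffleSum_nil_left]
  | cons k K ihK =>
    induction L generalizing y with
    | nil => simp [shuffleSum_nil_right]
    | cons l L ihL => simp only [shuffleSum_cons_cons, map_add, ihK, ihL]

theorem splitSum_add (w : List α) (q q' : List α → List α → E) :
    splitSum w (fun a b => q a b + q' a b) = splitSum w q + splitSum w q' := by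
  induction w generalizing q q' with
  | nil => rfl
  | cons x w ih =>
    simp only [splitSum, ih]
    exact add_add_add_comm _ _ _ _

theorem deconcSum_add (w : List α) (q q' : List α → List α → E) :
    deconcSum w (fun a b => q a b + q' a b) = deconcSum w q + deconcSum w q' := by
  induction w generalizing q q' with
  | nil => rfl
  | cons x w ih => simp only [deconcSum, ih, add_add_add_comm]

theorem shuffleSum_add (K L : List α) (y y' : List α → E) :
    shuffleSum K L (fun M => y M + y' M) = shuffleSum K L y + shuffleSum K L y' := by
  induction K generalizing L y y' with
  | nil => simp [shuffleSum_nil_left]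
  | cons k K ihK =>
    induction L generalizing y y' with
    | nil => simp [shuffleSum_nil_right]
    | cons l L ihL => simp only [shuffleSum_cons_cons, ihK, ihL, add_add_add_comm]

theorem splitSum_zero (w : List α) : splitSum w (fun _ _ => (0 : E)) = 0 := by
  induction w with
  | nil => rfl
  | cons x w ih => simp only [splitSum, ih, add_zero]

theorem deconcSum_zero (w : List α) : deconcSum w (fun _ _ => (0 : E)) = 0 := by
  induction w with
  | nil => rfl
  | cons x w ih => simp only [deconcSum, ih, add_zero]

theorem shuffleSum_zero (K L : List α) : shuffleSum K L (fun _ => (0 : E)) = 0 := by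
  induction K generalizing L with
  | nil => simp [shuffleSum_nil_left]
  | cons k K ihK =>
    induction L with
    | nil => simp [shuffleSum_nil_right]
    | cons l L ihL => simp only [shuffleSum_cons_cons, ihK, ihL, add_zero]

theorem splitSum_sum {ι : Type*} (s : Finset ι) (w : List α) (q : ι → List α → List α → E) :
    splitSum w (fun a b => ∑ i ∈ s, q i a b) = ∑ i ∈ s, splitSum w (q i) := by
  induction w generalizing q with
  | nil => rfl
  | cons x w ih => simp only [splitSum, ih, Finset.sum_add_distrib]

theorem deconcSum_sum {ι : Type*} (s : Finset ι) (w : List α) (q : ι → List α → List α → E) :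
    deconcSum w (fun a b => ∑ i ∈ s, q i a b) = ∑ i ∈ s, deconcSum w (q i) := by
  induction w generalizing q with
  | nil => rfl
  | cons x w ih => simp only [deconcSum, ih, Finset.sum_add_distrib]

theorem shuffleSum_sum {ι : Type*} (s : Finset ι) (K L : List α) (y : ι → List α → E) :
    shuffleSum K L (fun M => ∑ i ∈ s, y i M) = ∑ i ∈ s, shuffleSum K L (y i) := by
  induction K generalizing L y with
  | nil => simp [shuffleSum_nil_left]
  | cons k K ihK =>
    induction L generalizing y with
    | nil => simp [shuffleSum_nil_right]
    | cons l L ihL => simp only [shuffleSum_cons_cons, ihK, ihL, Finset.sum_add_distrib]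

theorem splitSum_deconcSum {β : Type*} (w : List α) (K : List β)
    (q : List α → List α → List β → List β → E) :
    splitSum w (fun a b => deconcSum K (q a b)) =
      deconcSum K fun v u => splitSum w fun a b => q a b v u := by
  induction w generalizing q with
  | nil => rfl
  | cons x w ih => simp only [splitSum, ih, deconcSum_add]

theorem shuffleSum_splitSum {β : Type*} (K L : List β) (w : List α)
    (q : List β → List α → List α → E) :
    shuffleSum K L (fun M => splitSum w (q M)) =
      splitSum w fun a b => shuffleSum K L fun M => q M a b := by
  induction w generalizing q with
  | nil => rfl
  | cons x w ih => simp only [splitSum, shuffleSum_add, ih]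

theorem splitSum_comm (w : List α) (q : List α → List α → E) :
    splitSum w (fun a b => q b a) = splitSum w q := by
  induction w generalizing q with
  | nil => rfl
  | cons x w ih =>
    simp only [splitSum]
    rw [ih (fun a b => q a (x :: b)), ih (fun a b => q (x :: a) b), add_comm]

/-- Deshuffling is coassociative. -/
theorem splitSum_assoc (w : List α) (q : List α → List α → List α → E) :
    splitSum w (fun a b => splitSum a fun a₁ a₂ => q a₁ a₂ b) =
      splitSum w fun a b => splitSum b fun b₁ b₂ => q a b₁ b₂ := by
  induction w generalizing q with
  | nil => rfl
  | cons x w ih =>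
    simp only [splitSum, splitSum_add, add_assoc]
    rw [ih fun a₁ a₂ b => q (x :: a₁) a₂ b, ih fun a₁ a₂ b => q a₁ (x :: a₂) b,
      ih fun a₁ a₂ b => q a₁ a₂ (x :: b)]

/-- Deshuffling is a morphism for the concatenation of words. -/
theorem splitSum_append (v u : List α) (q : List α → List α → E) :
    splitSum (v ++ u) q =
      splitSum v fun v₁ v₂ => splitSum u fun u₁ u₂ => q (v₁ ++ u₁) (v₂ ++ u₂) := by
  induction v generalizing q with
  | nil => rfl
  | cons x v ih => simp only [List.cons_append, splitSum, ih]

/-- Deconcatenation is a morphism for the shuffle product. -/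
theorem shuffleSum_deconcSum (K L : List α) (q : List α → List α → E) :
    shuffleSum K L (fun M => deconcSum M q) =
      deconcSum K fun K₁ K₂ => deconcSum L fun L₁ L₂ =>
        shuffleSum K₁ L₁ fun M₁ => shuffleSum K₂ L₂ fun M₂ => q M₁ M₂ := by
  induction K generalizing L q with
  | nil => simp [shuffleSum_nil_left, deconcSum]
  | cons k K ihK =>
    induction L generalizing q with
    | nil => simp [shuffleSum_nil_right, deconcSum]
    | cons l L ihL =>
      have h1 := ihK (l :: L) fun a b => q (k :: a) b
      have h2 := ihL fun a b => q (l :: a) b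
      simp only [deconcSum, shuffleSum_nil_left, shuffleSum_nil_right, shuffleSum_add,
        deconcSum_add, shuffleSum_cons_cons] at h1 h2 ⊢
      rw [h1, h2]
      abel

open Classical in
/-- Shuffling and deshuffling of words are dual to each other. -/
theorem shuffleSum_single {R : Type*} [CommSemiring R] (K L w : List α) :
    shuffleSum K L (fun M => if M = w then (1 : R) else 0) =
      splitSum w fun a b => if a = K ∧ b = L then 1 else 0 := by
  induction w generalizing K L with
  | nil =>
    rcases K with _ | ⟨k, K⟩
    · simp [shuffleSum_nil_left, splitSum, eq_comm]
    · rcases L with _ | ⟨l, L⟩ <;>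
        simp [shuffleSum_nil_right, shuffleSum_cons_cons, splitSum, shuffleSum_zero]
  | cons x w ih =>
    rcases K with _ | ⟨k, K⟩
    · rcases L with _ | ⟨l, L⟩
      · simp [shuffleSum_nil_left, splitSum, splitSum_zero]
      · have := ih [] L
        simp only [shuffleSum_nil_left] at this
        by_cases hx : x = l
        · subst hx; simp [shuffleSum_nil_left, splitSum, splitSum_zero, this]
        · simp [shuffleSum_nil_left, splitSum, splitSum_zero, hx, Ne.symm hx]
    · rcases L with _ | ⟨l, L⟩
      · have := ih K []
        simp only [shuffleSum_nil_right] at this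
        by_cases hx : x = k
        · subst hx; simp [shuffleSum_nil_right, splitSum, splitSum_zero, this]
        · simp [shuffleSum_nil_right, splitSum, splitSum_zero, hx, Ne.symm hx]
      · have h1 := ih K (l :: L)
        have h2 := ih (k :: K) L
        simp only [shuffleSum_cons_cons, splitSum, List.cons.injEq]
        refine congrArg₂ (· + ·) ?_ ?_
        · by_cases hx : x = k
          · subst hx; simpa using h1
          · simp [hx, Ne.symm hx, splitSum_zero, shuffleSum_zero]
        · by_cases hx : x = l
          · subst hx; simpa using h2
          · simp [hx, Ne.symm hx, splitSum_zero, shuffleSum_zero]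

end WordSums

/-! ### Words of bounded length -/

section Words

variable {ι : Type*} [Fintype ι]

/-- The words of length `n`. -/
def wordsOf (ι : Type*) [Fintype ι] (n : ℕ) : Finset (List ι) :=
  (Finset.univ : Finset (Fin n → ι)).map ⟨List.ofFn, List.ofFn_injective⟩

theorem mem_wordsOf {n : ℕ} {w : List ι} : w ∈ wordsOf ι n ↔ w.length = n := by
  simp only [wordsOf, Finset.mem_map, Finset.mem_univ, true_and, Function.Embedding.coeFn_mk]
  constructor
  · rintro ⟨f, rfl⟩; simp
  · rintro rfl; exact ⟨w.get, List.ofFn_get w⟩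

open Classical in
/-- The words of length at most `N`. -/
def wordsLE (ι : Type*) [Fintype ι] (N : ℕ) : Finset (List ι) :=
  (Finset.range (N + 1)).biUnion (wordsOf ι)

theorem mem_wordsLE {N : ℕ} {w : List ι} : w ∈ wordsLE ι N ↔ w.length ≤ N := by
  simp [wordsLE, mem_wordsOf]

theorem sum_wordsLE {E : Type*} [AddCommMonoid E] (N : ℕ) (F : List ι → E) :
    ∑ w ∈ wordsLE ι N, F w = ∑ n ∈ Finset.range (N + 1), ∑ w ∈ wordsOf ι n, F w := by
  classical
  rw [wordsLE, Finset.sum_biUnion]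
  intro m _ n _ hmn
  rw [Function.onFun, Finset.disjoint_left]
  intro w hm hn
  exact hmn ((mem_wordsOf.1 hm).symm.trans (mem_wordsOf.1 hn))

open Classical in
/-- Deconcatenation is dual to concatenation. -/
theorem deconcSum_single {α E : Type*} [AddCommMonoid E] (w v u : List α) (c : E) :
    (deconcSum w fun a b => if a = v ∧ b = u then c else 0) = if v ++ u = w then c else 0 := by
  induction w generalizing v with
  | nil =>
    simp only [deconcSum, List.append_eq_nil_iff, eq_comm]
  | cons x w ih =>
    rcases v with _ | ⟨y, v⟩
    · simp [deconcSum, deconcSum_zero, eq_comm]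
    · by_cases hx : x = y
      · subst hx; simp [deconcSum, ih]
      · simp [deconcSum, deconcSum_zero, hx, Ne.symm hx]

/-- Summing over words and their factorizations is summing over pairs of words of bounded total
length. -/
theorem sum_deconcSum {E : Type*} [AddCommMonoid E] (N : ℕ) (q : List ι → List ι → E) :
    ∑ w ∈ wordsLE ι N, deconcSum w q =
      ∑ u ∈ wordsLE ι N, ∑ v ∈ wordsLE ι N, if v.length + u.length ≤ N then q v u else 0 := by
  classical
  have h1 : ∀ w ∈ wordsLE ι N, deconcSum w q = ∑ u ∈ wordsLE ι N, ∑ v ∈ wordsLE ι N,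
      if v ++ u = w then q v u else 0 := by
    intro w hw
    rw [mem_wordsLE] at hw
    simp only [← deconcSum_single]
    simp only [← deconcSum_sum]
    refine deconcSum_congr fun v u hvu => ?_
    subst hvu
    rw [List.length_append] at hw
    rw [Finset.sum_eq_single u, Finset.sum_eq_single v]
    · simp
    · intro b _ hb; simp [Ne.symm hb]
    · intro h; exact absurd (mem_wordsLE.2 (by omega)) h
    · intro b _ hb
      exact Finset.sum_eq_zero fun v _ => by simp [Ne.symm hb]
    · intro h; exact absurd (mem_wordsLE.2 (by omega)) h
  rw [Finset.sum_congr rfl h1, Finset.sum_comm]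
  refine Finset.sum_congr rfl fun u _ => ?_
  rw [Finset.sum_comm]
  refine Finset.sum_congr rfl fun v _ => ?_
  rw [Finset.sum_ite_eq]
  simp [mem_wordsLE]

end Words

/-! ### Pairings of truncated tensors with functionals on words -/

section Pairing

section Mul

variable {ι R : Type*} [CommRing R]

theorem splitSum_mul_right (w : List ι) (q : List ι → List ι → R) (r : R) :
    splitSum w q * r = splitSum w fun a b => q a b * r :=
  map_splitSum (AddMonoidHom.mulRight r) w q

theorem splitSum_mul_left (w : List ι) (q : List ι → List ι → R) (r : R) :
    r * splitSum w q = splitSum w fun a b => r * q a b :=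
  map_splitSum (AddMonoidHom.mulLeft r) w q

theorem deconcSum_mul_right (w : List ι) (q : List ι → List ι → R) (r : R) :
    deconcSum w q * r = deconcSum w fun a b => q a b * r :=
  map_deconcSum (AddMonoidHom.mulRight r) w q

theorem shuffleSum_mul_left (a b : List ι) (y : List ι → R) (r : R) :
    r * shuffleSum a b y = shuffleSum a b fun M => r * y M :=
  map_shuffleSum (AddMonoidHom.mulLeft r) a b y

end Mul

variable {ι κ R : Type*} [Fintype ι] [CommRing R]

/-- The pairing `∑_{|w| ≤ N} x_w F(w)` of a truncated tensor with coordinates `x` with a linear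
functional given by its values `F` on words. -/
def wordSum (N : ℕ) (x F : List ι → R) : R := ∑ w ∈ wordsLE ι N, x w * F w

/-- Coordinates `x` of a group-like element: they define a character of the shuffle algebra. -/
def IsShuffleCharacter (x : List ι → R) : Prop :=
  ∀ a b, x a * x b = shuffleSum a b x

theorem wordSum_mul_right (N : ℕ) (x F : List ι → R) (r : R) :
    wordSum N x F * r = wordSum N x fun w => F w * r := by
  simp only [wordSum, Finset.sum_mul, mul_assoc]

theorem wordSum_mul_left (N : ℕ) (x F : List ι → R) (r : R) :
    r * wordSum N x F = wordSum N x fun w => r * F w := by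
  simp only [wordSum, Finset.mul_sum, mul_left_comm]

theorem wordSum_comm (N : ℕ) (x y : List ι → R) (F : List ι → List ι → R) :
    wordSum N x (fun u => wordSum N y (F u)) = wordSum N y fun v => wordSum N x fun u => F u v := by
  simp only [wordSum, Finset.mul_sum]
  rw [Finset.sum_comm]
  simp only [mul_left_comm]

theorem wordSum_splitSum {β : Type*} (N : ℕ) (x : List ι → R) (w : List β)
    (q : List β → List β → List ι → R) :
    wordSum N x (fun u => splitSum w fun a b => q a b u) =
      splitSum w fun a b => wordSum N x (q a b) := by
  simp only [wordSum, splitSum_sum, splitSum_mul_left]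

theorem wordSum_deconcSum {β : Type*} (N : ℕ) (x : List ι → R) (w : List β)
    (q : List β → List β → List ι → R) :
    wordSum N x (fun u => deconcSum w fun a b => q a b u) =
      deconcSum w fun a b => wordSum N x (q a b) := by
  simp only [wordSum, deconcSum_sum]
  refine Finset.sum_congr rfl fun u _ => ?_
  exact map_deconcSum (AddMonoidHom.mulLeft (x u)) w _

theorem wordSum_shuffleSum {β : Type*} (N : ℕ) (x : List ι → R) (K L : List β)
    (y : List β → List ι → R) :
    wordSum N x (fun u => shuffleSum K L fun M => y M u) =
      shuffleSum K L fun M => wordSum N x (y M) := by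
  simp only [wordSum, shuffleSum_sum]
  refine Finset.sum_congr rfl fun u _ => ?_
  exact map_shuffleSum (AddMonoidHom.mulLeft (x u)) K L _

/-- A group-like element turns the deshuffling coproduct into a product. -/
theorem IsShuffleCharacter.wordSum_splitSum_self {N : ℕ} {x : List ι → R}
    (hx : IsShuffleCharacter x) (hN : ∀ w, N < w.length → x w = 0) (q : List ι → List ι → R) :
    wordSum N x (fun w => splitSum w q) = wordSum N x fun a => wordSum N x fun b => q a b := by
  classical
  have h1 : ∀ w ∈ wordsLE ι N, splitSum w q = ∑ a ∈ wordsLE ι N, ∑ b ∈ wordsLE ι N,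
      q a b * shuffleSum a b fun M => if M = w then 1 else 0 := by
    intro w hw
    rw [mem_wordsLE] at hw
    simp only [shuffleSum_single, splitSum_mul_left]
    simp only [← splitSum_sum]
    refine splitSum_congr_length fun a b hab => ?_
    rw [Finset.sum_eq_single a, Finset.sum_eq_single b]
    · simp
    · intro c _ hc; simp [Ne.symm hc]
    · intro h; exact absurd (mem_wordsLE.2 (by omega)) h
    · intro c _ hc
      exact Finset.sum_eq_zero fun v _ => by simp [Ne.symm hc]
    · intro h; exact absurd (mem_wordsLE.2 (by omega)) h
  have h2 : ∀ M, ∑ w ∈ wordsLE ι N, x w * (if M = w then 1 else 0) = x M := by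
    intro M
    simp only [mul_ite, mul_one, mul_zero, Finset.sum_ite_eq]
    by_cases hM : M ∈ wordsLE ι N
    · simp [hM]
    · rw [if_neg hM, hN M (by simpa [mem_wordsLE] using hM)]
  unfold wordSum
  rw [Finset.sum_congr rfl fun w hw => congrArg (x w * ·) (h1 w hw)]
  simp only [Finset.mul_sum]
  rw [Finset.sum_comm]
  refine Finset.sum_congr rfl fun a _ => ?_
  rw [Finset.sum_comm]
  refine Finset.sum_congr rfl fun b _ => ?_
  rw [← mul_assoc, hx a b, mul_comm, ← show shuffleSum a b (fun M => ∑ w ∈ wordsLE ι N,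
    x w * (if M = w then 1 else 0)) = shuffleSum a b x by simp only [h2], shuffleSum_sum,
    Finset.mul_sum]
  refine Finset.sum_congr rfl fun w _ => ?_
  rw [← shuffleSum_mul_left, mul_left_comm]

end Pairing

/-! ### The ordered-shuffle map on words -/

section OrderedShuffle

variable {ι κ R : Type*} [CommRing R]

/-- The coordinate, at the word `K` in the letters `κ`, of the ordered-shuffle image of the word
`w`. All words are written backwards, so that the head of a list is the last letter of a tensor;
`h k` is the `k`-th coordinate of a linear map on `T(V)`. The recursion singles out the block that
contains the last letter of `w`: it is the last one in the order of the last letters, it is sent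
to the last letter of `K`, and the other blocks form an ordered shuffle of the remaining letters. -/
def orderedShuffleCoord (h : κ → List ι → R) : List κ → List ι → R
  | [], [] => 1
  | [], _ :: _ => 0
  | _ :: _, [] => 0
  | k :: K, x :: w => splitSum w fun a b => orderedShuffleCoord h K a * h k (x :: b)

theorem orderedShuffleCoord_eq_zero (h : κ → List ι → R) {K : List κ} {w : List ι}
    (hw : w.length < K.length) : orderedShuffleCoord h K w = 0 := by
  induction K generalizing w with
  | nil => simp at hw
  | cons k K ih =>
    rcases w with _ | ⟨x, w⟩
    · rfl
    · rw [orderedShuffleCoord]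
      refine (splitSum_congr_length fun a b hab => ?_).trans (splitSum_zero w)
      rw [ih (by simp only [List.length_cons] at hw; omega), zero_mul]

theorem splitSum_nil_mul (h : κ → List ι → R) (w : List ι) (f : List ι → R) :
    (splitSum w fun a b => orderedShuffleCoord h [] a * f b) = f w := by
  induction w generalizing f with
  | nil => simp [splitSum, orderedShuffleCoord]
  | cons y w ih =>
    simp only [splitSum, orderedShuffleCoord, zero_mul, splitSum_zero, zero_add]
    exact ih fun b => f (y :: b)

theorem orderedShuffleCoord_singleton (h : κ → List ι → R) (k : κ) (w : List ι) :
    orderedShuffleCoord h [k] w = if w = [] then 0 else h k w := by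
  rcases w with _ | ⟨x, w⟩
  · rfl
  · simp only [orderedShuffleCoord, reduceCtorEq, if_false]
    exact splitSum_nil_mul h w fun b => h k (x :: b)

/-- The ordered-shuffle map is a morphism for the deshuffling coproducts, hence it sends
group-like elements to group-like elements. -/
theorem shuffleSum_orderedShuffleCoord (h : κ → List ι → R) (K L : List κ) (w : List ι) :
    (shuffleSum K L fun M => orderedShuffleCoord h M w) =
      splitSum w fun a b => orderedShuffleCoord h K a * orderedShuffleCoord h L b := by
  obtain ⟨n, hn⟩ : ∃ n, w.length = n := ⟨_, rfl⟩
  induction n using Nat.strong_induction_on generalizing K L w with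
  | _ n ih =>
  rcases K with _ | ⟨k, K⟩
  · simp only [shuffleSum_nil_left, splitSum_nil_mul]
  rcases L with _ | ⟨l, L⟩
  · rw [shuffleSum_nil_right, ← splitSum_comm]
    simp only [mul_comm _ (orderedShuffleCoord h [] _), splitSum_nil_mul]
  rcases w with _ | ⟨x, w⟩
  · simp [shuffleSum_cons_cons, splitSum, orderedShuffleCoord, shuffleSum_zero]
  rw [List.length_cons] at hn
  simp only [shuffleSum_cons_cons, splitSum, orderedShuffleCoord, shuffleSum_splitSum,
    splitSum_mul_right, splitSum_mul_left]
  refine congrArg₂ (· + ·) ?_ ?_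
  · have h1 : ∀ a b : List ι, a.length + b.length = w.length →
        (shuffleSum K (l :: L) fun M => orderedShuffleCoord h M a * h k (x :: b)) =
          splitSum a fun a₁ a₂ =>
            orderedShuffleCoord h K a₁ * orderedShuffleCoord h (l :: L) a₂ * h k (x :: b) := by
      intro a b hab
      rw [← splitSum_mul_right, ← ih a.length (by omega) _ _ _ rfl]
      exact (map_shuffleSum (AddMonoidHom.mulRight (h k (x :: b))) K (l :: L) _).symm
    rw [splitSum_congr_length h1]
    rw [splitSum_assoc w fun a₁ a₂ b =>
      orderedShuffleCoord h K a₁ * orderedShuffleCoord h (l :: L) a₂ * h k (x :: b)]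
    rw [splitSum_assoc w fun a₁ a₂ b =>
      orderedShuffleCoord h K a₁ * h k (x :: a₂) * orderedShuffleCoord h (l :: L) b]
    refine splitSum_congr_length fun a b _ => ?_
    rw [← splitSum_comm]
    exact splitSum_congr_length fun _ _ _ => by ring
  · have h1 : ∀ a b : List ι, a.length + b.length = w.length →
        (shuffleSum (k :: K) L fun M => orderedShuffleCoord h M a * h l (x :: b)) =
          splitSum a fun a₁ a₂ =>
            orderedShuffleCoord h (k :: K) a₁ * orderedShuffleCoord h L a₂ * h l (x :: b) := by
      intro a b hab
      rw [← splitSum_mul_right, ← ih a.length (by omega) _ _ _ rfl]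
      exact (map_shuffleSum (AddMonoidHom.mulRight (h l (x :: b))) (k :: K) L _).symm
    rw [splitSum_congr_length h1]
    rw [splitSum_assoc w fun a₁ a₂ b =>
      orderedShuffleCoord h (k :: K) a₁ * orderedShuffleCoord h L a₂ * h l (x :: b)]
    exact splitSum_congr_length fun _ _ _ => splitSum_congr_length fun _ _ _ => by ring

section Multiplicative

variable [Fintype ι]

/-- For a group-like element `g` with coordinates `x` and `h_g = h(g · )`, the ordered-shuffle map
of `h` sends `g a` to the product of the image of `g` and of the image of `a` under the
ordered-shuffle map of `h_g`. -/
theorem wordSum_orderedShuffleCoord_append {N : ℕ} {x : List ι → R}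
    (hx : IsShuffleCharacter x) (hN : ∀ w, N < w.length → x w = 0)
    (h : κ → List ι → R) (K : List κ) (v : List ι) :
    wordSum N x (fun u => orderedShuffleCoord h K (v ++ u)) =
      deconcSum K fun K₂ K₁ => wordSum N x (orderedShuffleCoord h K₁) *
        orderedShuffleCoord (fun k v => wordSum N x fun u => h k (v ++ u)) K₂ v := by
  induction K generalizing v with
  | nil =>
    rcases v with _ | ⟨y, v⟩
    · simp [deconcSum, orderedShuffleCoord]
    · simp [deconcSum, orderedShuffleCoord, wordSum]
  | cons k K ih =>
    rcases v with _ | ⟨y, v⟩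
    · simp [deconcSum, orderedShuffleCoord, deconcSum_zero]
    · simp only [List.cons_append, deconcSum, orderedShuffleCoord, mul_zero, zero_add,
        splitSum_append]
      rw [wordSum_splitSum]
      simp only [hx.wordSum_splitSum_self hN, ← wordSum_mul_right, ← wordSum_mul_left, ih,
        deconcSum_mul_right, splitSum_deconcSum, splitSum_mul_left, mul_assoc]

end Multiplicative

end OrderedShuffle

/-! ### Ordered shuffles modulo the last ideal of a filtration -/

section Filtration

variable {ι κ R : Type*} [CommRing R]

/-- A decreasing multiplicative filtration by ideals that vanishes in degree `N + 1`. In the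
application, degree `m` stands for the order `O(ω(s, t)^{m/p})`. -/
structure IsFiltration (I : ℕ → Ideal R) (N : ℕ) : Prop where
  anti : Antitone I
  zero : I 0 = ⊤
  mul_mem : ∀ {i j a b}, a ∈ I i → b ∈ I j → a * b ∈ I (i + j)
  bot : I (N + 1) = ⊥

theorem splitSum_mem (J : Ideal R) (w : List ι) (q : List ι → List ι → R)
    (h : ∀ a b, a.length + b.length = w.length → q a b ∈ J) : splitSum w q ∈ J := by
  induction w generalizing q with
  | nil => exact h [] [] rfl
  | cons x w ih =>
    refine J.add_mem (ih _ fun a b hab => h _ _ ?_) (ih _ fun a b hab => h _ _ ?_) <;>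
      simp only [List.length_cons] <;> omega

namespace IsFiltration

variable {I : ℕ → Ideal R} {N : ℕ}

theorem mul_mem_of_le (hI : IsFiltration I N) {i j m : ℕ} {a b : R} (ha : a ∈ I i) (hb : b ∈ I j)
    (hm : m ≤ i + j) : a * b ∈ I m :=
  hI.anti hm (hI.mul_mem ha hb)

theorem eq_zero (hI : IsFiltration I N) {m : ℕ} {a : R} (ha : a ∈ I m) (hm : N < m) : a = 0 := by
  have : a ∈ I (N + 1) := hI.anti hm ha
  simpa [hI.bot] using this

theorem mul_eq_zero (hI : IsFiltration I N) {i j : ℕ} {a b : R} (ha : a ∈ I i) (hb : b ∈ I j)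
    (hm : N < i + j) : a * b = 0 :=
  hI.eq_zero (hI.mul_mem ha hb) hm

theorem mem_zero (hI : IsFiltration I N) (a : R) : a ∈ I 0 := by simp [hI.zero]

/-- Exchanging `h` for `h'` in the ordered-shuffle map costs an error of order at most
`N + |K| - 1`, once paired with an element whose coordinate at `w` has order `|w|`. -/
theorem orderedShuffleCoord_sub_mem (hI : IsFiltration I N) {h h' : κ → List ι → R}
    (hh : ∀ k v, h k v - h' k v ∈ I (N - v.length)) {K : List κ} (hK : 1 ≤ K.length)
    (w : List ι) :
    orderedShuffleCoord h K w - orderedShuffleCoord h' K w ∈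
      I (N + (K.length - 1) - w.length) := by
  induction K generalizing w with
  | nil => simp at hK
  | cons k K ih =>
    rcases w with _ | ⟨x, w⟩
    · simp [orderedShuffleCoord]
    rcases K with _ | ⟨k', K⟩
    · simpa [orderedShuffleCoord_singleton] using hh k (x :: w)
    simp only [orderedShuffleCoord.eq_4 _ k]
    rw [sub_eq_add_neg, ← neg_one_mul, splitSum_mul_left, ← splitSum_add]
    refine splitSum_mem _ _ _ fun a b hab => ?_
    have h1 := ih (by simp) a
    have h2 := hh k (x :: b)
    set A := orderedShuffleCoord h (k' :: K) a
    set A' := orderedShuffleCoord h' (k' :: K) a with hA'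
    have : A * h k (x :: b) + -1 * (A' * h' k (x :: b)) =
        (A - A') * h k (x :: b) + A' * (h k (x :: b) - h' k (x :: b)) := by ring
    rw [this]
    simp only [List.length_cons] at h1 h2 hab ⊢
    refine Ideal.add_mem _ ?_ ?_
    · exact hI.mul_mem_of_le h1 (hI.mem_zero _) (by omega)
    · by_cases hlt : a.length < (k' :: K).length
      · rw [hA', orderedShuffleCoord_eq_zero _ hlt, zero_mul]; exact Ideal.zero_mem _
      · simp only [List.length_cons] at hlt
        exact hI.mul_mem_of_le (hI.mem_zero _) h2 (by omega)

variable [Fintype ι]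

theorem wordSum_mem {J : Ideal R} {x F : List ι → R}
    (h : ∀ w, w.length ≤ N → x w * F w ∈ J) : wordSum N x F ∈ J :=
  Ideal.sum_mem _ fun w hw => h w (mem_wordsLE.1 hw)

theorem wordSum_orderedShuffleCoord_mem (hI : IsFiltration I N) {x : List ι → R}
    (hx : ∀ w, x w ∈ I w.length) (h : κ → List ι → R) (K : List κ) :
    wordSum N x (orderedShuffleCoord h K) ∈ I K.length := by
  refine wordSum_mem fun w _ => ?_
  by_cases hw : w.length < K.length
  · rw [orderedShuffleCoord_eq_zero h hw, mul_zero]; exact Ideal.zero_mem _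
  · exact hI.mul_mem_of_le (hx w) (hI.mem_zero _) (by omega)

theorem wordSum_nil {x : List ι → R} (hx1 : x [] = 1) (h : κ → List ι → R) :
    wordSum N x (orderedShuffleCoord h []) = 1 := by
  rw [wordSum, Finset.sum_eq_single []]
  · simp [hx1, orderedShuffleCoord]
  · intro w _ hw
    rcases w with _ | ⟨y, w⟩
    · exact absurd rfl hw
    · simp [orderedShuffleCoord]
  · intro hn; exact absurd (mem_wordsLE.2 (by simp)) hn

/-- Pairing with a product `x ⋆ y` of truncated tensors. -/
theorem wordSum_mul (hI : IsFiltration I N) {x y z : List ι → R}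
    (hx : ∀ w, x w ∈ I w.length) (hy : ∀ w, y w ∈ I w.length)
    (hz : ∀ w, w.length ≤ N → z w = deconcSum w fun v u => x u * y v) (F : List ι → R) :
    wordSum N z F = wordSum N y fun v => wordSum N x fun u => F (v ++ u) := by
  rw [wordSum_comm]
  have h1 : wordSum N z F =
      ∑ w ∈ wordsLE ι N, deconcSum w fun v u => x u * y v * F (v ++ u) := by
    refine Finset.sum_congr rfl fun w hw => ?_
    rw [hz w (mem_wordsLE.1 hw), deconcSum_mul_right]
    exact deconcSum_congr fun v u hvu => by rw [hvu]
  rw [h1, sum_deconcSum]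
  simp only [wordSum, Finset.mul_sum]
  refine Finset.sum_congr rfl fun u _ => Finset.sum_congr rfl fun v _ => ?_
  split_ifs with hN
  · ring
  · rw [← mul_assoc, hI.mul_eq_zero (hx u) (hy v) (by omega), zero_mul]

/-- The ordered-shuffle map is multiplicative up to order `N + 1` on words of length at least two,
even after a perturbation of order `N` of its components on letters. -/
theorem deconcSum_wordSum_eq (hI : IsFiltration I N) {x y z : List ι → R}
    (hx : ∀ w, x w ∈ I w.length) (hy : ∀ w, y w ∈ I w.length)
    (hy1 : y [] = 1) (hxc : IsShuffleCharacter x)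
    (hz : ∀ w, w.length ≤ N → z w = deconcSum w fun v u => x u * y v)
    {h h' : κ → List ι → R}
    (hh : ∀ k v, (wordSum N x fun u => h k (v ++ u)) - h' k v ∈ I (N - v.length))
    {P Q : List κ → R} (hP : ∀ K, K.length ≠ 1 → P K = wordSum N x (orderedShuffleCoord h K))
    (hP1 : ∀ K, K.length = 1 → wordSum N x (orderedShuffleCoord h K) - P K ∈ I N)
    (hPm : ∀ K, P K ∈ I K.length)
    (hQ : ∀ K, K.length ≠ 1 → Q K = wordSum N y (orderedShuffleCoord h' K))
    (hQ1 : ∀ K, K.length = 1 → wordSum N y (orderedShuffleCoord h' K) - Q K ∈ I N)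
    {K : List κ} (hK : 2 ≤ K.length) :
    (deconcSum K fun K₂ K₁ => P K₁ * Q K₂) = wordSum N z (orderedShuffleCoord h K) := by
  have hxN : ∀ w : List ι, N < w.length → x w = 0 := fun w hw => hI.eq_zero (hx w) hw
  rw [hI.wordSum_mul hx hy hz]
  simp only [wordSum_orderedShuffleCoord_append hxc hxN, wordSum_deconcSum]
  simp only [← wordSum_mul_left]
  refine deconcSum_congr fun K₂ K₁ hK12 => ?_
  set g : κ → List ι → R := fun k v => wordSum N x fun u => h k (v ++ u)
  have hlen : K₂.length + K₁.length = K.length := by rw [← hK12, List.length_append]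
  set A := wordSum N x (orderedShuffleCoord h K₁) with hA
  set B := wordSum N y (orderedShuffleCoord g K₂) with hB
  have hAm : A ∈ I K₁.length := hI.wordSum_orderedShuffleCoord_mem hx h K₁
  have hBm : B ∈ I K₂.length := hI.wordSum_orderedShuffleCoord_mem hy g K₂
  have hAP : A - P K₁ ∈ I (N + 1 - K₂.length) := by
    by_cases h1 : K₁.length = 1
    · exact hI.anti (by omega) (hP1 K₁ h1)
    · rw [hP K₁ h1, sub_self]; exact Ideal.zero_mem _
  have hB' : B - wordSum N y (orderedShuffleCoord h' K₂) ∈ I (N + (K₂.length - 1)) := by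
    rcases K₂ with _ | ⟨k, K₂⟩
    · rw [hB, wordSum_nil hy1, wordSum_nil hy1, sub_self]; exact Ideal.zero_mem _
    have : B - wordSum N y (orderedShuffleCoord h' (k :: K₂)) = wordSum N y fun w =>
        orderedShuffleCoord g (k :: K₂) w - orderedShuffleCoord h' (k :: K₂) w := by
      simp only [hB, wordSum, mul_sub, Finset.sum_sub_distrib]
    rw [this]
    refine wordSum_mem fun w _ => ?_
    exact hI.mul_mem_of_le (hy w) (hI.orderedShuffleCoord_sub_mem hh (by simp) w) (by omega)
  have hBQ : K₂.length = 0 ∧ B - Q K₂ = 0 ∨ B - Q K₂ ∈ I N ∧ (2 ≤ K₂.length → B - Q K₂ = 0) := by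
    rcases Nat.lt_trichotomy K₂.length 1 with h0 | h1 | h2
    · left
      have : K₂ = [] := List.length_eq_zero_iff.1 (by omega)
      subst this
      simp [hQ [] (by simp), hB, wordSum_nil hy1]
    · right
      refine ⟨?_, fun h => by omega⟩
      have := Ideal.add_mem _ (hI.anti (by omega) hB') (hQ1 K₂ h1)
      simpa using this
    · right
      have : B - Q K₂ = 0 := by
        rw [hQ K₂ (by omega)]
        exact hI.eq_zero hB' (by omega)
      exact ⟨by rw [this]; exact Ideal.zero_mem _, fun _ => this⟩
  have e1 : (A - P K₁) * B = 0 := by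
    by_cases hl : K₂.length ≤ N + 1
    · exact hI.mul_eq_zero hAP hBm (by omega)
    · rw [hI.eq_zero hBm (by omega), mul_zero]
  have e2 : P K₁ * (B - Q K₂) = 0 := by
    rcases hBQ with ⟨_, h0⟩ | ⟨h1, h2⟩
    · rw [h0, mul_zero]
    · by_cases h3 : 2 ≤ K₂.length
      · rw [h2 h3, mul_zero]
      · exact hI.mul_eq_zero (hPm K₁) h1 (by omega)
  linear_combination -e1 - e2

/-- The ordered-shuffle map preserves group-like elements up to order `N + 1`, even after a
perturbation of order `N` of its components on letters. -/
theorem shuffleSum_wordSum_eq (hI : IsFiltration I N) {x : List ι → R}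
    (hx : ∀ w, x w ∈ I w.length) (hxc : IsShuffleCharacter x) {h : κ → List ι → R}
    {P : List κ → R} (hP : ∀ K, K.length ≠ 1 → P K = wordSum N x (orderedShuffleCoord h K))
    (hP1 : ∀ K, K.length = 1 → wordSum N x (orderedShuffleCoord h K) - P K ∈ I N)
    (hPm : ∀ K, P K ∈ I K.length)
    {K L : List κ} (hK : 1 ≤ K.length) (hL : 1 ≤ L.length) :
    P K * P L = shuffleSum K L P := by
  have hxN : ∀ w : List ι, N < w.length → x w = 0 := fun w hw => hI.eq_zero (hx w) hw
  have h1 : shuffleSum K L P =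
      wordSum N x (orderedShuffleCoord h K) * wordSum N x (orderedShuffleCoord h L) := by
    rw [shuffleSum_congr fun M hM => hP M (by omega), ← wordSum_shuffleSum]
    simp only [shuffleSum_orderedShuffleCoord, hxc.wordSum_splitSum_self hxN]
    simp only [← wordSum_mul_left, ← wordSum_mul_right]
  rw [h1]
  have hdiff : ∀ K : List κ, wordSum N x (orderedShuffleCoord h K) - P K ∈ I N := by
    intro K
    by_cases hk : K.length = 1
    · exact hP1 K hk
    · rw [hP K hk, sub_self]; exact Ideal.zero_mem _
  have e1 := hI.mul_eq_zero (hdiff K) (hI.wordSum_orderedShuffleCoord_mem hx h L) (by omega)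
  have e2 := hI.mul_eq_zero (hPm K) (hdiff L) (by omega)
  linear_combination -e1 - e2

end IsFiltration

end Filtration

/-! ### Distributions of the letters of a word into blocks -/

section BlockSums

variable {α β J E : Type*} [AddCommMonoid E]

theorem splitSum_reverse (w : List α) (q : List α → List α → E) :
    splitSum w.reverse q = splitSum w fun a b => q a.reverse b.reverse := by
  induction w generalizing q with
  | nil => rfl
  | cons x w ih =>
    simp only [List.reverse_cons, splitSum_append, splitSum, List.append_nil, splitSum_add, ih]

theorem splitSum_map (f : α → β) (w : List α) (q : List β → List β → E) :
    splitSum (w.map f) q = splitSum w fun a b => q (a.map f) (b.map f) := by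
  induction w generalizing q with
  | nil => rfl
  | cons x w ih => simp only [List.map_cons, splitSum, ih]

variable [Fintype J] [DecidableEq J]

/-- The sum of `G` over all distributions of the letters of a word into blocks labelled by `J`;
every block keeps the order of its letters. -/
def blockSum : List α → ((J → List α) → E) → E
  | [], G => G fun _ => []
  | x :: w, G => ∑ j : J, blockSum w fun B => G (Function.update B j (x :: B j))

theorem blockSum_congr {w : List α} {G G' : (J → List α) → E}
    (h : ∀ B : J → List α, (∀ j, (B j).Sublist w) → (∀ x ∈ w, ∃ j, x ∈ B j) →
      ∑ j, (B j).length = w.length → G B = G' B) : blockSum w G = blockSum w G' := by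
  induction w generalizing G G' with
  | nil => exact h _ (fun _ => List.Sublist.refl _) (by simp) (by simp)
  | cons x w ih =>
    refine Finset.sum_congr rfl fun j _ => ih fun B hB hc hl => h _ (fun i => ?_) ?_ ?_
    · by_cases hij : i = j
      · subst hij; simpa using (hB i).cons_cons x
      · simpa [Function.update_of_ne hij] using (hB i).cons x
    · intro y hy
      rcases List.mem_cons.1 hy with rfl | hy
      · exact ⟨j, by simp⟩
      · obtain ⟨i, hi⟩ := hc y hy
        refine ⟨i, ?_⟩
        by_cases hij : i = j
        · subst hij; simp [hi]
        · simpa [Function.update_of_ne hij] using hi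
    · rw [List.length_cons, ← hl, ← Finset.sum_erase_add _ _ (Finset.mem_univ j),
        ← Finset.sum_erase_add _ (fun j => (B j).length) (Finset.mem_univ j)]
      rw [Finset.sum_congr rfl fun i hi => by
        rw [Function.update_of_ne (Finset.ne_of_mem_erase hi)]]
      simp [add_assoc]

theorem blockSum_zero (w : List α) : blockSum w (fun _ : J → List α => (0 : E)) = 0 := by
  induction w with
  | nil => rfl
  | cons x w ih => simp [blockSum, ih]

theorem blockSum_sum {ι : Type*} (s : Finset ι) (w : List α) (G : ι → (J → List α) → E) :
    blockSum w (fun B => ∑ i ∈ s, G i B) = ∑ i ∈ s, blockSum w (G i) := by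
  induction w generalizing G with
  | nil => rfl
  | cons x w ih => simp only [blockSum, ih]; exact Finset.sum_comm

theorem blockSum_map (f : α → β) (w : List α) (G : (J → List β) → E) :
    blockSum (w.map f) G = blockSum w fun B => G fun j => (B j).map f := by
  induction w generalizing G with
  | nil => rfl
  | cons x w ih =>
    simp only [List.map_cons, blockSum, ih]
    refine Finset.sum_congr rfl fun j _ => congrArg _ (funext fun B => congrArg _ ?_)
    ext1 i
    by_cases hij : i = j
    · subst hij; simp
    · simp [Function.update_of_ne hij]

theorem blockSum_concat (w : List α) (x : α) (G : (J → List α) → E) :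
    blockSum (w ++ [x]) G = ∑ j : J, blockSum w fun B => G (Function.update B j (B j ++ [x])) := by
  induction w generalizing G with
  | nil => rfl
  | cons y w ih =>
    simp only [List.cons_append, blockSum, ih]
    rw [Finset.sum_comm]
    refine Finset.sum_congr rfl fun j _ => Finset.sum_congr rfl fun i _ =>
      congrArg _ (funext fun B => congrArg _ ?_)
    ext1 k
    by_cases hij : i = j
    · subst hij
      by_cases hk : k = i
      · subst hk; simp
      · simp [Function.update_of_ne hk]
    · by_cases hk : k = i
      · subst hk; simp [Function.update_of_ne hij]
      · by_cases hk' : k = j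
        · subst hk'; simp [Function.update_of_ne hk]
        · simp [Function.update_of_ne hk, Function.update_of_ne hk']

theorem blockSum_reverse (w : List α) (G : (J → List α) → E) :
    blockSum w.reverse G = blockSum w fun B => G fun j => (B j).reverse := by
  induction w generalizing G with
  | nil => rfl
  | cons x w ih =>
    rw [List.reverse_cons, blockSum_concat, blockSum]
    refine Finset.sum_congr rfl fun j _ => ?_
    rw [ih]
    refine congrArg _ (funext fun B => congrArg _ ?_)
    ext1 i
    by_cases hij : i = j
    · subst hij; simp
    · simp [Function.update_of_ne hij]

theorem blockSum_bool (w : List α) (G : (Bool → List α) → E) :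
    blockSum w G = splitSum w fun a b => G fun t => cond t b a := by
  induction w generalizing G with
  | nil => exact congrArg G (by ext1 t; simp)
  | cons x w ih =>
    rw [blockSum, Fintype.sum_bool, splitSum, add_comm, ih, ih]
    refine congrArg₂ (· + ·) ?_ ?_ <;>
    · refine congrArg _ (funext fun a => funext fun b => congrArg _ ?_)
      ext1 t
      cases t <;> simp

/-- Distributing letters into `m + 1` blocks amounts to choosing the last block, and distributing
the complementary subword into `m` blocks. -/
theorem blockSum_snoc {m : ℕ} (w : List α) (G : (Fin (m + 1) → List α) → E) :
    blockSum w G = splitSum w fun a b =>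
      blockSum a fun B => G (Fin.snoc (α := fun _ => List α) B b) := by
  induction w generalizing G with
  | nil =>
    refine congrArg G (funext fun i => ?_)
    refine Fin.lastCases ?_ (fun i => ?_) i <;> simp
  | cons x w ih =>
    rw [blockSum, Fin.sum_univ_castSucc, splitSum]
    refine congrArg₂ (· + ·) ?_ ?_
    · simp only [blockSum, ih, splitSum_sum]
      refine Finset.sum_congr rfl fun j _ => ?_
      simp only [Fin.snoc_update, Fin.snoc_castSucc]
    · simp only [ih, Fin.update_snoc_last, Fin.snoc_last]

/-- A distribution of the letters into blocks is a map `c` from positions to labels. -/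
theorem sum_blocks {n : ℕ} (f : Fin n → α) (G : (J → List α) → E) :
    ∑ c : Fin n → J, G (fun j => ((List.finRange n).filter (c · = j)).map f) =
      blockSum (List.ofFn f) G := by
  induction n generalizing G with
  | zero => simp [blockSum, List.finRange_zero]
  | succ n ih =>
    rw [List.ofFn_succ, blockSum, ← (Fin.consEquiv fun _ => J).sum_comp, Fintype.sum_prod_type]
    refine Finset.sum_congr rfl fun j _ => ?_
    rw [← ih]
    refine Finset.sum_congr rfl fun c _ => congrArg _ (funext fun i => ?_)
    rw [List.finRange_succ, List.filter_cons, List.filter_map]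
    by_cases hij : j = i
    · subst hij
      simp [Function.comp_def, Fin.consEquiv]
    · simp [Function.comp_def, Fin.consEquiv, hij, Function.update_of_ne (Ne.symm hij)]

open Classical in
/-- The permutations that are increasing on each block of a given partition of the letters
correspond to the distributions of the letters into blocks of the given sizes. -/
theorem sum_strictMono_perm {n : ℕ} (ν : J → ℕ) (P : (Σ j, Fin (ν j)) ≃ Fin n)
    (G : (J → List (Fin n)) → E) :
    ∑ σ ∈ Finset.univ.filter (fun σ : Equiv.Perm (Fin n) =>
        ∀ j, StrictMono fun a : Fin (ν j) => σ (P ⟨j, a⟩)),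
      G (fun j => List.ofFn fun a : Fin (ν j) => σ (P ⟨j, a⟩)) =
    blockSum (List.finRange n) fun B => if ∀ j, (B j).length = ν j then G B else 0 := by
  have hlist : ∀ σ : Equiv.Perm (Fin n), (∀ j, StrictMono fun a : Fin (ν j) => σ (P ⟨j, a⟩)) →
      ∀ j, (List.finRange n).filter (fun x => (P.symm (σ.symm x)).1 = j) =
        List.ofFn fun a : Fin (ν j) => σ (P ⟨j, a⟩) := by
    intro σ hσ j
    have hs1 : ((List.finRange n).filter (fun x => (P.symm (σ.symm x)).1 = j)).Pairwise (· < ·) :=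
      (List.pairwise_lt_finRange n).filter _
    have hs2 : (List.ofFn fun a : Fin (ν j) => σ (P ⟨j, a⟩)).Pairwise (· < ·) := by
      rw [List.pairwise_ofFn]; exact fun _ _ h => hσ j h
    refine List.Perm.eq_of_pairwise (fun a b _ _ h1 h2 => absurd h1 (lt_asymm h2)) hs1 hs2 ?_
    rw [List.perm_ext_iff_of_nodup (hs1.imp fun h => h.ne) (hs2.imp fun h => h.ne)]
    intro x
    simp only [List.mem_filter, List.mem_finRange, true_and, decide_eq_true_eq, List.mem_ofFn]
    constructor
    · rintro rfl
      exact ⟨(P.symm (σ.symm x)).2, by simp⟩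
    · rintro ⟨a, rfl⟩
      simp
  have h1 := sum_blocks (J := J) (fun x : Fin n => x)
    fun B => if ∀ j, (B j).length = ν j then G B else 0
  rw [show List.ofFn (fun x : Fin n => x) = List.finRange n from List.ofFn_id n] at h1
  simp only [List.map_id'] at h1
  rw [← h1, ← Finset.sum_filter]
  refine Finset.sum_bij (fun σ _ x => (P.symm (σ.symm x)).1) ?_ ?_ ?_ ?_
  · intro σ hσ
    simp only [Finset.mem_filter, Finset.mem_univ, true_and] at hσ ⊢
    intro j
    rw [hlist σ hσ j, List.length_ofFn]
  · intro σ hσ τ hτ he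
    simp only [Finset.mem_filter, Finset.mem_univ, true_and] at hσ hτ
    ext1 x
    obtain ⟨⟨j, a⟩, rfl⟩ := P.surjective x
    have h2 := hlist σ hσ j
    rw [show (fun x => decide ((P.symm (σ.symm x)).1 = j)) =
      fun x => decide ((P.symm (τ.symm x)).1 = j) from funext fun x => by
        rw [congrFun he x], hlist τ hτ j] at h2
    exact (congrFun (List.ofFn_injective h2) a).symm
  · intro c hc
    simp only [Finset.mem_filter, Finset.mem_univ, true_and] at hc
    set e : (Σ j, Fin (ν j)) → Fin n := fun ja =>
      ((List.finRange n).filter (c · = ja.1)).get (ja.2.cast (hc ja.1).symm) with he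
    have hce : ∀ ja, c (e ja) = ja.1 := fun ja => by
      simpa [he] using List.of_mem_filter (List.get_mem
        ((List.finRange n).filter (c · = ja.1)) (ja.2.cast (hc ja.1).symm))
    have hpw : ∀ j, ((List.finRange n).filter (c · = j)).Pairwise (· < ·) := fun j =>
      (List.pairwise_lt_finRange n).filter _
    have hmono : ∀ j, StrictMono fun a => e ⟨j, a⟩ := fun j a b hab =>
      List.pairwise_iff_get.1 (hpw j) _ _ hab
    have hbij : Function.Bijective e := by
      constructor
      · rintro ⟨j, a⟩ ⟨k, b⟩ hab
        have hjk : j = k := (hce ⟨j, a⟩).symm.trans ((congrArg c hab).trans (hce ⟨k, b⟩))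
        subst hjk
        rw [(hmono j).injective hab]
      · intro x
        have hx : x ∈ (List.finRange n).filter (c · = c x) := by simp
        obtain ⟨i, hi⟩ := List.get_of_mem hx
        exact ⟨⟨c x, i.cast (hc (c x))⟩, hi⟩
    refine ⟨P.symm.trans (Equiv.ofBijective e hbij), ?_, ?_⟩
    · simpa using hmono
    · ext1 x
      obtain ⟨ja, rfl⟩ := hbij.2 x
      have : (Equiv.ofBijective e hbij).symm (e ja) = ja :=
        (Equiv.ofBijective e hbij).symm_apply_apply ja
      simp [this, hce]
  · intro σ hσ
    simp only [Finset.mem_filter, Finset.mem_univ, true_and] at hσ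
    refine congrArg G (funext fun j => ?_)
    rw [← hlist σ hσ j]

end BlockSums

/-! ### Blocks ordered by their last letters -/

section LastLetters

variable {α ι κ R : Type*} [CommRing R]

theorem blockSum_mul_right {J : Type*} [Fintype J] [DecidableEq J] (w : List α)
    (G : (J → List α) → R) (r : R) : blockSum w G * r = blockSum w fun B => G B * r := by
  induction w generalizing G with
  | nil => rfl
  | cons x w ih => simp only [blockSum, Finset.sum_mul, ih]

/-- The blocks `B` are non-empty, and their elements of largest rank form an increasing
sequence. -/
def LastOrdered (r : α → ℕ) {m : ℕ} (B : Fin m → List α) : Prop :=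
  (∀ i, B i ≠ []) ∧ ∀ i i', i < i' → ∀ x ∈ B i, ∃ y ∈ B i', r x < r y

theorem lastOrdered_reverse {r : α → ℕ} {m : ℕ} {B : Fin m → List α} :
    LastOrdered r (fun j => (B j).reverse) ↔ LastOrdered r B := by
  simp [LastOrdered]

theorem lastOrdered_map {β : Type*} {r : α → ℕ} {f : β → α} {m : ℕ} {B : Fin m → List β} :
    LastOrdered r (fun j => (B j).map f) ↔ LastOrdered (fun x => r (f x)) B := by
  simp [LastOrdered]

/-- Inserting the letter `x` of largest rank at the head of the last block `b`. -/
theorem lastOrdered_snoc {r : α → ℕ} {m : ℕ} {B : Fin m → List α} {x : α} {b : List α}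
    (h : ∀ i, ∀ y ∈ B i, r y < r x) :
    LastOrdered r (Fin.snoc (α := fun _ => List α) B (x :: b)) ↔ LastOrdered r B := by
  constructor
  · rintro ⟨h1, h2⟩
    refine ⟨fun i => by simpa using h1 i.castSucc, fun i i' hi => ?_⟩
    simpa using h2 i.castSucc i'.castSucc hi
  · rintro ⟨h1, h2⟩
    refine ⟨fun i => ?_, fun i i' hi => ?_⟩
    · refine Fin.lastCases ?_ (fun i => ?_) i
      · simp
      · simpa using h1 i
    · revert hi
      refine Fin.lastCases ?_ (fun i' => ?_) i'
      · refine Fin.lastCases ?_ (fun i => ?_) i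
        · intro hi; exact absurd hi (lt_irrefl _)
        · intro _ y hy
          refine ⟨x, by simp, h i y (by simpa using hy)⟩
      · refine Fin.lastCases ?_ (fun i => ?_) i
        · intro hi; exact absurd hi (by simp [Fin.castSucc_lt_last, le_of_lt])
        · intro hi
          simpa using h2 i i' (by simpa using hi)

open Classical in
/-- The recursion that defines `orderedShuffleCoord` computes the sum over the distributions into
non-empty blocks that are ordered by their last letters. -/
theorem blockSum_lastOrdered (r : α → ℕ) (f : α → ι) (h : κ → List ι → R) {m : ℕ} (K : Fin m → κ)
    (w : List α) (hw : w.Pairwise fun x y => r y < r x) :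
    (blockSum w fun B : Fin m → List α =>
      if LastOrdered r B then ∏ i, h (K i) ((B i).map f) else 0) =
      orderedShuffleCoord h (List.ofFn K).reverse (w.map f) := by
  induction m generalizing w with
  | zero =>
    rcases w with _ | ⟨x, w⟩
    · simp [blockSum, LastOrdered, orderedShuffleCoord]
    · simp [blockSum, orderedShuffleCoord]
  | succ m ih =>
    rw [List.ofFn_succ', List.concat_eq_append, List.reverse_append, List.reverse_singleton,
      List.singleton_append]
    rcases w with _ | ⟨x, w⟩
    · rw [List.map_nil, orderedShuffleCoord, blockSum, if_neg]
      exact fun hB => hB.1 0 rfl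
    · rw [List.pairwise_cons] at hw
      rw [List.map_cons, orderedShuffleCoord, splitSum_map, blockSum_snoc, splitSum]
      have h0 : ∀ a b : List α, a.Sublist w → b.Sublist w → (a ++ b).Perm w →
          (blockSum (x :: a) fun B : Fin m → List α =>
            if LastOrdered r (Fin.snoc (α := fun _ => List α) B b) then
              ∏ i, h (K i) ((Fin.snoc (α := fun _ => List α) B b i).map f) else 0) = 0 := by
        intro a b ha hb _
        refine (blockSum_congr fun B _ hc _ => if_neg fun hB => ?_).trans (blockSum_zero _)
        obtain ⟨j, hj⟩ := hc x (by simp)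
        obtain ⟨y, hy, hxy⟩ := hB.2 j.castSucc (Fin.last m) (Fin.castSucc_lt_last j) x
          (by simpa using hj)
        simp only [Fin.snoc_last] at hy
        exact absurd hxy (lt_asymm (hw.1 y (hb.subset hy)))
      rw [splitSum_congr h0, splitSum_zero, zero_add]
      refine splitSum_congr fun a b ha hb _ => ?_
      rw [← ih (fun i => K i.castSucc) a (hw.2.sublist ha), blockSum_mul_right]
      refine blockSum_congr fun B hB _ _ => ?_
      have hlt : ∀ i, ∀ y ∈ B i, r y < r x := fun i y hy =>
        hw.1 y (ha.subset ((hB i).subset hy))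
      simp only [lastOrdered_snoc hlt, Fin.prod_univ_castSucc, Fin.snoc_castSucc, Fin.snoc_last,
        ite_mul, zero_mul, List.map_cons]

end LastLetters

/-! ### Coordinates on the tensor algebra -/

section Coordinates

variable {U κ : Type*} [AddCommGroup U] [Module ℝ U]

/-- The basis of `U^{⊗ n}` made of the tensors `b_{K 0} ⊗ ⋯ ⊗ b_{K (n - 1)}`. -/
def tensorBasis (b : Module.Basis κ ℝ U) (n : ℕ) : Module.Basis (Fin n → κ) ℝ (⨂[ℝ]^n U) :=
  Basis.piTensorProduct fun _ => b

theorem tensorBasis_apply (b : Module.Basis κ ℝ U) (n : ℕ) (K : Fin n → κ) :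
    tensorBasis b n K = PiTensorProduct.tprod ℝ fun i => b (K i) :=
  Basis.piTensorProduct_apply _ _

theorem tensorBasis_repr_tprod (b : Module.Basis κ ℝ U) (n : ℕ) (x : Fin n → U) (K : Fin n → κ) :
    (tensorBasis b n).repr (PiTensorProduct.tprod ℝ x) K = ∏ i, b.repr (x i) (K i) :=
  Basis.piTensorProduct_repr_tprod_apply _ _ _

/-- The coordinate of an element of `T(U)` at a word. The word is written backwards: its head is
the last letter. -/
def wordCoord (b : Module.Basis κ ℝ U) (w : List κ) : TAlg U →ₗ[ℝ] ℝ :=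
  (tensorBasis b w.length).coord (fun i => w.get i.rev) ∘ₗ
    DirectSum.component ℝ ℕ (fun n => ⨂[ℝ]^n U) w.length

/-- The basis tensor of a word, written backwards. -/
def wordTensor (b : Module.Basis κ ℝ U) (w : List κ) : TAlg U :=
  incl w.length (tensorBasis b w.length fun i => w.get i.rev)

theorem get_reverse_ofFn {n : ℕ} (K : Fin n → κ) (i : Fin (List.ofFn K).reverse.length)
    (h : (List.ofFn K).reverse.length = n) :
    (List.ofFn K).reverse.get i.rev = K (i.cast h) := by
  have hi : (i : ℕ) < n := by have := i.2; omega
  simp only [List.get_eq_getElem, List.getElem_reverse, List.getElem_ofFn]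
  congr 1
  ext
  simp only [Fin.val_rev, List.length_ofFn, List.length_reverse, Fin.val_cast]
  omega

theorem wordCoord_reverse_ofFn (b : Module.Basis κ ℝ U) {n : ℕ} (K : Fin n → κ) (a : TAlg U) :
    wordCoord b (List.ofFn K).reverse a = (tensorBasis b n).repr (a n) K := by
  have key : ∀ (w : List κ) (h : w.length = n), (∀ i : Fin w.length, w.get i.rev = K (i.cast h)) →
      wordCoord b w a = (tensorBasis b n).repr (a n) K := by
    rintro w rfl hK
    simp only [wordCoord, LinearMap.comp_apply, hK]
    rfl
  exact key _ (by simp) fun i => get_reverse_ofFn K i _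

theorem wordTensor_reverse_ofFn (b : Module.Basis κ ℝ U) {n : ℕ} (K : Fin n → κ) :
    wordTensor b (List.ofFn K).reverse = incl n (PiTensorProduct.tprod ℝ fun i => b (K i)) := by
  have key : ∀ (w : List κ) (h : w.length = n), (∀ i : Fin w.length, w.get i.rev = K (i.cast h)) →
      wordTensor b w = incl n (PiTensorProduct.tprod ℝ fun i => b (K i)) := by
    rintro w rfl hK
    simp only [wordTensor, tensorBasis_apply, hK]
    rfl
  exact key _ (by simp) fun i => get_reverse_ofFn K i _

theorem exists_eq_reverse_ofFn {n : ℕ} {w : List κ} (h : w.length = n) :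
    ∃ K : Fin n → κ, w = (List.ofFn K).reverse := by
  have h' : w.reverse.length = n := by simpa
  obtain ⟨K, hK⟩ : ∃ K : Fin n → κ, List.ofFn K = w.reverse := by
    subst h'
    exact ⟨w.reverse.get, List.ofFn_get _⟩
  exact ⟨K, by rw [hK, List.reverse_reverse]⟩

theorem incl_apply_self (n : ℕ) (a : ⨂[ℝ]^n U) : (incl n a) n = a :=
  DirectSum.of_eq_same _ _

theorem incl_apply_of_ne {m n : ℕ} (h : m ≠ n) (a : ⨂[ℝ]^m U) : (incl m a) n = 0 :=
  DirectSum.of_eq_of_ne _ _ _ h.symm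

theorem wordCoord_eq_zero_of_apply_eq_zero (b : Module.Basis κ ℝ U) {w : List κ} {a : TAlg U}
    (h : a w.length = 0) : wordCoord b w a = 0 := by
  simp only [wordCoord, LinearMap.comp_apply]
  rw [show (DirectSum.component ℝ ℕ (fun n => ⨂[ℝ]^n U) w.length) a = a w.length from rfl, h,
    map_zero]

theorem wordCoord_congr (b : Module.Basis κ ℝ U) {w : List κ} {a a' : TAlg U}
    (h : a w.length = a' w.length) : wordCoord b w a = wordCoord b w a' := by
  simp only [wordCoord, LinearMap.comp_apply]
  rw [show (DirectSum.component ℝ ℕ (fun n => ⨂[ℝ]^n U) w.length) a = a w.length from rfl, h]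
  rfl

theorem wordCoord_incl_of_ne (b : Module.Basis κ ℝ U) {n : ℕ} {w : List κ} (h : n ≠ w.length)
    (a : ⨂[ℝ]^n U) : wordCoord b w (incl n a) = 0 :=
  wordCoord_eq_zero_of_apply_eq_zero b (incl_apply_of_ne h a)

open Classical in
theorem wordCoord_wordTensor (b : Module.Basis κ ℝ U) (w v : List κ) :
    wordCoord b w (wordTensor b v) = if w = v then 1 else 0 := by
  by_cases hl : w.length = v.length
  · obtain ⟨K, rfl⟩ := exists_eq_reverse_ofFn hl
    obtain ⟨L, hL⟩ := exists_eq_reverse_ofFn (w := v) rfl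
    generalize v.length = n at K L hL
    subst hL
    rw [wordCoord_reverse_ofFn, wordTensor_reverse_ofFn, incl_apply_self, ← tensorBasis_apply,
      Module.Basis.repr_self, Finsupp.single_apply]
    simp [List.ofFn_injective.eq_iff, eq_comm]
  · rw [if_neg (fun h => hl (by rw [h])), wordTensor, wordCoord_incl_of_ne b (Ne.symm hl)]

theorem dual_apply_eq_sum [Fintype κ] (b : Module.Basis κ ℝ U) {n : ℕ} (ℓ : Module.Dual ℝ (⨂[ℝ]^n U))
    (a : TAlg U) : ℓ (a n) = ∑ K : Fin n → κ,
      wordCoord b (List.ofFn K).reverse a * ℓ (tensorBasis b n K) := by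
  conv_lhs => rw [← (tensorBasis b n).sum_repr (a n)]
  simp only [map_sum, map_smul, smul_eq_mul, wordCoord_reverse_ofFn]

theorem apply_eq_of_wordCoord_eq (b : Module.Basis κ ℝ U) {n : ℕ} {a a' : TAlg U}
    (h : ∀ w, w.length = n → wordCoord b w a = wordCoord b w a') : a n = a' n := by
  refine (tensorBasis b n).ext_elem fun K => ?_
  rw [← wordCoord_reverse_ofFn, ← wordCoord_reverse_ofFn]
  exact h _ (by simp)

/-- The product of the coordinates of the vectors of a list at the letters of a word, and `0` if
the lengths differ. -/
def listCoord (b : Module.Basis κ ℝ U) : List κ → List U → ℝ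
  | [], [] => 1
  | k :: K, x :: l => b.repr x k * listCoord b K l
  | _, _ => 0

theorem listCoord_append (b : Module.Basis κ ℝ U) (w : List κ) (l l' : List U) :
    listCoord b w (l ++ l') = deconcSum w fun v u => listCoord b v l * listCoord b u l' := by
  induction l generalizing w with
  | nil =>
    rcases w with _ | ⟨k, w⟩
    · simp [deconcSum, listCoord]
    · simp [deconcSum, listCoord, deconcSum_zero]
  | cons x l ih =>
    rcases w with _ | ⟨k, w⟩
    · simp [deconcSum, listCoord]
    · simp only [List.cons_append, listCoord, ih, deconcSum, zero_mul, zero_add, mul_assoc]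
      exact map_deconcSum (AddMonoidHom.mulLeft (b.repr x k)) w _

theorem listCoord_reverse_ofFn (b : Module.Basis κ ℝ U) {n : ℕ} (K : Fin n → κ) (x : Fin n → U) :
    listCoord b (List.ofFn K).reverse (List.ofFn x).reverse = ∏ i, b.repr (x i) (K i) := by
  induction n with
  | zero => simp [listCoord]
  | succ n ih =>
    simp only [List.ofFn_succ', List.concat_eq_append, List.reverse_append, List.reverse_singleton,
      List.singleton_append, listCoord, ih, Fin.prod_univ_castSucc]
    ring

theorem listCoord_eq_zero (b : Module.Basis κ ℝ U) {w : List κ} {l : List U}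
    (h : w.length ≠ l.length) : listCoord b w l = 0 := by
  induction w generalizing l with
  | nil =>
    rcases l with _ | ⟨x, l⟩
    · simp at h
    · rfl
  | cons k w ih =>
    rcases l with _ | ⟨x, l⟩
    · rfl
    · rw [listCoord, ih (by simpa using h), mul_zero]

theorem wordCoord_incl_tprod (b : Module.Basis κ ℝ U) (w : List κ) {n : ℕ} (x : Fin n → U) :
    wordCoord b w (incl n (PiTensorProduct.tprod ℝ x)) = listCoord b w (List.ofFn x).reverse := by
  by_cases h : w.length = n
  · obtain ⟨K, rfl⟩ := exists_eq_reverse_ofFn h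
    rw [wordCoord_reverse_ofFn, incl_apply_self, tensorBasis_repr_tprod, listCoord_reverse_ofFn]
  · rw [wordCoord_incl_of_ne b (Ne.symm h), listCoord_eq_zero]
    simpa using h

theorem incl_mul_incl {i j : ℕ} (a : ⨂[ℝ]^i U) (c : ⨂[ℝ]^j U) :
    (incl i a * incl j c : TAlg U) = incl (i + j) (boxTensor a c) :=
  DirectSum.of_mul_of _ _

theorem boxTensor_tprod {i j : ℕ} (x : Fin i → U) (y : Fin j → U) :
    boxTensor (PiTensorProduct.tprod ℝ x) (PiTensorProduct.tprod ℝ y) =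
      PiTensorProduct.tprod ℝ (Fin.append x y) :=
  TensorPower.tprod_mul_tprod ℝ x y

@[elab_as_elim]
theorem tAlg_induction {p : TAlg U → Prop} (a : TAlg U) (zero : p 0)
    (tprod : ∀ (n : ℕ) (x : Fin n → U), p (incl n (PiTensorProduct.tprod ℝ x)))
    (smul : ∀ (r : ℝ) a, p a → p (r • a)) (add : ∀ a c, p a → p c → p (a + c)) : p a := by
  induction a using DirectSum.induction_on with
  | zero => exact zero
  | of n x =>
    change p (incl n x)
    induction x using PiTensorProduct.induction_on with
    | smul_tprod r x => rw [map_smul]; exact smul _ _ (tprod n x)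
    | add x y hx hy => rw [map_add]; exact add _ _ hx hy
  | add a c ha hc => exact add _ _ ha hc

/-- Coordinates of a product: the tensor product is dual to the deconcatenation of words. -/
theorem wordCoord_mul (b : Module.Basis κ ℝ U) (w : List κ) (a c : TAlg U) :
    wordCoord b w (a * c) = deconcSum w fun v u => wordCoord b u a * wordCoord b v c := by
  induction a using tAlg_induction with
  | zero => simp [deconcSum_zero]
  | smul r a ha =>
    rw [smul_mul_assoc, map_smul, ha, smul_eq_mul]
    simp only [map_smul, smul_eq_mul, mul_assoc]
    exact map_deconcSum (AddMonoidHom.mulLeft r) w _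
  | add a a' ha ha' => simp only [add_mul, map_add, ha, ha', deconcSum_add]
  | tprod n x =>
    induction c using tAlg_induction with
    | zero => simp [deconcSum_zero]
    | smul r a ha =>
      rw [mul_smul_comm, map_smul, ha, smul_eq_mul]
      simp only [map_smul, smul_eq_mul, mul_left_comm _ r]
      exact map_deconcSum (AddMonoidHom.mulLeft r) w _
    | add a a' ha ha' => simp only [mul_add, map_add, ha, ha', deconcSum_add]
    | tprod m y =>
      rw [incl_mul_incl, boxTensor_tprod]
      simp only [wordCoord_incl_tprod, List.ofFn_fin_append, List.reverse_append, listCoord_append,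
        mul_comm]

theorem one_eq_wordTensor (b : Module.Basis κ ℝ U) : (1 : TAlg U) = wordTensor b [] := by
  rw [wordTensor, tensorBasis_apply]
  exact congrArg (incl 0) (congrArg (PiTensorProduct.tprod ℝ) (Subsingleton.elim _ _))

theorem wordTensor_mul (b : Module.Basis κ ℝ U) (u v : List κ) :
    wordTensor b u * wordTensor b v = wordTensor b (v ++ u) := by
  obtain ⟨K, hK⟩ := exists_eq_reverse_ofFn (w := u) rfl
  obtain ⟨L, hL⟩ := exists_eq_reverse_ofFn (w := v) rfl
  generalize u.length = i at K hK
  generalize v.length = j at L hL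
  subst hK hL
  rw [← List.reverse_append, ← List.ofFn_fin_append, wordTensor_reverse_ofFn,
    wordTensor_reverse_ofFn, wordTensor_reverse_ofFn, incl_mul_incl, boxTensor_tprod]
  congr 2
  ext i
  refine Fin.addCases (fun i => ?_) (fun i => ?_) i <;> simp

theorem incl_apply_eq_sum [Fintype κ] (b : Module.Basis κ ℝ U) (n : ℕ) (a : TAlg U) :
    incl n (a n) = ∑ w ∈ wordsOf κ n, wordCoord b w a • wordTensor b w := by
  have h : ∑ w ∈ wordsOf κ n, wordCoord b w a • wordTensor b w =
      ∑ K : Fin n → κ, wordCoord b (List.ofFn K).reverse a •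
        wordTensor b (List.ofFn K).reverse := by
    rw [← (Equiv.arrowCongr Fin.revPerm (Equiv.refl κ)).sum_comp, wordsOf, Finset.sum_map]
    refine Finset.sum_congr rfl fun K _ => ?_
    have : (List.ofFn ((Equiv.arrowCongr Fin.revPerm (Equiv.refl κ)) K)).reverse = List.ofFn K := by
      refine List.ext_getElem (by simp) fun i h1 h2 => ?_
      have hi : i < n := by simpa using h2
      simp only [List.getElem_reverse, List.getElem_ofFn, List.length_ofFn,
        Equiv.arrowCongr_apply, Equiv.coe_refl, Function.comp_apply, id]
      congr 1
      ext
      simp only [Fin.revPerm_symm, Fin.revPerm_apply, Fin.val_rev]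
      omega
    rw [this]
    rfl
  rw [h]
  conv_lhs => rw [← (tensorBasis b n).sum_repr (a n)]
  simp only [map_sum, map_smul, wordCoord_reverse_ofFn, wordTensor_reverse_ofFn,
    tensorBasis_apply]

theorem wordCoord_one (b : Module.Basis κ ℝ U) (w : List κ) :
    wordCoord b w (1 : TAlg U) = if w = [] then 1 else 0 := by
  classical
  rw [one_eq_wordTensor b, wordCoord_wordTensor]

/-- The element of `T(U)` with prescribed coordinates at the words of length at most `N`. -/
def ofCoords [Fintype κ] (b : Module.Basis κ ℝ U) (N : ℕ) (f : List κ → ℝ) : TAlg U :=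
  ∑ w ∈ wordsLE κ N, f w • wordTensor b w

theorem wordCoord_ofCoords [Fintype κ] (b : Module.Basis κ ℝ U) (N : ℕ) (f : List κ → ℝ)
    (w : List κ) : wordCoord b w (ofCoords b N f) = if w.length ≤ N then f w else 0 := by
  classical
  simp only [ofCoords, map_sum, map_smul, wordCoord_wordTensor, smul_eq_mul, mul_ite, mul_one,
    mul_zero, Finset.sum_ite_eq, mem_wordsLE]

end Coordinates

/-! ### Shuffles in coordinates -/

section Shuffles

variable {U κ : Type*} [AddCommGroup U] [Module ℝ U]

/-- The blocks of lengths `i` and `j` among `i + j` letters. -/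
def twoBlocks (i j : ℕ) : (Σ t : Bool, Fin (cond t j i)) ≃ Fin (i + j) :=
  ((Equiv.sumEquivSigmaBool (Fin i) (Fin j)).trans
    (Equiv.sigmaCongrRight fun t => by cases t <;> exact Equiv.refl _)).symm.trans finSumFinEquiv

/-- A shuffle is determined by the set of values that it takes on the first `i` letters. -/
theorem sum_shuffles {E : Type*} [AddCommMonoid E] {i j : ℕ}
    (q : List (Fin (i + j)) → List (Fin (i + j)) → E)
    (hq : ∀ a b, ¬ (a.length = i ∧ b.length = j) → q a b = 0) :
    ∑ σ ∈ shuffles i j, q (List.ofFn fun a : Fin i => σ (Fin.castAdd j a))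
        (List.ofFn fun b : Fin j => σ (Fin.natAdd i b)) =
      splitSum (List.finRange (i + j)) q := by
  classical
  have h := sum_strictMono_perm (fun t : Bool => cond t j i) (twoBlocks i j)
    (fun B => q (B false) (B true))
  rw [blockSum_bool] at h
  refine Eq.trans (Finset.sum_congr ?_ fun _ _ => rfl)
    (h.trans (congrArg _ (funext fun a => funext fun b => ?_)))
  · ext σ
    simp only [shuffles, Finset.mem_filter, Finset.mem_univ, true_and, Bool.forall_bool]
    rfl
  split_ifs with hl
  · rfl
  · refine (hq a b fun hab => hl ?_).symm
    simpa [Bool.forall_bool] using hab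

/-- The coordinates of `∑_{σ ∈ Sh(i, j)} σ_* a` are sums of coordinates of `a` over shuffles. -/
theorem repr_sum_shuffles (b : Module.Basis κ ℝ U) {i j : ℕ} (K : Fin i → κ) (L : Fin j → κ)
    (a : TAlg U) :
    (tensorBasis b (i + j)).repr (∑ σ ∈ shuffles i j, permAct σ (a (i + j))) (Fin.append K L) =
      shuffleSum (List.ofFn K).reverse (List.ofFn L).reverse fun M => wordCoord b M a := by
  classical
  have key : ∀ c : ⨂[ℝ]^(i + j) U,
      (tensorBasis b (i + j)).repr (∑ σ ∈ shuffles i j, permAct σ c) (Fin.append K L) =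
        shuffleSum (List.ofFn K).reverse (List.ofFn L).reverse fun M =>
          wordCoord b M (incl (i + j) c) := by
    intro c
    let f : (⨂[ℝ]^(i + j) U) →ₗ[ℝ] ℝ :=
      ((Finsupp.lapply (Fin.append K L)) ∘ₗ (tensorBasis b (i + j)).repr.toLinearMap) ∘ₗ
        (∑ σ ∈ shuffles i j, permAct (V := U) σ)
    let g : (⨂[ℝ]^(i + j) U) →ₗ[ℝ] ℝ :=
      { toFun := fun c => shuffleSum (List.ofFn K).reverse (List.ofFn L).reverse fun M =>
          wordCoord b M (incl (i + j) c)
        map_add' := fun x y => by simp only [map_add, shuffleSum_add]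
        map_smul' := fun r x => by
          simp only [map_smul, smul_eq_mul, RingHom.id_apply, shuffleSum_mul_left] }
    have hlin : f = g := by
      refine (tensorBasis b (i + j)).ext fun W => ?_
      have hf : f (tensorBasis b (i + j) W) = ∑ σ ∈ shuffles i j,
          if (fun x => W (σ x)) = Fin.append K L then 1 else 0 := by
        simp only [f, LinearMap.comp_apply, LinearMap.sum_apply, LinearEquiv.coe_coe, map_sum,
          Finsupp.lapply_apply, tensorBasis_apply, permAct_tprod]
        simp only [← tensorBasis_apply b (i + j) fun x => W _, Module.Basis.repr_self,
          Finsupp.single_apply]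
      have hg : g (tensorBasis b (i + j) W) = splitSum (List.ofFn W) fun a b =>
          if a.reverse = (List.ofFn K).reverse ∧ b.reverse = (List.ofFn L).reverse
            then 1 else 0 := by
        simp only [g, LinearMap.coe_mk, AddHom.coe_mk, tensorBasis_apply,
          ← wordTensor_reverse_ofFn, wordCoord_wordTensor, shuffleSum_single, splitSum_reverse]
      rw [hf, hg]
      have h2 := sum_shuffles (E := ℝ) (i := i) (j := j) (fun A B =>
        if A.map W = List.ofFn K ∧ B.map W = List.ofFn L then 1 else 0) (fun A B hAB => by
          rw [if_neg]
          rintro ⟨h1, h2⟩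
          exact hAB ⟨by simpa using congrArg List.length h1,
            by simpa using congrArg List.length h2⟩)
      rw [show List.ofFn W = (List.finRange (i + j)).map W from (List.ofFn_eq_map),
        splitSum_map]
      simp only [List.reverse_inj]
      rw [← h2]
      refine Finset.sum_congr rfl fun σ _ => if_congr ?_ rfl rfl
      simp only [List.map_ofFn, List.ofFn_injective.eq_iff, funext_iff, Function.comp_apply]
      constructor
      · intro h
        exact ⟨fun x => by simpa using h (Fin.castAdd j x), fun x => by simpa using h (Fin.natAdd i x)⟩
      · rintro ⟨h, h'⟩ x
        refine Fin.addCases (fun x => ?_) (fun x => ?_) x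
        · simpa using h x
        · simpa using h' x
    calc _ = f c := by
          simp only [f, LinearMap.comp_apply, LinearMap.sum_apply, LinearEquiv.coe_coe,
            Finsupp.lapply_apply]
      _ = g c := by rw [hlin]
      _ = _ := rfl
  rw [key]
  refine shuffleSum_congr fun M hM => wordCoord_congr b ?_
  have hM' : M.length = i + j := by simpa using hM
  rw [hM', incl_apply_self]

theorem repr_boxTensor (b : Module.Basis κ ℝ U) {i j : ℕ} (K : Fin i → κ) (L : Fin j → κ)
    (a : ⨂[ℝ]^i U) (c : ⨂[ℝ]^j U) :
    (tensorBasis b (i + j)).repr (boxTensor a c) (Fin.append K L) =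
      (tensorBasis b i).repr a K * (tensorBasis b j).repr c L := by
  induction a using PiTensorProduct.induction_on with
  | add x y hx hy =>
    simp only [boxTensor, TensorProduct.add_tmul, map_add, Finsupp.add_apply, add_mul] at hx hy ⊢
    rw [hx, hy]
  | smul_tprod r x =>
    induction c using PiTensorProduct.induction_on with
    | add y y' hy hy' =>
      simp only [boxTensor, TensorProduct.tmul_add, map_add, Finsupp.add_apply, mul_add] at hy hy' ⊢
      rw [hy, hy']
    | smul_tprod r' y =>
      have h : boxTensor (r • PiTensorProduct.tprod ℝ x) (r' • PiTensorProduct.tprod ℝ y) =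
          (r * r') • PiTensorProduct.tprod ℝ (Fin.append x y) := by
        rw [← boxTensor_tprod]
        simp only [boxTensor, TensorProduct.smul_tmul_smul, map_smul]
      rw [h]
      simp only [map_smul, Finsupp.smul_apply, smul_eq_mul, tensorBasis_repr_tprod,
        Fin.prod_univ_add, Fin.append_left, Fin.append_right]
      ring

/-- Integration by parts says that the coordinates form a character of the shuffle algebra. -/
theorem repr_geometricDefect (b : Module.Basis κ ℝ U) (X : ℝ → ℝ → TAlg U) {i j : ℕ}
    (K : Fin i → κ) (L : Fin j → κ) (s t : ℝ) :
    (tensorBasis b (i + j)).repr (geometricDefect X i j s t) (Fin.append K L) =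
      wordCoord b (List.ofFn K).reverse (X s t) * wordCoord b (List.ofFn L).reverse (X s t) -
        shuffleSum (List.ofFn K).reverse (List.ofFn L).reverse fun M => wordCoord b M (X s t) := by
  rw [geometricDefect, map_sub, Finsupp.sub_apply, repr_sum_shuffles, repr_boxTensor,
    wordCoord_reverse_ofFn, wordCoord_reverse_ofFn]

end Shuffles

/-! ### Ordered shuffles in coordinates -/

section OrderedShuffles

variable {V U ι κ : Type*} [AddCommGroup V] [Module ℝ V] [AddCommGroup U] [Module ℝ U]

/-- On permutations that are increasing on blocks, the condition on the last letters in the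
definition of `orderedShuffles` is `LastOrdered`, ranked by values. -/
theorem lastOrdered_ofFn_iff {m : ℕ} {ν : Fin m → ℕ} (hν : ∀ i, ν i ≠ 0)
    {σ : Equiv.Perm (Fin (∑ i, ν i))} (hσ : ∀ i, StrictMono fun j : Fin (ν i) => σ (pos ν i j)) :
    LastOrdered (fun x : Fin (∑ i, ν i) => (x : ℕ))
        (fun i => List.ofFn fun j : Fin (ν i) => σ (pos ν i j)) ↔
      ∀ (i i' : Fin m) (j : Fin (ν i)) (j' : Fin (ν i')),
        i < i' → (j : ℕ) + 1 = ν i → (j' : ℕ) + 1 = ν i' → σ (pos ν i j) < σ (pos ν i' j') := by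
  constructor
  · rintro ⟨-, h⟩ i i' j j' hi hj hj'
    obtain ⟨y, hy, hlt⟩ := h i i' hi (σ (pos ν i j)) (List.mem_ofFn.2 ⟨j, rfl⟩)
    obtain ⟨k, rfl⟩ := List.mem_ofFn.1 hy
    refine lt_of_lt_of_le (Fin.lt_def.2 hlt) ((hσ i').monotone (Fin.le_def.2 ?_))
    have := k.2
    omega
  · intro h
    refine ⟨fun i hi => hν i (by simpa using congrArg List.length hi), fun i i' hi x hx => ?_⟩
    obtain ⟨k, rfl⟩ := List.mem_ofFn.1 hx
    have h0 := Nat.pos_of_ne_zero (hν i)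
    have h0' := Nat.pos_of_ne_zero (hν i')
    refine ⟨_, List.mem_ofFn.2 ⟨⟨ν i' - 1, by omega⟩, rfl⟩, Fin.lt_def.1 (lt_of_le_of_lt ?_
      (h i i' ⟨ν i - 1, by omega⟩ ⟨ν i' - 1, by omega⟩ hi (by simp; omega) (by simp; omega)))⟩
    refine (hσ i).monotone (Fin.le_def.2 ?_)
    have := k.2
    simp only
    omega

open Classical in
/-- Ordered shuffles are the distributions of the letters into non-empty blocks of prescribed
lengths that are ordered by their last letters. -/
theorem sum_orderedShuffles {E : Type*} [AddCommMonoid E] {m : ℕ} {ν : Fin m → ℕ}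
    (hν : ∀ i, ν i ≠ 0) (G : (Fin m → List (Fin (∑ i, ν i))) → E) :
    ∑ σ ∈ orderedShuffles ν, G (fun i => List.ofFn fun j : Fin (ν i) => σ (pos ν i j)) =
      blockSum (List.finRange (∑ i, ν i)) fun B =>
        if ∀ i, (B i).length = ν i then
          if LastOrdered (fun x : Fin (∑ i, ν i) => (x : ℕ)) B then G B else 0
        else 0 := by
  have h := sum_strictMono_perm ν finSigmaFinEquiv fun B =>
    if LastOrdered (fun x : Fin (∑ i, ν i) => (x : ℕ)) B then G B else 0
  rw [← Finset.sum_filter, Finset.filter_filter] at h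
  refine Eq.trans (Finset.sum_congr ?_ fun _ _ => rfl)
    (h.trans (congrArg _ (funext fun B => by split_ifs <;> rfl)))
  ext σ
  simp only [orderedShuffles, Finset.mem_filter, Finset.mem_univ, true_and]
  exact and_congr_right fun h => (lastOrdered_ofFn_iff hν h).symm

/-- The coordinates of a linear map `h : T(V) → U`, on words written backwards. -/
def mapCoord (e : Module.Basis ι ℝ V) (b : Module.Basis κ ℝ U) (h : TAlg V →ₗ[ℝ] U) (k : κ)
    (w : List ι) : ℝ :=
  b.repr (h (wordTensor e w)) k

open Classical in
/-- One summand of the ordered-shuffle functional, at a basis tensor. The letters are tagged with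
their positions, which rank them. -/
theorem repr_boxMap_sum_orderedShuffles (e : Module.Basis ι ℝ V) (b : Module.Basis κ ℝ U)
    (h : TAlg V →ₗ[ℝ] U) {m : ℕ} {ν : Fin m → ℕ} (hν : ∀ i, ν i ≠ 0) (K : Fin m → κ)
    (W : Fin (∑ i, ν i) → ι) :
    (tensorBasis b m).repr (boxMap h ν (∑ σ ∈ orderedShuffles ν,
      permAct σ (tensorBasis e _ W))) K =
      blockSum (List.ofFn W).zipIdx fun B => if ∀ i, (B i).length = ν i then
        if LastOrdered Prod.snd B then
          ∏ i, mapCoord e b h (K i) ((B i).map Prod.fst).reverse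
        else 0 else 0 := by
  have h1 : ∀ σ : Equiv.Perm (Fin (∑ i, ν i)),
      (tensorBasis b m).repr (boxMap h ν (permAct σ (tensorBasis e _ W))) K =
        ∏ i, mapCoord e b h (K i)
          ((List.ofFn fun j : Fin (ν i) => σ (pos ν i j)).map W).reverse := by
    intro σ
    rw [tensorBasis_apply, permAct_tprod, boxMap_tprod, tensorBasis_repr_tprod]
    refine Finset.prod_congr rfl fun i _ => ?_
    rw [mapCoord, List.map_ofFn, wordTensor_reverse_ofFn]
    rfl
  simp only [map_sum, Finsupp.finsetSum_apply, h1]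
  rw [sum_orderedShuffles hν fun B =>
    ∏ i, mapCoord e b h (K i) ((B i).map W).reverse]
  have h2 : (List.ofFn W).zipIdx = (List.finRange (∑ i, ν i)).map fun x => (W x, (x : ℕ)) := by
    refine List.ext_getElem (by simp) fun i h1 h2 => by simp
  rw [h2, blockSum_map]
  simp only [lastOrdered_map, List.length_map, List.map_map]
  rfl

/-- The ordered-shuffle functional in coordinates. -/
theorem repr_orderedShufflePairing [Fintype ι] (e : Module.Basis ι ℝ V) (b : Module.Basis κ ℝ U)
    (h : TAlg V →ₗ[ℝ] U) (N : ℕ) {m : ℕ} (K : Fin m → κ) (a : TAlg V) :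
    (tensorBasis b m).repr (orderedShufflePairing N m h a) K =
      wordSum N (fun w => wordCoord e w a)
        (orderedShuffleCoord (mapCoord e b h) (List.ofFn K).reverse) := by
  classical
  set F : (Fin m → ℕ) → List ι → ℝ := fun ν w =>
    blockSum w.zipIdx fun B => if ∀ i, (B i).length = ν i then
        if LastOrdered Prod.snd B then
          ∏ i, mapCoord e b h (K i) ((B i).map Prod.fst).reverse
        else 0 else 0 with hF
  have h1 : ∀ ν ∈ degreeTuples N m,
      (tensorBasis b m).repr (boxMap h ν (∑ σ ∈ orderedShuffles ν, permAct σ (a (∑ i, ν i)))) K =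
        ∑ w ∈ wordsLE ι N, wordCoord e w.reverse a * F ν w := by
    intro ν hν
    simp only [degreeTuples, Finset.mem_filter, Fintype.mem_piFinset, Finset.mem_Icc] at hν
    have e1 : (tensorBasis b m).repr
        (boxMap h ν (∑ σ ∈ orderedShuffles ν, permAct σ (a (∑ i, ν i)))) K =
        ∑ W : Fin (∑ i, ν i) → ι, wordCoord e (List.ofFn W).reverse a * F ν (List.ofFn W) := by
      have hexp : ∑ σ ∈ orderedShuffles ν, permAct σ (a (∑ i, ν i)) =
          ∑ W : Fin (∑ i, ν i) → ι, (tensorBasis e _).repr (a (∑ i, ν i)) W •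
            ∑ σ ∈ orderedShuffles ν, permAct σ (tensorBasis e _ W) := by
        conv_lhs => rw [← (tensorBasis e _).sum_repr (a (∑ i, ν i))]
        simp only [map_sum, map_smul, Finset.smul_sum]
        exact Finset.sum_comm
      rw [hexp, map_sum, map_sum, Finsupp.finsetSum_apply]
      refine Finset.sum_congr rfl fun W _ => ?_
      rw [map_smul, map_smul, Finsupp.smul_apply, smul_eq_mul, wordCoord_reverse_ofFn,
        repr_boxMap_sum_orderedShuffles e b h
          (fun i => Nat.pos_iff_ne_zero.1 (hν.1 i).1) K W]
    have e2 : ∑ W : Fin (∑ i, ν i) → ι, wordCoord e (List.ofFn W).reverse a * F ν (List.ofFn W) =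
        ∑ w ∈ wordsOf ι (∑ i, ν i), wordCoord e w.reverse a * F ν w := by
      rw [wordsOf, Finset.sum_map]
      rfl
    rw [e1, e2]
    refine Finset.sum_subset (fun w hw => mem_wordsLE.2 ?_) fun w _ hw => ?_
    · rw [mem_wordsOf.1 hw]; exact hν.2
    · rw [mem_wordsOf] at hw
      have : F ν w = 0 := by
        refine (blockSum_congr fun B _ _ hl => if_neg fun hB => hw ?_).trans (blockSum_zero _)
        rw [List.length_zipIdx] at hl
        rw [← hl]
        exact Finset.sum_congr rfl fun i _ => hB i
      rw [this, mul_zero]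
  have h2 : ∀ w ∈ wordsLE ι N, ∑ ν ∈ degreeTuples N m, F ν w =
      orderedShuffleCoord (mapCoord e b h) (List.ofFn K).reverse w.reverse := by
    intro w hw
    rw [mem_wordsLE] at hw
    rw [hF, ← blockSum_sum]
    have e1 := blockSum_lastOrdered (α := ι × ℕ) Prod.snd Prod.fst (mapCoord e b h) K
      w.zipIdx.reverse ?_
    · rw [List.map_reverse, List.zipIdx_map_fst, blockSum_reverse] at e1
      rw [← e1]
      refine blockSum_congr fun B _ _ hl => ?_
      simp only [lastOrdered_reverse, List.map_reverse]
      by_cases hB : LastOrdered Prod.snd B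
      · rw [if_pos hB, Finset.sum_eq_single fun i => (B i).length]
        · exact if_pos fun _ => rfl
        · intro ν _ hν
          exact if_neg fun h => hν (funext fun i => (h i).symm)
        · intro hn
          refine absurd ?_ hn
          rw [List.length_zipIdx] at hl
          simp only [degreeTuples, Finset.mem_filter, Fintype.mem_piFinset, Finset.mem_Icc]
          refine ⟨fun i => ⟨List.length_pos_iff.2 (hB.1 i), ?_⟩, hl.trans_le hw⟩
          exact (Finset.single_le_sum (f := fun i => (B i).length) (fun _ _ => Nat.zero_le _)
            (Finset.mem_univ i)).trans (hl.trans_le hw)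
      · rw [if_neg hB]
        refine Finset.sum_eq_zero fun ν _ => ?_
        exact ite_self _
    · rw [List.pairwise_reverse, List.pairwise_iff_getElem]
      intro i j hi hj hij
      simpa using hij
  have h3 : wordSum N (fun w => wordCoord e w a)
        (orderedShuffleCoord (mapCoord e b h) (List.ofFn K).reverse) =
      ∑ w ∈ wordsLE ι N, wordCoord e w.reverse a *
        orderedShuffleCoord (mapCoord e b h) (List.ofFn K).reverse w.reverse := by
    refine Finset.sum_nbij' List.reverse List.reverse ?_ ?_ ?_ ?_ ?_ <;> simp [mem_wordsLE]
  rw [orderedShufflePairing, map_sum, Finsupp.finsetSum_apply, Finset.sum_congr rfl h1,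
    Finset.sum_comm, h3]
  refine Finset.sum_congr rfl fun w hw => ?_
  rw [← Finset.mul_sum, h2 w hw]

end OrderedShuffles

/-! ### Bounded functions modulo functions of high order -/

section Maps

variable {ι κ R S : Type*} [CommRing R] [CommRing S]

theorem map_wordSum [Fintype ι] (f : R →+* S) (N : ℕ) (x F : List ι → R) :
    f (wordSum N x F) = wordSum N (fun w => f (x w)) fun w => f (F w) := by
  simp only [wordSum, map_sum, map_mul]

theorem map_orderedShuffleCoord (f : R →+* S) (h : κ → List ι → R) (K : List κ) (w : List ι) :
    f (orderedShuffleCoord h K w) = orderedShuffleCoord (fun k v => f (h k v)) K w := by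
  induction K generalizing w with
  | nil => cases w <;> simp [orderedShuffleCoord]
  | cons k K ih =>
    cases w with
    | nil => simp [orderedShuffleCoord]
    | cons x w =>
      simp only [orderedShuffleCoord]
      refine (map_splitSum f.toAddMonoidHom w _).trans ?_
      simp [ih]

end Maps

section BoundedFunctions

variable {α : Type*}

/-- The ring of bounded real functions. -/
def boundedFunctions (α : Type*) : Subring (α → ℝ) where
  carrier := {f | ∃ C, ∀ a, |f a| ≤ C}
  mul_mem' := by
    rintro f g ⟨C, hC⟩ ⟨D, hD⟩
    refine ⟨C * D, fun a => ?_⟩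
    rw [Pi.mul_apply, abs_mul]
    exact mul_le_mul (hC a) (hD a) (abs_nonneg _) ((abs_nonneg _).trans (hC a))
  one_mem' := ⟨1, fun a => by simp⟩
  add_mem' := by
    rintro f g ⟨C, hC⟩ ⟨D, hD⟩
    exact ⟨C + D, fun a => (abs_add_le _ _).trans (add_le_add (hC a) (hD a))⟩
  zero_mem' := ⟨0, fun a => by simp⟩
  neg_mem' := by
    rintro f ⟨C, hC⟩
    exact ⟨C, fun a => by simpa using hC a⟩

theorem exists_mul_bound {f g : α → ℝ} (hf : ∃ C, ∀ a, |f a| ≤ C) (hg : ∃ C, ∀ a, |g a| ≤ C) :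
    ∃ C, ∀ a, |f a * g a| ≤ C :=
  (boundedFunctions α).mul_mem hf hg

theorem exists_nonneg_bound {P : α → Prop} {f g : α → ℝ} (hg : ∀ a, P a → 0 ≤ g a)
    (h : ∃ C, ∀ a, P a → |f a| ≤ C * g a) : ∃ C, 0 ≤ C ∧ ∀ a, P a → |f a| ≤ C * g a := by
  obtain ⟨C, hC⟩ := h
  exact ⟨max C 0, le_max_right _ _, fun a ha =>
    (hC a ha).trans (mul_le_mul_of_nonneg_right (le_max_left _ _) (hg a ha))⟩

/-- The ideal of the functions of order `O(ε^k)`. -/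
def orderIdeal (ε : α → ℝ) (k : ℕ) : Ideal (boundedFunctions α) where
  carrier := {f | ∃ C, ∀ a, |f.1 a| ≤ C * ε a ^ k}
  add_mem' := by
    rintro f g ⟨C, hC⟩ ⟨D, hD⟩
    refine ⟨C + D, fun a => ?_⟩
    rw [add_mul]
    exact (abs_add_le _ _).trans (add_le_add (hC a) (hD a))
  zero_mem' := ⟨0, fun a => by simp⟩
  smul_mem' := by
    rintro ⟨f, D, hD⟩ g ⟨C, hC⟩
    refine ⟨D * C, fun a => ?_⟩
    simp only [smul_eq_mul, Subring.coe_mul, Pi.mul_apply, abs_mul]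
    rw [mul_assoc]
    exact mul_le_mul (hD a) (hC a) (abs_nonneg _) ((abs_nonneg _).trans (hD a))

variable (ε : α → ℝ)

/-- Bounded functions modulo `O(ε^{N + 1})`. -/
abbrev OrderQuotient (N : ℕ) : Type _ := boundedFunctions α ⧸ orderIdeal ε (N + 1)

/-- The functions of order `O(ε^k)`, modulo `O(ε^{N + 1})`. -/
def quotientOrderIdeal (N k : ℕ) : Ideal (OrderQuotient ε N) :=
  (orderIdeal ε k).map (Ideal.Quotient.mk _)

variable {ε}

theorem mk_mem_quotientOrderIdeal {N k : ℕ} {f : boundedFunctions α}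
    (hf : f ∈ orderIdeal ε k) :
    (Ideal.Quotient.mk (orderIdeal ε (N + 1)) f) ∈ quotientOrderIdeal ε N k :=
  Ideal.mem_map_of_mem _ hf

theorem orderIdeal_antitone (hε : ∀ a, 0 ≤ ε a) (M : ℝ) (hM : ∀ a, ε a ≤ M) :
    Antitone (orderIdeal ε) := by
  refine antitone_nat_of_succ_le fun k => ?_
  rintro f ⟨C, hC⟩
  obtain ⟨D, hD0, hD⟩ := exists_nonneg_bound (P := fun _ => True)
    (fun a _ => pow_nonneg (hε a) (k + 1)) ⟨C, fun a _ => hC a⟩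
  refine ⟨D * M, fun a => (hD a trivial).trans ?_⟩
  rw [pow_succ, mul_assoc, mul_comm M]
  exact mul_le_mul_of_nonneg_left
    (mul_le_mul_of_nonneg_left (hM a) (pow_nonneg (hε a) k)) hD0

theorem isFiltration_quotientOrderIdeal (hε : ∀ a, 0 ≤ ε a) (M : ℝ) (hM : ∀ a, ε a ≤ M) (N : ℕ) :
    IsFiltration (quotientOrderIdeal ε N) N where
  anti := fun _ _ h => Ideal.map_mono (orderIdeal_antitone hε M hM h)
  zero := by
    have : orderIdeal ε 0 = ⊤ := by
      rw [Ideal.eq_top_iff_one]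
      exact ⟨1, fun a => by simp⟩
    rw [quotientOrderIdeal, this, Ideal.map_top]
  mul_mem := by
    intro i j a b ha hb
    obtain ⟨f, ⟨C, hC⟩, rfl⟩ :=
      (Ideal.mem_map_iff_of_surjective _ Ideal.Quotient.mk_surjective).1 ha
    obtain ⟨g, ⟨D, hD⟩, rfl⟩ :=
      (Ideal.mem_map_iff_of_surjective _ Ideal.Quotient.mk_surjective).1 hb
    rw [← map_mul]
    refine mk_mem_quotientOrderIdeal ⟨C * D, fun a => ?_⟩
    simp only [Subring.coe_mul, Pi.mul_apply, abs_mul]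
    rw [pow_add, mul_mul_mul_comm]
    exact mul_le_mul (hC a) (hD a) (abs_nonneg _) ((abs_nonneg _).trans (hC a))
  bot := by
    rw [quotientOrderIdeal, Ideal.map_quotient_self]

end BoundedFunctions

/-! ### Estimates in terms of a control -/

section Estimates

/-- A finite-dimensional estimate may be checked on the coordinates in a basis. -/
theorem exists_dual_bound {E κ β : Type*} [AddCommGroup E] [Module ℝ E] [Fintype κ]
    (B : Module.Basis κ ℝ E) {P : β → Prop} {f : β → E} {g : β → ℝ}
    (h : ∀ k, ∃ C, ∀ x, P x → |B.repr (f x) k| ≤ C * g x) (ℓ : Module.Dual ℝ E) :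
    ∃ C, ∀ x, P x → |ℓ (f x)| ≤ C * g x := by
  choose C hC using h
  refine ⟨∑ k, C k * |ℓ (B k)|, fun x hx => ?_⟩
  have h1 : ℓ (f x) = ∑ k, B.repr (f x) k * ℓ (B k) := by
    conv_lhs => rw [← B.sum_repr (f x)]
    simp only [map_sum, map_smul, smul_eq_mul]
  rw [h1, Finset.sum_mul]
  refine (Finset.abs_sum_le_sum_abs _ _).trans (Finset.sum_le_sum fun k _ => ?_)
  rw [abs_mul, mul_right_comm]
  exact mul_le_mul_of_nonneg_right (hC k x hx) (abs_nonneg _)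

variable {T p : ℝ} {ω : ℝ → ℝ → ℝ}

theorem IsControl.left_le (hω : IsControl T ω) {s u t : ℝ} (hs : 0 ≤ s) (hsu : s ≤ u)
    (hut : u ≤ t) (ht : t ≤ T) : ω s u ≤ ω s t := by
  linarith [hω.superadditive s u t hs hsu hut ht, hω.nonneg u t (hs.trans hsu) hut ht]

theorem IsControl.right_le (hω : IsControl T ω) {s u t : ℝ} (hs : 0 ≤ s) (hsu : s ≤ u)
    (hut : u ≤ t) (ht : t ≤ T) : ω u t ≤ ω s t := by
  linarith [hω.superadditive s u t hs hsu hut ht, hω.nonneg s u hs hsu (hut.trans ht)]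

theorem IsControl.le_total (hω : IsControl T ω) {s t : ℝ} (hs : 0 ≤ s) (hst : s ≤ t)
    (ht : t ≤ T) : ω s t ≤ ω 0 T :=
  (hω.right_le le_rfl hs hst ht).trans (hω.left_le le_rfl (hs.trans hst) ht le_rfl)

theorem rpow_natCast_div (n : ℕ) {x : ℝ} (hx : 0 ≤ x) (p : ℝ) :
    x ^ ((n : ℝ) / p) = (x ^ (1 / p)) ^ n := by
  rw [← Real.rpow_natCast, ← Real.rpow_mul hx, one_div_mul_eq_div]

end Estimates

/-! ### Rough and controlled paths in coordinates -/

section CoordinateEstimates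

variable {V U ι κ : Type*} [AddCommGroup V] [Module ℝ V] [AddCommGroup U] [Module ℝ U]
  {T p : ℝ} {ω : ℝ → ℝ → ℝ} {X : ℝ → ℝ → TAlg V} {H : ℝ → TAlg V →ₗ[ℝ] U}

theorem IsRegularFunctional.wordCoord_nil (hX : IsRegularFunctional T p ω X)
    (e : Module.Basis ι ℝ V) {s t : ℝ} (hs : 0 ≤ s) (hst : s ≤ t) (ht : t ≤ T) :
    wordCoord e [] (X s t) = 1 := by
  rw [wordCoord_congr e (a' := 1) (hX.level_zero s t hs hst ht), wordCoord_one, if_pos rfl]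

theorem IsRegularFunctional.wordCoord_eq_zero (hX : IsRegularFunctional T p ω X)
    (e : Module.Basis ι ℝ V) {s t : ℝ} (hs : 0 ≤ s) (hst : s ≤ t) (ht : t ≤ T) {w : List ι}
    (hw : ⌊p⌋₊ < w.length) : wordCoord e w (X s t) = 0 :=
  wordCoord_eq_zero_of_apply_eq_zero e (hX.truncated s t hs hst ht _ hw)

theorem exists_dual_eq_wordCoord (e : Module.Basis ι ℝ V) (w : List ι) :
    ∃ ℓ : Module.Dual ℝ (⨂[ℝ]^w.length V), ∀ a : TAlg V, wordCoord e w a = ℓ (a w.length) :=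
  ⟨(tensorBasis e w.length).coord fun i => w.get i.rev, fun _ => rfl⟩

theorem IsRegularFunctional.wordCoord_bound (hX : IsRegularFunctional T p ω X)
    (hω : IsControl T ω) (e : Module.Basis ι ℝ V) (w : List ι) :
    ∃ C, ∀ s t, 0 ≤ s → s ≤ t → t ≤ T →
      |wordCoord e w (X s t)| ≤ C * (ω s t ^ (1 / p)) ^ w.length := by
  rcases Nat.eq_zero_or_pos w.length with h0 | h0
  · rw [List.length_eq_zero_iff] at h0
    subst h0
    exact ⟨1, fun s t hs hst ht => by simp [hX.wordCoord_nil e hs hst ht]⟩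
  · rcases le_or_gt w.length ⌊p⌋₊ with hw | hw
    · obtain ⟨ℓ, hℓ⟩ := exists_dual_eq_wordCoord e w
      obtain ⟨C, hC⟩ := hX.regular _ h0 hw ℓ
      refine ⟨C, fun s t hs hst ht => ?_⟩
      rw [hℓ, ← rpow_natCast_div _ (hω.nonneg s t hs hst ht)]
      exact hC s t hs hst ht
    · exact ⟨0, fun s t hs hst ht => by simp [hX.wordCoord_eq_zero e hs hst ht hw]⟩

theorem IsRoughPath.wordCoord_mul_eq_shuffleSum (hX : IsRoughPath T p ω X)
    (e : Module.Basis ι ℝ V) {s t : ℝ} (hs : 0 ≤ s) (hst : s ≤ t) (ht : t ≤ T)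
    {u v : List ι} (h : u.length + v.length ≤ ⌊p⌋₊) :
    wordCoord e u (X s t) * wordCoord e v (X s t) =
      shuffleSum u v fun M => wordCoord e M (X s t) := by
  obtain ⟨K, hK⟩ := exists_eq_reverse_ofFn (w := u) rfl
  obtain ⟨L, hL⟩ := exists_eq_reverse_ofFn (w := v) rfl
  have h1 := repr_geometricDefect e X K L s t
  rw [hX.geometric s t hs hst ht _ _ h, map_zero, Finsupp.zero_apply, ← hK, ← hL] at h1
  linarith

theorem IsRoughPath.wordCoord_eq_deconcSum (hX : IsRoughPath T p ω X)
    (e : Module.Basis ι ℝ V) {s u t : ℝ} (hs : 0 ≤ s) (hsu : s ≤ u) (hut : u ≤ t) (ht : t ≤ T)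
    {w : List ι} (h : w.length ≤ ⌊p⌋₊) :
    wordCoord e w (X s t) =
      deconcSum w fun v v' => wordCoord e v' (X s u) * wordCoord e v (X u t) := by
  rw [← wordCoord_mul, wordCoord_congr e (hX.multiplicative s u t hs hsu hut ht _ h)]

theorem IsControlledPath.mapCoord_eq_zero (hH : IsControlledPath T p ω X H)
    (e : Module.Basis ι ℝ V) (b : Module.Basis κ ℝ U) {t : ℝ} (h0 : 0 ≤ t) (ht : t ≤ T) (k : κ)
    {w : List ι} (hw : ⌊p⌋₊ ≤ w.length) : mapCoord e b (H t) k w = 0 := by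
  rw [mapCoord, wordTensor, hH.truncated t h0 ht _ hw, map_zero, Finsupp.zero_apply]

theorem IsControlledPath.mapCoord_bound (hH : IsControlledPath T p ω X H)
    (e : Module.Basis ι ℝ V) (b : Module.Basis κ ℝ U) (k : κ) (w : List ι) :
    ∃ C, ∀ t, 0 ≤ t → t ≤ T → |mapCoord e b (H t) k w| ≤ C := by
  obtain ⟨C, hC⟩ := isCompact_Icc.exists_bound_of_continuousOn
    (hH.continuousOn (wordTensor e w) (b.coord k))
  exact ⟨C, fun t h0 ht => hC t ⟨h0, ht⟩⟩

/-- The defining estimate of a controlled path in coordinates. -/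
theorem IsControlledPath.mapCoord_sub_bound [Fintype ι] (hX : IsRegularFunctional T p ω X)
    (hH : IsControlledPath T p ω X H) (hω : IsControl T ω)
    (e : Module.Basis ι ℝ V) (b : Module.Basis κ ℝ U) (k : κ) (v : List ι) :
    ∃ C, ∀ s t, 0 ≤ s → s ≤ t → t ≤ T →
      |wordSum ⌊p⌋₊ (fun u => wordCoord e u (X s t)) (fun u => mapCoord e b (H s) k (v ++ u)) -
        mapCoord e b (H t) k v| ≤ C * (ω s t ^ (1 / p)) ^ (⌊p⌋₊ - v.length) := by
  set N := ⌊p⌋₊ with hN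
  rcases lt_trichotomy (v.length + 1) N with h | h | h
  · obtain ⟨C, hC⟩ := hH.controlled v.length (by omega) (tensorBasis e v.length fun i => v.get i.rev)
      (b.coord k)
    refine ⟨C, fun s t hs hst ht => ?_⟩
    have h1 := hC s t hs hst ht
    rw [← hN, ← Nat.cast_sub (by omega), rpow_natCast_div _ (hω.nonneg s t hs hst ht),
      map_sub, abs_sub_comm] at h1
    convert h1 using 3
    swap
    · rfl
    have h2 : (∑ k ∈ Finset.range (N - v.length), incl k (X s t k)) * wordTensor e v =
        ∑ n ∈ Finset.range (N - v.length), ∑ u ∈ wordsOf ι n,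
          wordCoord e u (X s t) • wordTensor e (v ++ u) := by
      simp only [incl_apply_eq_sum e, Finset.sum_mul, smul_mul_assoc, wordTensor_mul]
    change _ = b.coord k (H s ((∑ k ∈ Finset.range (N - v.length), incl k (X s t k)) *
      wordTensor e v))
    rw [h2]
    simp only [map_sum, map_smul, smul_eq_mul]
    rw [wordSum, sum_wordsLE]
    symm
    refine Finset.sum_subset (Finset.range_mono (by omega)) fun n _ hn => ?_
    refine Finset.sum_eq_zero fun u hu => ?_
    change _ * mapCoord e b (H s) k (v ++ u) = 0
    rw [hH.mapCoord_eq_zero e b hs (hst.trans ht), mul_zero]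
    rw [mem_wordsOf] at hu
    rw [Finset.mem_range] at hn
    rw [List.length_append]
    omega
  · obtain ⟨C, hC⟩ := hH.regular (wordTensor e v) (b.coord k)
    refine ⟨C, fun s t hs hst ht => ?_⟩
    have h1 := hC s t hs hst ht
    rw [map_sub, abs_sub_comm] at h1
    rw [show N - v.length = 1 by omega, pow_one]
    convert h1 using 3
    · rw [wordSum, Finset.sum_eq_single []]
      · rw [hX.wordCoord_nil e hs hst ht, one_mul, List.append_nil]
        rfl
      · intro u _ hu
        rw [hH.mapCoord_eq_zero e b hs (hst.trans ht), mul_zero]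
        have := List.length_pos_iff.2 hu
        rw [List.length_append]
        omega
      · intro hn
        exact absurd (mem_wordsLE.2 (by simp)) hn
    · rfl
  · refine ⟨0, fun s t hs hst ht => ?_⟩
    rw [hH.mapCoord_eq_zero e b (hs.trans hst) ht k (by omega), wordSum, Finset.sum_eq_zero]
    · simp
    · intro u _
      rw [hH.mapCoord_eq_zero e b hs (hst.trans ht), mul_zero]
      rw [List.length_append]
      omega

theorem wordCoord_incl_vec (b : Module.Basis κ ℝ U) (k : κ) (v : U) :
    wordCoord b [k] (incl 1 (vec v)) = b.repr v k := by
  rw [vec, wordCoord_incl_tprod]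
  simp [listCoord]

theorem wordCoord_singleton_partialLift (b : Module.Basis κ ℝ U) (s t : ℝ) (k : κ) :
    wordCoord b [k] (partialLift p X H s t) = b.repr (trace H t - trace H s) k := by
  rw [partialLift, map_add, map_add, wordCoord_one, wordCoord_incl_vec, map_sum, Finset.sum_eq_zero]
  · simp
  · intro m hm
    rw [Finset.mem_Icc] at hm
    exact wordCoord_incl_of_ne b (by simp; omega) _

theorem wordCoord_partialLift [Fintype ι] (hX : IsRegularFunctional T p ω X)
    (e : Module.Basis ι ℝ V) (b : Module.Basis κ ℝ U) {s t : ℝ} (hs : 0 ≤ s) (hst : s ≤ t)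
    (ht : t ≤ T) {K : List κ} (hK : K.length ≠ 1) :
    wordCoord b K (partialLift p X H s t) = if K.length ≤ ⌊p⌋₊ then
      wordSum ⌊p⌋₊ (fun w => wordCoord e w (X s t))
        (orderedShuffleCoord (mapCoord e b (H s)) K) else 0 := by
  rw [partialLift, map_add, map_add, wordCoord_one, wordCoord_incl_of_ne b (Ne.symm hK), add_zero,
    map_sum]
  rcases K with _ | ⟨k, K⟩
  · rw [if_pos rfl, if_pos (by simp), IsFiltration.wordSum_nil (hX.wordCoord_nil e hs hst ht),
      Finset.sum_eq_zero, add_zero]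
    intro m hm
    rw [Finset.mem_Icc] at hm
    exact wordCoord_incl_of_ne b (by simp; omega) _
  · rw [if_neg (by simp), zero_add]
    obtain ⟨L, hL⟩ := exists_eq_reverse_ofFn (w := k :: K) rfl
    have hl : 2 ≤ (k :: K).length := by
      simp only [List.length_cons] at hK ⊢; omega
    generalize (k :: K).length = n at L hL hl
    rw [hL]
    split_ifs with hn
    · rw [Finset.sum_eq_single n]
      · rw [wordCoord_reverse_ofFn, incl_apply_self, repr_orderedShufflePairing e]
      · intro m _ hm
        exact wordCoord_incl_of_ne b (by simpa using hm) _
      · intro h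
        exact absurd (Finset.mem_Icc.2 ⟨hl, hn⟩) h
    · refine Finset.sum_eq_zero fun m hm => wordCoord_incl_of_ne b ?_ _
      rw [Finset.mem_Icc] at hm
      simp; omega

end CoordinateEstimates

/-! ### Functions of three times modulo high order -/

section Triples

/-- Triples of times `0 ≤ s ≤ u ≤ t ≤ T`. -/
abbrev Triple (T : ℝ) : Type :=
  {q : ℝ × ℝ × ℝ // 0 ≤ q.1 ∧ q.1 ≤ q.2.1 ∧ q.2.1 ≤ q.2.2 ∧ q.2.2 ≤ T}

variable {T p : ℝ} {ω : ℝ → ℝ → ℝ}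

/-- The unit `ω(s, t)^{1/p}` in which orders are measured. -/
def orderUnit (T p : ℝ) (ω : ℝ → ℝ → ℝ) (q : Triple T) : ℝ := ω q.1.1 q.1.2.2 ^ (1 / p)

/-- A selection of a pair of times inside `[s, t]` for every triple `s ≤ u ≤ t`. -/
structure PairSelection (T : ℝ) (ω : ℝ → ℝ → ℝ) where
  fst : Triple T → ℝ
  snd : Triple T → ℝ
  nonneg : ∀ q, 0 ≤ fst q
  le : ∀ q, fst q ≤ snd q
  le_T : ∀ q, snd q ≤ T
  control_le : ∀ q, ω (fst q) (snd q) ≤ ω q.1.1 q.1.2.2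

theorem orderUnit_nonneg (hω : IsControl T ω) (q : Triple T) : 0 ≤ orderUnit T p ω q :=
  Real.rpow_nonneg (hω.nonneg _ _ q.2.1 (q.2.2.1.trans q.2.2.2.1) q.2.2.2.2) _

open Classical in
/-- The class of a function of `(s, u, t)` modulo `O(ω(s, t)^{(N + 1)/p})`; the value is a junk
value `0` unless the function is bounded. -/
def orderClass (N : ℕ) (ε : Triple T → ℝ) (f : Triple T → ℝ) : OrderQuotient ε N :=
  Ideal.Quotient.mk _ (if hf : ∃ C, ∀ a, |f a| ≤ C then ⟨f, hf⟩ else 0)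

theorem orderClass_mk {N : ℕ} {ε : Triple T → ℝ} (f : boundedFunctions (Triple T)) :
    orderClass N ε f.1 = Ideal.Quotient.mk _ f := by
  have hf : ∃ C, ∀ a, |f.1 a| ≤ C := f.2
  rw [orderClass, dif_pos hf]

theorem orderClass_of_bounded {N : ℕ} {ε f : Triple T → ℝ} (hf : ∃ C, ∀ a, |f a| ≤ C) :
    orderClass N ε f = Ideal.Quotient.mk _ (⟨f, hf⟩ : boundedFunctions (Triple T)) := by
  rw [orderClass, dif_pos hf]

theorem PairSelection.exists_bound (τ : PairSelection T ω) (hω : IsControl T ω) (hp : 0 < p)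
    {n : ℕ} {f : ℝ → ℝ → ℝ}
    (hf : ∃ C, ∀ s t, 0 ≤ s → s ≤ t → t ≤ T → |f s t| ≤ C * (ω s t ^ (1 / p)) ^ n) :
    ∃ C, ∀ q, |f (τ.fst q) (τ.snd q)| ≤ C * orderUnit T p ω q ^ n := by
  obtain ⟨C, hC⟩ := hf
  have h0 : ∀ q, 0 ≤ ω (τ.fst q) (τ.snd q) := fun q =>
    hω.nonneg _ _ (τ.nonneg q) (τ.le q) (τ.le_T q)
  refine ⟨max C 0, fun q => (hC _ _ (τ.nonneg q) (τ.le q) (τ.le_T q)).trans ?_⟩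
  refine mul_le_mul (le_max_left _ _) ?_ (pow_nonneg (Real.rpow_nonneg (h0 q) _) _)
    (le_max_right _ _)
  exact pow_le_pow_left₀ (Real.rpow_nonneg (h0 q) _)
    (Real.rpow_le_rpow (h0 q) (τ.control_le q) (by positivity)) n

theorem orderUnit_le (hω : IsControl T ω) (hp : 0 < p) (q : Triple T) :
    orderUnit T p ω q ≤ ω 0 T ^ (1 / p) :=
  Real.rpow_le_rpow (hω.nonneg _ _ q.2.1 (q.2.2.1.trans q.2.2.2.1) q.2.2.2.2)
    (hω.le_total q.2.1 (q.2.2.1.trans q.2.2.2.1) q.2.2.2.2) (by positivity)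

theorem bounded_of_order (hω : IsControl T ω) (hp : 0 < p) {n : ℕ} {f : Triple T → ℝ}
    (hf : ∃ C, ∀ q, |f q| ≤ C * orderUnit T p ω q ^ n) : ∃ C, ∀ q, |f q| ≤ C := by
  obtain ⟨C, hC0, hC⟩ := exists_nonneg_bound (P := fun _ => True)
    (fun q _ => pow_nonneg (orderUnit_nonneg (p := p) hω q) n) (hf.imp fun C h q _ => h q)
  exact ⟨C * (ω 0 T ^ (1 / p)) ^ n, fun q => (hC q trivial).trans
    (mul_le_mul_of_nonneg_left (pow_le_pow_left₀ (orderUnit_nonneg hω q)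
      (orderUnit_le hω hp q) n) hC0)⟩

theorem orderClass_mem (hω : IsControl T ω) (hp : 0 < p) {N n : ℕ} {f : Triple T → ℝ}
    (hf : ∃ C, ∀ q, |f q| ≤ C * orderUnit T p ω q ^ n) :
    orderClass N (orderUnit T p ω) f ∈ quotientOrderIdeal (orderUnit T p ω) N n := by
  rw [orderClass_of_bounded (bounded_of_order hω hp hf)]
  exact mk_mem_quotientOrderIdeal hf

theorem isFiltration_orderUnit (hω : IsControl T ω) (hp : 0 < p) (N : ℕ) :
    IsFiltration (quotientOrderIdeal (orderUnit T p ω) N) N :=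
  isFiltration_quotientOrderIdeal (orderUnit_nonneg hω) _ (orderUnit_le hω hp) N

/-- The interval `[s, u]`. -/
def PairSelection.left (hω : IsControl T ω) : PairSelection T ω where
  fst q := q.1.1
  snd q := q.1.2.1
  nonneg q := q.2.1
  le q := q.2.2.1
  le_T q := q.2.2.2.1.trans q.2.2.2.2
  control_le q := hω.left_le q.2.1 q.2.2.1 q.2.2.2.1 q.2.2.2.2

/-- The interval `[u, t]`. -/
def PairSelection.right (hω : IsControl T ω) : PairSelection T ω where
  fst q := q.1.2.1
  snd q := q.1.2.2
  nonneg q := q.2.1.trans q.2.2.1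
  le q := q.2.2.2.1
  le_T q := q.2.2.2.2
  control_le q := hω.right_le q.2.1 q.2.2.1 q.2.2.2.1 q.2.2.2.2

/-- The interval `[s, t]`. -/
def PairSelection.full (T : ℝ) (ω : ℝ → ℝ → ℝ) : PairSelection T ω where
  fst q := q.1.1
  snd q := q.1.2.2
  nonneg q := q.2.1
  le q := q.2.2.1.trans q.2.2.2.1
  le_T q := q.2.2.2.2
  control_le _ := le_rfl

end Triples

/-! ### Classes of the coordinates of rough and controlled paths -/

section AlmostRough

variable {V U ι κ : Type*} [AddCommGroup V] [Module ℝ V] [AddCommGroup U] [Module ℝ U]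
  {T p : ℝ} {ω : ℝ → ℝ → ℝ} {X : ℝ → ℝ → TAlg V} {H : ℝ → TAlg V →ₗ[ℝ] U}

/-- The coordinates of `X` over the selected pairs, modulo `O(ω(s, t)^{(N + 1)/p})`. -/
def pathClass (p : ℝ) (e : Module.Basis ι ℝ V) (X : ℝ → ℝ → TAlg V) (τ : PairSelection T ω)
    (w : List ι) : OrderQuotient (orderUnit T p ω) ⌊p⌋₊ :=
  orderClass _ _ fun q => wordCoord e w (X (τ.fst q) (τ.snd q))

/-- The coordinates of `H` at the initial selected times, modulo `O(ω(s, t)^{(N + 1)/p})`. -/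
def mapClass (p : ℝ) (e : Module.Basis ι ℝ V) (b : Module.Basis κ ℝ U)
    (H : ℝ → TAlg V →ₗ[ℝ] U) (τ : PairSelection T ω)
    (k : κ) (w : List ι) : OrderQuotient (orderUnit T p ω) ⌊p⌋₊ :=
  orderClass _ _ fun q => mapCoord e b (H (τ.fst q)) k w

theorem IsRegularFunctional.pathClass_mem (hX : IsRegularFunctional T p ω X) (hω : IsControl T ω)
    (hp : 0 < p) (e : Module.Basis ι ℝ V) (τ : PairSelection T ω) (w : List ι) :
    pathClass p e X τ w ∈ quotientOrderIdeal (orderUnit T p ω) ⌊p⌋₊ w.length :=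
  orderClass_mem hω hp (τ.exists_bound hω hp (hX.wordCoord_bound hω e w))

theorem IsRegularFunctional.coord_bounded (hX : IsRegularFunctional T p ω X) (hω : IsControl T ω)
    (hp : 0 < p) (e : Module.Basis ι ℝ V) (τ : PairSelection T ω) (w : List ι) :
    ∃ C, ∀ q, |wordCoord e w (X (τ.fst q) (τ.snd q))| ≤ C :=
  bounded_of_order hω hp (τ.exists_bound hω hp (hX.wordCoord_bound hω e w))

theorem IsControlledPath.coord_bounded (hH : IsControlledPath T p ω X H)
    (e : Module.Basis ι ℝ V) (b : Module.Basis κ ℝ U) (τ : PairSelection T ω) (k : κ)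
    (w : List ι) : ∃ C, ∀ q, |mapCoord e b (H (τ.fst q)) k w| ≤ C := by
  obtain ⟨C, hC⟩ := hH.mapCoord_bound e b k w
  exact ⟨C, fun q => hC _ (τ.nonneg q) ((τ.le q).trans (τ.le_T q))⟩

theorem IsRegularFunctional.pathClass_nil (hX : IsRegularFunctional T p ω X)
    (e : Module.Basis ι ℝ V) (τ : PairSelection T ω) : pathClass p e X τ [] = 1 := by
  have h : (fun q => wordCoord e [] (X (τ.fst q) (τ.snd q))) =
      (1 : boundedFunctions (Triple T)).1 :=
    funext fun q => hX.wordCoord_nil e (τ.nonneg q) (τ.le q) (τ.le_T q)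
  rw [pathClass, h, orderClass_mk, map_one]

theorem wordSum_orderClass [Fintype ι] {N : ℕ} {ε : Triple T → ℝ} {x : List ι → Triple T → ℝ}
    {F : List ι → Triple T → ℝ} (hx : ∀ w, ∃ C, ∀ q, |x w q| ≤ C)
    (hF : ∀ w, ∃ C, ∀ q, |F w q| ≤ C) (M : ℕ) :
    orderClass N ε (fun q => wordSum M (fun w => x w q) fun w => F w q) =
      wordSum M (fun w => orderClass N ε (x w)) fun w => orderClass N ε (F w) := by
  set x' : List ι → boundedFunctions (Triple T) := fun w => ⟨x w, hx w⟩
  set F' : List ι → boundedFunctions (Triple T) := fun w => ⟨F w, hF w⟩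
  have h : (fun q => wordSum M (fun w => x w q) fun w => F w q) =
      (wordSum M x' F' : boundedFunctions (Triple T)).1 := by
    ext q
    exact (map_wordSum ((Pi.evalRingHom (fun _ => ℝ) q).comp (Subring.subtype _)) M x' F').symm
  rw [h, orderClass_mk, map_wordSum]
  simp only [orderClass_of_bounded (hx _), orderClass_of_bounded (hF _)]
  rfl

theorem orderedShuffleCoord_bounded {h : κ → List ι → Triple T → ℝ}
    (hh : ∀ k w, ∃ C, ∀ q, |h k w q| ≤ C) (K : List κ) (w : List ι) :
    ∃ C, ∀ q, |orderedShuffleCoord (fun k v => h k v q) K w| ≤ C := by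
  set h' : κ → List ι → boundedFunctions (Triple T) := fun k w => ⟨h k w, hh k w⟩
  obtain ⟨C, hC⟩ := (orderedShuffleCoord h' K w).2
  refine ⟨C, fun q => ?_⟩
  have := map_orderedShuffleCoord ((Pi.evalRingHom (fun _ => ℝ) q).comp (Subring.subtype _)) h' K w
  rw [show orderedShuffleCoord (fun k v => h k v q) K w = (orderedShuffleCoord h' K w).1 q from
    this.symm]
  exact hC q

theorem orderedShuffleCoord_orderClass {N : ℕ} {ε : Triple T → ℝ} {h : κ → List ι → Triple T → ℝ}
    (hh : ∀ k w, ∃ C, ∀ q, |h k w q| ≤ C) (K : List κ) (w : List ι) :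
    orderClass N ε (fun q => orderedShuffleCoord (fun k v => h k v q) K w) =
      orderedShuffleCoord (fun k v => orderClass N ε (h k v)) K w := by
  set h' : κ → List ι → boundedFunctions (Triple T) := fun k w => ⟨h k w, hh k w⟩
  have h1 : (fun q => orderedShuffleCoord (fun k v => h k v q) K w) =
      (orderedShuffleCoord h' K w).1 := by
    ext q
    exact (map_orderedShuffleCoord
      ((Pi.evalRingHom (fun _ => ℝ) q).comp (Subring.subtype _)) h' K w).symm
  rw [h1, orderClass_mk, map_orderedShuffleCoord]
  simp only [orderClass_of_bounded (hh _ _)]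
  rfl

theorem orderClass_sub {N : ℕ} {ε f g : Triple T → ℝ} (hf : ∃ C, ∀ q, |f q| ≤ C)
    (hg : ∃ C, ∀ q, |g q| ≤ C) :
    orderClass N ε (fun q => f q - g q) = orderClass N ε f - orderClass N ε g := by
  rw [orderClass_of_bounded hf, orderClass_of_bounded hg, ← map_sub, ← orderClass_mk]
  rfl

theorem orderClass_mul {N : ℕ} {ε f g : Triple T → ℝ} (hf : ∃ C, ∀ q, |f q| ≤ C)
    (hg : ∃ C, ∀ q, |g q| ≤ C) :
    orderClass N ε (fun q => f q * g q) = orderClass N ε f * orderClass N ε g := by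
  rw [orderClass_of_bounded hf, orderClass_of_bounded hg, ← map_mul, ← orderClass_mk]
  rfl

theorem deconcSum_orderClass {α : Type*} {N : ℕ} {ε : Triple T → ℝ}
    {q : List α → List α → Triple T → ℝ} (hq : ∀ v u, ∃ C, ∀ a, |q v u a| ≤ C) (K : List α) :
    (∃ C, ∀ a, |deconcSum K fun v u => q v u a| ≤ C) ∧
    orderClass N ε (fun a => deconcSum K fun v u => q v u a) =
      deconcSum K fun v u => orderClass N ε (q v u) := by
  set q' : List α → List α → boundedFunctions (Triple T) := fun v u => ⟨q v u, hq v u⟩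
  have h1 : (fun a => deconcSum K fun v u => q v u a) = (deconcSum K q').1 := by
    ext a
    exact (map_deconcSum ((Pi.evalRingHom (fun _ => ℝ) a).comp
      (Subring.subtype (boundedFunctions (Triple T)))).toAddMonoidHom K q').symm
  refine ⟨?_, ?_⟩
  · obtain ⟨C, hC⟩ := (deconcSum K q').2
    exact ⟨C, fun a => by rw [show (deconcSum K fun v u => q v u a) = _ from congrFun h1 a]; exact hC a⟩
  · rw [h1, orderClass_mk]
    refine (map_deconcSum (Ideal.Quotient.mk _).toAddMonoidHom K q').trans ?_
    simp only [orderClass_of_bounded (hq _ _)]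
    rfl

theorem shuffleSum_orderClass {α : Type*} {N : ℕ} {ε : Triple T → ℝ}
    {y : List α → Triple T → ℝ} (hy : ∀ M, ∃ C, ∀ a, |y M a| ≤ C) (K L : List α) :
    (∃ C, ∀ a, |shuffleSum K L fun M => y M a| ≤ C) ∧
    orderClass N ε (fun a => shuffleSum K L fun M => y M a) =
      shuffleSum K L fun M => orderClass N ε (y M) := by
  set y' : List α → boundedFunctions (Triple T) := fun M => ⟨y M, hy M⟩
  have h1 : (fun a => shuffleSum K L fun M => y M a) = (shuffleSum K L y').1 := by
    ext a
    exact (map_shuffleSum ((Pi.evalRingHom (fun _ => ℝ) a).comp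
      (Subring.subtype (boundedFunctions (Triple T)))).toAddMonoidHom K L y').symm
  refine ⟨?_, ?_⟩
  · obtain ⟨C, hC⟩ := (shuffleSum K L y').2
    exact ⟨C, fun a => by rw [show (shuffleSum K L fun M => y M a) = _ from congrFun h1 a]; exact hC a⟩
  · rw [h1, orderClass_mk]
    refine (map_shuffleSum (Ideal.Quotient.mk _).toAddMonoidHom K L y').trans ?_
    simp only [orderClass_of_bounded (hy _)]
    rfl

/-- Equality of classes is an estimate of order `O(ε^{N + 1})`. -/
theorem exists_bound_of_orderClass_eq {N : ℕ} {ε f g : Triple T → ℝ} (hf : ∃ C, ∀ q, |f q| ≤ C)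
    (hg : ∃ C, ∀ q, |g q| ≤ C) (h : orderClass N ε f = orderClass N ε g) :
    ∃ C, ∀ q, |f q - g q| ≤ C * ε q ^ (N + 1) := by
  rw [orderClass_of_bounded hf, orderClass_of_bounded hg, Ideal.Quotient.eq] at h
  exact h

end AlmostRough

/-! ### Estimates for the ordered-shuffle functional -/

section AlmostRoughPath

variable {V U ι κ : Type*} [AddCommGroup V] [Module ℝ V] [AddCommGroup U] [Module ℝ U]
  {T p : ℝ} {ω : ℝ → ℝ → ℝ} {X : ℝ → ℝ → TAlg V} {H : ℝ → TAlg V →ₗ[ℝ] U}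

theorem exists_pair_bound {f : ℝ → ℝ → ℝ} {n : ℕ}
    (h : ∃ C, ∀ q : Triple T, |f q.1.1 q.1.2.2| ≤ C * orderUnit T p ω q ^ n) :
    ∃ C, ∀ s t, 0 ≤ s → s ≤ t → t ≤ T → |f s t| ≤ C * (ω s t ^ (1 / p)) ^ n := by
  obtain ⟨C, hC⟩ := h
  exact ⟨C, fun s t hs hst ht => hC ⟨(s, s, t), hs, le_rfl, hst, ht⟩⟩

theorem wordSum_orderedShuffleCoord_singleton {R : Type*} [CommRing R] [Fintype ι] (N : ℕ)
    {x : List ι → R} (hx : x [] = 1) (h : κ → List ι → R) (k : κ) :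
    wordSum N x (orderedShuffleCoord h [k]) = wordSum N x (h k) - h k [] := by
  have hmem : ([] : List ι) ∈ wordsLE ι N := mem_wordsLE.2 (by simp)
  classical
  rw [wordSum, wordSum, ← Finset.add_sum_erase _ _ hmem, ← Finset.add_sum_erase _ _ hmem, hx,
    one_mul, one_mul, add_sub_cancel_left]
  simp only [orderedShuffleCoord, zero_add]
  refine Finset.sum_congr rfl fun w hw => ?_
  rw [orderedShuffleCoord_singleton, if_neg (Finset.ne_of_mem_erase hw)]

theorem repr_trace (H : ℝ → TAlg V →ₗ[ℝ] U)
    (e : Module.Basis ι ℝ V) (b : Module.Basis κ ℝ U) (t : ℝ) (k : κ) :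
    b.repr (trace H t) k = mapCoord e b (H t) k [] := by
  rw [trace, mapCoord, one_eq_wordTensor e]

/-- The increment of the trace agrees, up to order `N`, with the first level of the ordered-shuffle
map. -/
theorem IsControlledPath.trace_sub_bound [Fintype ι] (hX : IsRegularFunctional T p ω X)
    (hH : IsControlledPath T p ω X H) (hω : IsControl T ω)
    (e : Module.Basis ι ℝ V) (b : Module.Basis κ ℝ U) (k : κ) :
    ∃ C, ∀ s t, 0 ≤ s → s ≤ t → t ≤ T →
      |wordSum ⌊p⌋₊ (fun w => wordCoord e w (X s t))
          (orderedShuffleCoord (mapCoord e b (H s)) [k]) -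
        wordCoord b [k] (partialLift p X H s t)| ≤ C * (ω s t ^ (1 / p)) ^ ⌊p⌋₊ := by
  obtain ⟨C, hC⟩ := hH.mapCoord_sub_bound hX hω e b k []
  refine ⟨C, fun s t hs hst ht => ?_⟩
  have h1 := hC s t hs hst ht
  rw [wordSum_orderedShuffleCoord_singleton _ (hX.wordCoord_nil e hs hst ht),
    wordCoord_singleton_partialLift, map_sub, Finsupp.sub_apply,
    repr_trace H e b, repr_trace H e b]
  simp only [List.nil_append, List.length_nil, Nat.sub_zero] at h1
  convert h1 using 2
  ring

theorem wordCoord_nil_partialLift [Fintype ι] (hX : IsRegularFunctional T p ω X)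
    (e : Module.Basis ι ℝ V) (b : Module.Basis κ ℝ U) {s t : ℝ} (hs : 0 ≤ s) (hst : s ≤ t)
    (ht : t ≤ T) : wordCoord b [] (partialLift p X H s t) = 1 := by
  rw [wordCoord_partialLift hX e b hs hst ht (by simp), if_pos (by simp),
    IsFiltration.wordSum_nil (hX.wordCoord_nil e hs hst ht)]

/-- The `m`-th level of the ordered-shuffle functional has order `m`. -/
theorem partialLift_bound [Fintype ι] (hX : IsRegularFunctional T p ω X)
    (hH : IsControlledPath T p ω X H) (hω : IsControl T ω) (hp : 0 < p)
    (e : Module.Basis ι ℝ V) (b : Module.Basis κ ℝ U) (K : List κ) :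
    ∃ C, ∀ s t, 0 ≤ s → s ≤ t → t ≤ T →
      |wordCoord b K (partialLift p X H s t)| ≤ C * (ω s t ^ (1 / p)) ^ K.length := by
  by_cases hK : K.length = 1
  · obtain ⟨k, rfl⟩ := List.length_eq_one_iff.1 hK
    obtain ⟨C, hC⟩ := hH.regular 1 (b.coord k)
    refine ⟨C, fun s t hs hst ht => ?_⟩
    rw [wordCoord_singleton_partialLift, List.length_singleton, pow_one]
    exact hC s t hs hst ht
  · by_cases hN : K.length ≤ ⌊p⌋₊
    · refine exists_pair_bound ?_
      set τ := PairSelection.full T ω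
      set x : List ι → boundedFunctions (Triple T) := fun w => ⟨_, hX.coord_bounded hω hp e τ w⟩
      set F : List ι → boundedFunctions (Triple T) := fun w =>
        ⟨_, orderedShuffleCoord_bounded (fun k w => hH.coord_bounded e b τ k w) K w⟩
      have h1 : wordSum ⌊p⌋₊ x F ∈ orderIdeal (orderUnit T p ω) K.length := by
        refine Ideal.sum_mem _ fun w _ => ?_
        by_cases hw : w.length < K.length
        · have : F w = 0 := by
            ext q
            exact orderedShuffleCoord_eq_zero _ hw
          rw [this, mul_zero]
          exact Ideal.zero_mem _
        · refine Ideal.mul_mem_right _ _ (orderIdeal_antitone (orderUnit_nonneg hω) _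
            (orderUnit_le hω hp) (not_lt.1 hw) ?_)
          exact τ.exists_bound hω hp (hX.wordCoord_bound hω e w)
      obtain ⟨C, hC⟩ := h1
      refine ⟨C, fun q => ?_⟩
      have h2 := hC q
      change |wordCoord b K (partialLift p X H (τ.fst q) (τ.snd q))| ≤ _
      rw [wordCoord_partialLift hX e b (τ.nonneg q) (τ.le q) (τ.le_T q) hK, if_pos hN]
      convert h2 using 2
      exact (map_wordSum ((Pi.evalRingHom (fun _ => ℝ) q).comp (Subring.subtype _)) _ x F).symm
    · refine ⟨0, fun s t hs hst ht => ?_⟩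
      rw [wordCoord_partialLift hX e b hs hst ht hK, if_neg hN]
      simp

/-- The coordinates of the ordered-shuffle functional over the selected pairs, modulo
`O(ω(s, t)^{(N + 1)/p})`. -/
def liftClass (p : ℝ) (b : Module.Basis κ ℝ U) (X : ℝ → ℝ → TAlg V) (H : ℝ → TAlg V →ₗ[ℝ] U)
    (τ : PairSelection T ω) (K : List κ) : OrderQuotient (orderUnit T p ω) ⌊p⌋₊ :=
  orderClass _ _ fun q => wordCoord b K (partialLift p X H (τ.fst q) (τ.snd q))

theorem liftClass_bounded [Fintype ι] (hX : IsRegularFunctional T p ω X)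
    (hH : IsControlledPath T p ω X H) (hω : IsControl T ω) (hp : 0 < p)
    (e : Module.Basis ι ℝ V) (b : Module.Basis κ ℝ U) (τ : PairSelection T ω) (K : List κ) :
    ∃ C, ∀ q, |wordCoord b K (partialLift p X H (τ.fst q) (τ.snd q))| ≤ C :=
  bounded_of_order hω hp (τ.exists_bound hω hp (partialLift_bound hX hH hω hp e b K))

theorem liftClass_mem [Fintype ι] (hX : IsRegularFunctional T p ω X)
    (hH : IsControlledPath T p ω X H) (hω : IsControl T ω) (hp : 0 < p)
    (e : Module.Basis ι ℝ V) (b : Module.Basis κ ℝ U) (τ : PairSelection T ω) (K : List κ) :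
    liftClass p b X H τ K ∈ quotientOrderIdeal (orderUnit T p ω) ⌊p⌋₊ K.length :=
  orderClass_mem hω hp (τ.exists_bound hω hp (partialLift_bound hX hH hω hp e b K))

theorem wordSum_classes_eq [Fintype ι] (hX : IsRegularFunctional T p ω X)
    (hH : IsControlledPath T p ω X H) (hω : IsControl T ω) (hp : 0 < p)
    (e : Module.Basis ι ℝ V) (b : Module.Basis κ ℝ U) (τ : PairSelection T ω) (K : List κ) :
    wordSum ⌊p⌋₊ (pathClass p e X τ) (orderedShuffleCoord (mapClass p e b H τ) K) =
      orderClass _ _ fun q => wordSum ⌊p⌋₊ (fun w => wordCoord e w (X (τ.fst q) (τ.snd q)))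
        (orderedShuffleCoord (mapCoord e b (H (τ.fst q))) K) := by
  refine Eq.symm ((wordSum_orderClass (fun w => hX.coord_bounded hω hp e τ w)
    (fun w => orderedShuffleCoord_bounded (fun k w => hH.coord_bounded e b τ k w) K w) _).trans ?_)
  refine congrArg _ (funext fun w => ?_)
  exact orderedShuffleCoord_orderClass (fun k w => hH.coord_bounded e b τ k w) K w

theorem liftClass_eq [Fintype ι] (hX : IsRegularFunctional T p ω X)
    (hH : IsControlledPath T p ω X H) (hω : IsControl T ω) (hp : 0 < p)
    (e : Module.Basis ι ℝ V) (b : Module.Basis κ ℝ U) (τ : PairSelection T ω) (K : List κ)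
    (hK : K.length ≠ 1) : liftClass p b X H τ K =
      wordSum ⌊p⌋₊ (pathClass p e X τ) (orderedShuffleCoord (mapClass p e b H τ) K) := by
  by_cases hN : K.length ≤ ⌊p⌋₊
  · rw [wordSum_classes_eq hX hH hω hp, liftClass]
    refine congrArg _ (funext fun q => ?_)
    rw [wordCoord_partialLift hX e b (τ.nonneg q) (τ.le q) (τ.le_T q) hK, if_pos hN]
  · have hI := isFiltration_orderUnit (T := T) hω hp ⌊p⌋₊
    rw [hI.eq_zero (liftClass_mem hX hH hω hp e b τ K) (by omega),
      hI.eq_zero (hI.wordSum_orderedShuffleCoord_mem (hX.pathClass_mem hω hp e τ) _ K) (by omega)]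

/-- On the first level the ordered-shuffle functional is defined by the increment of the trace,
which agrees with the ordered-shuffle map up to order `N`. -/
theorem wordSum_sub_liftClass_mem [Fintype ι] (hX : IsRegularFunctional T p ω X)
    (hH : IsControlledPath T p ω X H) (hω : IsControl T ω) (hp : 0 < p)
    (e : Module.Basis ι ℝ V) (b : Module.Basis κ ℝ U) (τ : PairSelection T ω) (K : List κ)
    (hK : K.length = 1) :
    wordSum ⌊p⌋₊ (pathClass p e X τ) (orderedShuffleCoord (mapClass p e b H τ) K) -
      liftClass p b X H τ K ∈ quotientOrderIdeal (orderUnit T p ω) ⌊p⌋₊ ⌊p⌋₊ := by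
  obtain ⟨k, rfl⟩ := List.length_eq_one_iff.1 hK
  have h := τ.exists_bound hω hp (hH.trace_sub_bound hX hω e b k)
  have hl := liftClass_bounded hX hH hω hp e b τ [k]
  rw [wordSum_classes_eq hX hH hω hp, liftClass, ← orderClass_sub ?_ hl]
  · exact orderClass_mem hω hp h
  · obtain ⟨C, hC⟩ := bounded_of_order hω hp h
    obtain ⟨D, hD⟩ := hl
    refine ⟨C + D, fun q => ?_⟩
    have := abs_add_le (wordSum ⌊p⌋₊ (fun w => wordCoord e w (X (τ.fst q) (τ.snd q)))
        (orderedShuffleCoord (mapCoord e b (H (τ.fst q))) [k]) -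
      wordCoord b [k] (partialLift p X H (τ.fst q) (τ.snd q)))
      (wordCoord b [k] (partialLift p X H (τ.fst q) (τ.snd q)))
    rw [sub_add_cancel] at this
    exact this.trans (add_le_add (hC q) (hD q))

/-- Modulo `O(ω(s, t)^{(N + 1)/p})`, integration by parts holds at words of arbitrary length: both
sides vanish when the total length exceeds `N`. -/
theorem IsRoughPath.isShuffleCharacter_pathClass (hX : IsRoughPath T p ω X)
    (hω : IsControl T ω) (hp : 0 < p) (e : Module.Basis ι ℝ V) (τ : PairSelection T ω) :
    IsShuffleCharacter (pathClass p e X τ) := by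
  intro u v
  have hXr := hX.toIsRegularFunctional
  by_cases h : u.length + v.length ≤ ⌊p⌋₊
  · have hb := fun w => hXr.coord_bounded hω hp e τ w
    rw [pathClass, pathClass, ← orderClass_mul (hb u) (hb v)]
    refine Eq.trans ?_ (shuffleSum_orderClass hb u v).2
    refine congrArg _ (funext fun q => ?_)
    exact hX.wordCoord_mul_eq_shuffleSum e (τ.nonneg q) (τ.le q) (τ.le_T q) h
  · have hI := isFiltration_orderUnit (T := T) hω hp ⌊p⌋₊
    rw [hI.mul_eq_zero (hXr.pathClass_mem hω hp e τ u) (hXr.pathClass_mem hω hp e τ v) (by omega),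
      shuffleSum_congr (y' := fun _ => 0) fun M hM =>
        hI.eq_zero (hXr.pathClass_mem hω hp e τ M) (by omega), shuffleSum_zero]

/-- Almost multiplicativity of the ordered-shuffle functional, in coordinates. -/
theorem partialLift_almost_multiplicative [Fintype ι] (hX : IsRoughPath T p ω X)
    (hH : IsControlledPath T p ω X H) (hω : IsControl T ω) (hp : 0 < p)
    (e : Module.Basis ι ℝ V) (b : Module.Basis κ ℝ U) (K : List κ) :
    ∃ C, ∀ s u t, 0 ≤ s → s ≤ u → u ≤ t → t ≤ T →
      |wordCoord b K (partialLift p X H s u * partialLift p X H u t) -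
        wordCoord b K (partialLift p X H s t)| ≤ C * (ω s t ^ (1 / p)) ^ (⌊p⌋₊ + 1) := by
  have hXr := hX.toIsRegularFunctional
  rcases Nat.lt_trichotomy K.length 1 with hK | hK | hK
  · have : K = [] := List.length_eq_zero_iff.1 (by omega)
    subst this
    refine ⟨0, fun s u t hs hsu hut ht => ?_⟩
    rw [wordCoord_mul, deconcSum, wordCoord_nil_partialLift hXr e b hs hsu (hut.trans ht),
      wordCoord_nil_partialLift hXr e b (hs.trans hsu) hut ht,
      wordCoord_nil_partialLift hXr e b hs (hsu.trans hut) ht]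
    simp
  · obtain ⟨k, rfl⟩ := List.length_eq_one_iff.1 hK
    refine ⟨0, fun s u t hs hsu hut ht => ?_⟩
    rw [wordCoord_mul, deconcSum, deconcSum,
      wordCoord_nil_partialLift hXr e b hs hsu (hut.trans ht),
      wordCoord_nil_partialLift hXr e b (hs.trans hsu) hut ht, wordCoord_singleton_partialLift,
      wordCoord_singleton_partialLift, wordCoord_singleton_partialLift]
    simp
  · set L := PairSelection.left hω
    set R := PairSelection.right hω
    set F := PairSelection.full T ω
    have hI := isFiltration_orderUnit (T := T) hω hp ⌊p⌋₊
    have hz : ∀ w : List ι, w.length ≤ ⌊p⌋₊ → pathClass p e X F w =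
        deconcSum w fun v u => pathClass p e X L u * pathClass p e X R v := by
      intro w hw
      have hbd : ∀ v u : List ι, ∃ C, ∀ q : Triple T,
          |wordCoord e u (X (L.fst q) (L.snd q)) * wordCoord e v (X (R.fst q) (R.snd q))| ≤ C :=
        fun v u => exists_mul_bound (hXr.coord_bounded hω hp e L u)
          (hXr.coord_bounded hω hp e R v)
      simp only [pathClass, ← orderClass_mul (hXr.coord_bounded hω hp e L _)
        (hXr.coord_bounded hω hp e R _)]
      refine Eq.trans ?_ (deconcSum_orderClass hbd w).2
      refine congrArg _ (funext fun q => ?_)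
      exact hX.wordCoord_eq_deconcSum e q.2.1 q.2.2.1 q.2.2.2.1 q.2.2.2.2 hw
    have hh : ∀ k v, (wordSum ⌊p⌋₊ (pathClass p e X L) fun u => mapClass p e b H L k (v ++ u)) -
        mapClass p e b H R k v ∈ quotientOrderIdeal (orderUnit T p ω) ⌊p⌋₊ (⌊p⌋₊ - v.length) := by
      intro k v
      have h := L.exists_bound hω hp (hH.mapCoord_sub_bound hXr hω e b k v)
      have hr := hH.coord_bounded e b R k v
      have h1 : (wordSum ⌊p⌋₊ (pathClass p e X L) fun u => mapClass p e b H L k (v ++ u)) =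
          orderClass _ _ fun q => wordSum ⌊p⌋₊
            (fun w => wordCoord e w (X (L.fst q) (L.snd q)))
            fun u => mapCoord e b (H (L.fst q)) k (v ++ u) :=
        (wordSum_orderClass (fun w => hXr.coord_bounded hω hp e L w)
          (fun u => hH.coord_bounded e b L k (v ++ u)) _).symm
      rw [h1, mapClass, ← orderClass_sub ?_ hr]
      · exact orderClass_mem hω hp h
      · obtain ⟨C, hC⟩ := bounded_of_order hω hp h
        obtain ⟨D, hD⟩ := hr
        refine ⟨C + D, fun q => ?_⟩
        have := abs_add_le (wordSum ⌊p⌋₊ (fun w => wordCoord e w (X (L.fst q) (L.snd q)))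
            (fun u => mapCoord e b (H (L.fst q)) k (v ++ u)) - mapCoord e b (H (R.fst q)) k v)
          (mapCoord e b (H (R.fst q)) k v)
        rw [sub_add_cancel] at this
        exact this.trans (add_le_add (hC q) (hD q))
    have key := hI.deconcSum_wordSum_eq (hXr.pathClass_mem hω hp e L)
      (hXr.pathClass_mem hω hp e R) (hXr.pathClass_nil e R)
      (hX.isShuffleCharacter_pathClass hω hp e L) hz hh
      (liftClass_eq hXr hH hω hp e b L) (wordSum_sub_liftClass_mem hXr hH hω hp e b L)
      (liftClass_mem hXr hH hω hp e b L)
      (liftClass_eq hXr hH hω hp e b R) (wordSum_sub_liftClass_mem hXr hH hω hp e b R)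
      (K := K) (by omega)
    rw [show mapClass p e b H L = mapClass p e b H F from rfl,
      ← liftClass_eq hXr hH hω hp e b F K (by omega)] at key
    have hbd : ∀ v u : List κ, ∃ C, ∀ q : Triple T,
        |wordCoord b u (partialLift p X H (L.fst q) (L.snd q)) *
          wordCoord b v (partialLift p X H (R.fst q) (R.snd q))| ≤ C :=
      fun v u => exists_mul_bound (liftClass_bounded hXr hH hω hp e b L u)
        (liftClass_bounded hXr hH hω hp e b R v)
    simp only [liftClass, ← orderClass_mul (liftClass_bounded hXr hH hω hp e b L _)
      (liftClass_bounded hXr hH hω hp e b R _)] at key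
    obtain ⟨hb1, h1⟩ := deconcSum_orderClass (N := ⌊p⌋₊) (ε := orderUnit T p ω) hbd K
    obtain ⟨C, hC⟩ := exists_bound_of_orderClass_eq hb1
      (liftClass_bounded hXr hH hω hp e b F K) (h1.trans key)
    refine ⟨C, fun s u t hs hsu hut ht => ?_⟩
    rw [wordCoord_mul]
    exact hC ⟨(s, u, t), hs, hsu, hut, ht⟩

/-- Almost integration by parts for the ordered-shuffle functional, in coordinates. -/
theorem partialLift_almost_geometric [Fintype ι] (hX : IsRoughPath T p ω X)
    (hH : IsControlledPath T p ω X H) (hω : IsControl T ω) (hp : 0 < p)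
    (e : Module.Basis ι ℝ V) (b : Module.Basis κ ℝ U) (K L : List κ) :
    ∃ C, ∀ s t, 0 ≤ s → s ≤ t → t ≤ T →
      |wordCoord b K (partialLift p X H s t) * wordCoord b L (partialLift p X H s t) -
        shuffleSum K L fun M => wordCoord b M (partialLift p X H s t)| ≤
        C * (ω s t ^ (1 / p)) ^ (⌊p⌋₊ + 1) := by
  have hXr := hX.toIsRegularFunctional
  rcases K with _ | ⟨k, K⟩
  · refine ⟨0, fun s t hs hst ht => ?_⟩
    rw [shuffleSum_nil_left, wordCoord_nil_partialLift hXr e b hs hst ht]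
    simp
  rcases L with _ | ⟨l, L⟩
  · refine ⟨0, fun s t hs hst ht => ?_⟩
    rw [shuffleSum_nil_right, wordCoord_nil_partialLift hXr e b hs hst ht]
    simp
  set F := PairSelection.full T ω
  have hI := isFiltration_orderUnit (T := T) hω hp ⌊p⌋₊
  have key := hI.shuffleSum_wordSum_eq (hXr.pathClass_mem hω hp e F)
    (hX.isShuffleCharacter_pathClass hω hp e F)
    (liftClass_eq hXr hH hω hp e b F) (wordSum_sub_liftClass_mem hXr hH hω hp e b F)
    (liftClass_mem hXr hH hω hp e b F) (K := k :: K) (L := l :: L) (by simp) (by simp)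
  have hb := fun M => liftClass_bounded hXr hH hω hp e b F M
  obtain ⟨hb1, h1⟩ := shuffleSum_orderClass (N := ⌊p⌋₊) (ε := orderUnit T p ω) hb (k :: K) (l :: L)
  refine exists_pair_bound ?_
  refine exists_bound_of_orderClass_eq (exists_mul_bound (hb (k :: K)) (hb (l :: L))) hb1 ?_
  exact (orderClass_mul (hb _) (hb _)).trans (key.trans h1.symm)

end AlmostRoughPath

/-! ### Continuity, and the almost rough path of ordered shuffles -/

section Assembly

theorem continuousOn_splitSum {α β : Type*} [TopologicalSpace β] {S : Set β} (w : List α)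
    {q : List α → List α → β → ℝ} (hq : ∀ a b, ContinuousOn (q a b) S) :
    ContinuousOn (fun t => splitSum w fun a b => q a b t) S := by
  induction w generalizing q with
  | nil => exact hq _ _
  | cons x w ih => exact (ih fun a b => hq _ _).add (ih fun a b => hq _ _)

theorem continuousOn_deconcSum {α β : Type*} [TopologicalSpace β] {S : Set β} (w : List α)
    {q : List α → List α → β → ℝ} (hq : ∀ a b, a ++ b = w → ContinuousOn (q a b) S) :
    ContinuousOn (fun t => deconcSum w fun a b => q a b t) S := by
  induction w generalizing q with
  | nil => exact hq _ _ rfl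
  | cons x w ih => exact (hq _ _ rfl).add (ih fun a b hab => hq _ _ (by simp [hab]))

theorem continuousOn_orderedShuffleCoord {ι κ β : Type*} [TopologicalSpace β] {S : Set β}
    {h : κ → List ι → β → ℝ} (hh : ∀ k w, ContinuousOn (h k w) S) (K : List κ) (w : List ι) :
    ContinuousOn (fun t => orderedShuffleCoord (fun k v => h k v t) K w) S := by
  induction K generalizing w with
  | nil => cases w <;> exact continuousOn_const
  | cons k K ih =>
    cases w with
    | nil => exact continuousOn_const
    | cons x w => exact continuousOn_splitSum w fun a b => (ih a).mul (hh k (x :: b))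

variable {V U ι κ : Type*} [AddCommGroup V] [Module ℝ V] [AddCommGroup U] [Module ℝ U]
  {T p : ℝ} {ω : ℝ → ℝ → ℝ} {X : ℝ → ℝ → TAlg V} {H : ℝ → TAlg V →ₗ[ℝ] U}

theorem IsRegularFunctional.continuousOn_wordCoord (hX : IsRegularFunctional T p ω X)
    (e : Module.Basis ι ℝ V) (w : List ι) :
    ContinuousOn (fun q : ℝ × ℝ => wordCoord e w (X q.1 q.2)) (simplex T) := by
  rcases le_or_gt w.length ⌊p⌋₊ with hw | hw
  · obtain ⟨ℓ, hℓ⟩ := exists_dual_eq_wordCoord e w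
    simp only [hℓ]
    exact hX.continuousOn _ hw ℓ
  · exact (continuousOn_const (c := (0 : ℝ))).congr fun q hq =>
      hX.wordCoord_eq_zero e hq.1 hq.2.1 hq.2.2 hw

theorem IsControlledPath.continuousOn_mapCoord_fst (hH : IsControlledPath T p ω X H)
    (e : Module.Basis ι ℝ V) (b : Module.Basis κ ℝ U) (k : κ) (w : List ι) :
    ContinuousOn (fun q : ℝ × ℝ => mapCoord e b (H q.1) k w) (simplex T) :=
  (hH.continuousOn (wordTensor e w) (b.coord k)).comp continuousOn_fst
    fun _ hq => ⟨hq.1, hq.2.1.trans hq.2.2⟩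

theorem IsControlledPath.continuousOn_mapCoord_snd (hH : IsControlledPath T p ω X H)
    (e : Module.Basis ι ℝ V) (b : Module.Basis κ ℝ U) (k : κ) (w : List ι) :
    ContinuousOn (fun q : ℝ × ℝ => mapCoord e b (H q.2) k w) (simplex T) :=
  (hH.continuousOn (wordTensor e w) (b.coord k)).comp continuousOn_snd
    fun _ hq => ⟨hq.1.trans hq.2.1, hq.2.2⟩

theorem continuousOn_wordCoord_partialLift [Fintype ι] (hX : IsRegularFunctional T p ω X)
    (hH : IsControlledPath T p ω X H) (e : Module.Basis ι ℝ V) (b : Module.Basis κ ℝ U)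
    (K : List κ) :
    ContinuousOn (fun q : ℝ × ℝ => wordCoord b K (partialLift p X H q.1 q.2)) (simplex T) := by
  by_cases hK : K.length = 1
  · obtain ⟨k, rfl⟩ := List.length_eq_one_iff.1 hK
    simp only [wordCoord_singleton_partialLift, map_sub, Finsupp.sub_apply,
      repr_trace H e b]
    exact (hH.continuousOn_mapCoord_snd e b k []).sub (hH.continuousOn_mapCoord_fst e b k [])
  · by_cases hN : K.length ≤ ⌊p⌋₊
    · refine ContinuousOn.congr (f := fun q : ℝ × ℝ => wordSum ⌊p⌋₊
        (fun w => wordCoord e w (X q.1 q.2)) (orderedShuffleCoord (mapCoord e b (H q.1)) K))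
        (continuousOn_finsetSum _ fun w _ => (hX.continuousOn_wordCoord e w).mul
          (continuousOn_orderedShuffleCoord
            (fun k v => hH.continuousOn_mapCoord_fst e b k v) K w)) fun q hq => ?_
      rw [wordCoord_partialLift hX e b hq.1 hq.2.1 hq.2.2 hK, if_pos hN]
    · refine (continuousOn_const (c := (0 : ℝ))).congr fun q hq => ?_
      rw [wordCoord_partialLift hX e b hq.1 hq.2.1 hq.2.2 hK, if_neg hN]

/-- A functional is regular as soon as its coordinates are. -/
theorem isRegularFunctional_of_wordCoord [Fintype κ] (hω : IsControl T ω)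
    (b : Module.Basis κ ℝ U) {Y : ℝ → ℝ → TAlg U}
    (h0 : ∀ s t, 0 ≤ s → s ≤ t → t ≤ T → wordCoord b [] (Y s t) = 1)
    (hN : ∀ s t, 0 ≤ s → s ≤ t → t ≤ T → ∀ w : List κ, ⌊p⌋₊ < w.length →
      wordCoord b w (Y s t) = 0)
    (hc : ∀ w : List κ, w.length ≤ ⌊p⌋₊ →
      ContinuousOn (fun q : ℝ × ℝ => wordCoord b w (Y q.1 q.2)) (simplex T))
    (hb : ∀ w : List κ, w.length ≤ ⌊p⌋₊ → ∃ C, ∀ s t, 0 ≤ s → s ≤ t → t ≤ T →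
      |wordCoord b w (Y s t)| ≤ C * (ω s t ^ (1 / p)) ^ w.length) :
    IsRegularFunctional T p ω Y where
  truncated s t hs hst ht n hn := by
    rw [apply_eq_of_wordCoord_eq b (a' := 0) fun w hw => ?_]
    · rfl
    · rw [hN s t hs hst ht w (by omega), map_zero]
  continuousOn n hn ℓ := by
    simp only [dual_apply_eq_sum b ℓ]
    exact continuousOn_finsetSum _ fun K _ => (hc _ (by simpa using hn)).mul continuousOn_const
  level_zero s t hs hst ht := by
    refine apply_eq_of_wordCoord_eq b fun w hw => ?_
    rw [List.length_eq_zero_iff] at hw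
    rw [hw, h0 s t hs hst ht, wordCoord_one, if_pos rfl]
  regular n _ hn ℓ := by
    obtain ⟨C, hC⟩ := exists_dual_bound (tensorBasis b n)
      (P := fun q : ℝ × ℝ => 0 ≤ q.1 ∧ q.1 ≤ q.2 ∧ q.2 ≤ T) (f := fun q => Y q.1 q.2 n)
      (g := fun q => ω q.1 q.2 ^ ((n : ℝ) / p)) (fun K => by
        obtain ⟨C, hC⟩ := hb (List.ofFn K).reverse (by simpa using hn)
        refine ⟨C, fun q hq => ?_⟩
        rw [← wordCoord_reverse_ofFn, rpow_natCast_div _ (hω.nonneg _ _ hq.1 hq.2.1 hq.2.2)]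
        simpa using hC q.1 q.2 hq.1 hq.2.1 hq.2.2) ℓ
    exact ⟨C, fun s t hs hst ht => hC (s, t) ⟨hs, hst, ht⟩⟩

theorem exists_eq_append {i j : ℕ} (M : Fin (i + j) → κ) :
    ∃ (K : Fin i → κ) (L : Fin j → κ), M = Fin.append K L :=
  ⟨fun a => M (Fin.castAdd j a), fun a => M (Fin.natAdd i a), (Fin.append_castAdd_natAdd).symm⟩

/-- The ordered-shuffle functional of a controlled path is an almost rough path. -/
theorem isAlmostRoughPath_partialLift [Fintype ι] [Fintype κ] (hX : IsRoughPath T p ω X)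
    (hH : IsControlledPath T p ω X H) (hω : IsControl T ω) (hp : 1 ≤ p)
    (e : Module.Basis ι ℝ V) (b : Module.Basis κ ℝ U) :
    IsAlmostRoughPath T p ω (partialLift p X H) := by
  have hp0 : 0 < p := by linarith
  have hN1 : 1 ≤ ⌊p⌋₊ := Nat.one_le_floor_iff p |>.2 hp
  have hXr := hX.toIsRegularFunctional
  have hcast : (((⌊p⌋₊ : ℝ) + 1) / p) = ((⌊p⌋₊ + 1 : ℕ) : ℝ) / p := by push_cast; ring
  refine ⟨isRegularFunctional_of_wordCoord hω b
    (fun s t hs hst ht => wordCoord_nil_partialLift hXr e b hs hst ht)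
    (fun s t hs hst ht w hw => ?_)
    (fun w _ => continuousOn_wordCoord_partialLift hXr hH e b w)
    (fun w _ => partialLift_bound hXr hH hω hp0 e b w), ?_, ?_⟩
  · rw [wordCoord_partialLift hXr e b hs hst ht (by omega), if_neg (by omega)]
  · intro n hn ℓ
    obtain ⟨C, hC⟩ := exists_dual_bound (tensorBasis b n)
      (P := fun q : ℝ × ℝ × ℝ => 0 ≤ q.1 ∧ q.1 ≤ q.2.1 ∧ q.2.1 ≤ q.2.2 ∧ q.2.2 ≤ T)
      (f := fun q => (partialLift p X H q.1 q.2.1 * partialLift p X H q.2.1 q.2.2) n -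
        partialLift p X H q.1 q.2.2 n)
      (g := fun q => ω q.1 q.2.2 ^ (((⌊p⌋₊ : ℝ) + 1) / p)) (fun K => by
        obtain ⟨C, hC⟩ := partialLift_almost_multiplicative hX hH hω hp0 e b (List.ofFn K).reverse
        refine ⟨C, fun q hq => ?_⟩
        rw [map_sub, Finsupp.sub_apply, ← wordCoord_reverse_ofFn, ← wordCoord_reverse_ofFn, hcast,
          rpow_natCast_div _ (hω.nonneg _ _ hq.1 (hq.2.1.trans hq.2.2.1) hq.2.2.2)]
        exact hC q.1 q.2.1 q.2.2 hq.1 hq.2.1 hq.2.2.1 hq.2.2.2) ℓ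
    exact ⟨C, fun s u t hs hsu hut ht => hC (s, u, t) ⟨hs, hsu, hut, ht⟩⟩
  · intro i j _ ℓ
    obtain ⟨C, hC⟩ := exists_dual_bound (tensorBasis b (i + j))
      (P := fun q : ℝ × ℝ => 0 ≤ q.1 ∧ q.1 ≤ q.2 ∧ q.2 ≤ T)
      (f := fun q => geometricDefect (partialLift p X H) i j q.1 q.2)
      (g := fun q => ω q.1 q.2 ^ (((⌊p⌋₊ : ℝ) + 1) / p)) (fun M => by
        obtain ⟨K, L, rfl⟩ := exists_eq_append M
        obtain ⟨C, hC⟩ := partialLift_almost_geometric hX hH hω hp0 e b (List.ofFn K).reverse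
          (List.ofFn L).reverse
        refine ⟨C, fun q hq => ?_⟩
        rw [repr_geometricDefect, hcast, rpow_natCast_div _ (hω.nonneg _ _ hq.1 hq.2.1 hq.2.2)]
        exact hC q.1 q.2 hq.1 hq.2.1 hq.2.2) ℓ
    exact ⟨C, fun s t hs hst ht => hC (s, t) ⟨hs, hst, ht⟩⟩

end Assembly

/-! ### Products over partitions in a monoid with a pseudo-distance -/

section Sewing

variable {A : Type*} [Monoid A]

/-- A pseudo-distance `d` and a size function `ν` on a monoid, such that multiplication by `c`
expands distances by a factor at most `ν c`. -/
structure IsSubmulDist (d : A → A → ℝ) (ν : A → ℝ) : Prop where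
  nonneg : ∀ a b, 0 ≤ d a b
  symm : ∀ a b, d a b = d b a
  triangle : ∀ a b c, d a c ≤ d a b + d b c
  size_nonneg : ∀ a, 0 ≤ ν a
  size_le : ∀ a b, ν a ≤ ν b + d a b
  mul_left : ∀ a b c, d (c * a) (c * b) ≤ ν c * d a b
  mul_right : ∀ a b c, d (a * c) (b * c) ≤ d a b * ν c

/-- The product of `Y` over the consecutive pairs of a list of times. -/
def pathProd (Y : ℝ → ℝ → A) : List ℝ → A
  | [] => 1
  | [_] => 1
  | x :: y :: l => Y x y * pathProd Y (y :: l)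

/-- Cutting a partition at a point `x`. -/
theorem pathProd_append (Y : ℝ → ℝ → A) (l₁ : List ℝ) (x : ℝ) (l₂ : List ℝ) :
    pathProd Y (l₁ ++ x :: l₂) = pathProd Y (l₁ ++ [x]) * pathProd Y (x :: l₂) := by
  induction l₁ with
  | nil => simp [pathProd]
  | cons y l₁ ih =>
    rcases l₁ with _ | ⟨z, l₁⟩
    · simp [pathProd]
    · simp only [List.cons_append, pathProd] at ih ⊢
      rw [ih, mul_assoc]

theorem pathProd_map_range' (Y : ℝ → ℝ → A) (f : ℕ → ℝ) (i n : ℕ) :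
    pathProd Y ((List.range' i (n + 1)).map f) =
      ((List.range' i n).map fun k => Y (f k) (f (k + 1))).prod := by
  induction n generalizing i with
  | zero => simp [pathProd]
  | succ n ih =>
    have h := ih (i + 1)
    rw [List.range'_succ, List.map_cons] at h
    rw [List.range'_succ, List.range'_succ, List.map_cons, List.map_cons, pathProd, h,
      List.range'_succ, List.map_cons, List.prod_cons]

/-- A list contains two consecutive elements at which `P` changes to `Q`. -/
theorem exists_consecutive {P Q : ℝ → Prop} (l : List ℝ) (x t : ℝ) (hx : P x) (hl : l ≠ [])
    (ht : (x :: l).getLast? = some t) (hQ : Q t) (hPQ : ∀ y ∈ l, P y ∨ Q y) :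
    ∃ l₁ y z l₂, x :: l = l₁ ++ y :: z :: l₂ ∧ P y ∧ Q z := by
  induction l generalizing x with
  | nil => exact absurd rfl hl
  | cons y l ih =>
    rcases hPQ y (by simp) with hy | hy
    · rcases eq_or_ne l [] with rfl | hl'
      · obtain rfl : y = t := by simpa using ht
        exact ⟨[], x, y, [], rfl, hx, hQ⟩
      · obtain ⟨l₁, a, c, l₂, h, h1, h2⟩ := ih y hy hl' (by rwa [List.getLast?_cons_cons] at ht)
          fun z hz => hPQ z (by simp [hz])
        exact ⟨x :: l₁, a, c, l₂, by simp [h], h1, h2⟩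
    · exact ⟨[], x, y, l, rfl, hx, hy⟩

/-- A list of times `s ≤ ⋯ ≤ t` in `[0, T]`. -/
structure IsTimes (T s t : ℝ) (l : List ℝ) : Prop where
  pairwise : l.Pairwise (· ≤ ·)
  mem : ∀ x ∈ l, 0 ≤ x ∧ x ≤ T
  head : l.head? = some s
  last : l.getLast? = some t

namespace IsTimes

variable {T s t x y : ℝ} {l l₁ l₂ : List ℝ}

theorem le_of_append (h : IsTimes T s t (l₁ ++ y :: l₂)) : 0 ≤ s ∧ s ≤ y ∧ y ≤ t ∧ t ≤ T := by
  have hs : s ∈ l₁ ++ y :: l₂ := List.mem_of_mem_head? h.head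
  have ht : t ∈ l₁ ++ y :: l₂ := List.mem_of_mem_getLast? h.last
  refine ⟨(h.mem s hs).1, ?_, ?_, (h.mem t ht).2⟩
  · rcases l₁ with _ | ⟨x, l₁⟩
    · obtain rfl : y = s := by simpa using h.head
      rfl
    · obtain rfl : x = s := by simpa using h.head
      exact (List.pairwise_cons.1 h.pairwise).1 y (by simp)
  · have h1 : (y :: l₂).getLast? = some t := by
      have := h.last
      rwa [List.getLast?_append_of_ne_nil _ (by simp)] at this
    have h2 := (List.pairwise_append.1 h.pairwise).2.1
    rcases List.mem_cons.1 (List.mem_of_mem_getLast? h1) with h3 | h3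
    · exact h3.ge
    · exact (List.pairwise_cons.1 h2).1 t h3

theorem left (h : IsTimes T s t (l₁ ++ y :: l₂)) : IsTimes T s y (l₁ ++ [y]) where
  pairwise := h.pairwise.sublist (by simp)
  mem x hx := h.mem x (by simp at hx ⊢; tauto)
  head := by rw [← h.head]; cases l₁ <;> rfl
  last := by simp

theorem right (h : IsTimes T s t (l₁ ++ y :: l₂)) : IsTimes T y t (y :: l₂) where
  pairwise := (List.pairwise_append.1 h.pairwise).2.1
  mem x hx := h.mem x (by simp at hx ⊢; tauto)
  head := rfl
  last := by rw [← h.last, List.getLast?_append_of_ne_nil _ (by simp)]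

theorem le (h : IsTimes T s t l) : 0 ≤ s ∧ s ≤ t ∧ t ≤ T := by
  rcases l with _ | ⟨x, l⟩
  · exact absurd h.head (by simp)
  · obtain ⟨h1, h2, h3, h4⟩ := h.le_of_append (l₁ := [])
    exact ⟨h1, h2.trans h3, h4⟩

end IsTimes

variable {T : ℝ} {ω : ℝ → ℝ → ℝ} {d : A → A → ℝ} {ν : A → ℝ}

/-- The maximal inequality of sewing: all products of an almost multiplicative functional over
partitions of `[s, t]` are close to its value on `[s, t]`. The proof cuts out an interval of the
partition in such a way that the control of each of the two remaining parts is at most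
`ω(s, t) / 2`. -/
theorem dist_pathProd_le (hd : IsSubmulDist d ν) (hω : IsControl T ω) {Y : ℝ → ℝ → A}
    {θ ε C K : ℝ} (hθ : 0 < θ) (hε : 0 ≤ ε) (hε1 : ε ≤ 1) (hC : 0 ≤ C) (hK0 : 0 ≤ K)
    (hY : ∀ s t, 0 ≤ s → s ≤ t → t ≤ T → ν (Y s t) ≤ 1 + ε)
    (hone : ∀ t, 0 ≤ t → t ≤ T → d 1 (Y t t) = 0)
    (hmul : ∀ s u t, 0 ≤ s → s ≤ u → u ≤ t → t ≤ T →
      d (Y s u * Y u t) (Y s t) ≤ C * ω s t ^ θ)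
    (hK : K * (2 * (1 / 2) ^ θ * (1 + 2 * ε) ^ 2) + 3 * C ≤ K) (hW : K * ω 0 T ^ θ ≤ ε)
    (l : List ℝ) : ∀ s t, IsTimes T s t l → d (pathProd Y l) (Y s t) ≤ K * ω s t ^ θ := by
  induction hn : l.length using Nat.strong_induction_on generalizing l with
  | _ n ih =>
  subst hn
  intro s t hl
  obtain ⟨hs, hst, ht⟩ := hl.le
  have hω0 := hω.nonneg s t hs hst ht
  rcases l with _ | ⟨x, l⟩
  · exact absurd hl.head (by simp)
  obtain rfl : x = s := by simpa using hl.head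
  rcases eq_or_ne l [] with rfl | hne
  · obtain rfl : x = t := by simpa using hl.last
    rw [pathProd, hone x hs ht]
    positivity
  -- the last point `y` before the control of `[x, y]` exceeds half of the total control
  obtain ⟨l₁, y, z, l₂, he, hy, hz⟩ := exists_consecutive (P := fun y => ω x y ≤ ω x t / 2)
    (Q := fun z => ω z t ≤ ω x t / 2) l x t (by rw [hω.diag x hs (hst.trans ht)]; positivity) hne
    hl.last (by rw [hω.diag t (hs.trans hst) ht]; positivity) (fun y hy => by
      obtain ⟨l₁, l₂, rfl⟩ := List.append_of_mem hy
      obtain ⟨-, h2, h3, -⟩ := IsTimes.le_of_append (l₁ := x :: l₁) hl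
      rcases le_or_gt (ω x y) (ω x t / 2) with h | h
      · exact Or.inl h
      · exact Or.inr (by linarith [hω.superadditive x y t hs h2 h3 ht]))
  have hlen : (x :: l).length = l₁.length + l₂.length + 2 := by
    rw [he]; simp; ring
  rw [he] at hl ⊢
  have hly := hl.left
  have hry := hl.right
  have hlz : IsTimes T z t (z :: l₂) := IsTimes.right (l₁ := [y]) hry
  have dl := ih _ (by rw [hlen]; simp) _ rfl _ _ hly
  have dr := ih _ (by rw [hlen]; simp) _ rfl _ _ hlz
  obtain ⟨-, hxy, hyt, -⟩ := hl.le_of_append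
  obtain ⟨hy0, hyz, hzt, -⟩ := IsTimes.le_of_append (l₁ := [y]) hry
  have hz0 := hy0.trans hyz
  set w := ω x t ^ θ with hw
  have hw0 : 0 ≤ w := Real.rpow_nonneg hω0 _
  set q : ℝ := (1 / 2) ^ θ with hq
  have half : ∀ a, 0 ≤ a → a ≤ ω x t / 2 → a ^ θ ≤ q * w := fun a ha h => by
    rw [hq, hw, ← Real.mul_rpow (by norm_num) hω0]
    exact Real.rpow_le_rpow ha (by linarith) hθ.le
  have dl' : d (pathProd Y (l₁ ++ [y])) (Y x y) ≤ K * (q * w) :=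
    dl.trans (mul_le_mul_of_nonneg_left (half _ (hω.nonneg x y hs hxy (hyt.trans ht)) hy) hK0)
  have dr' : d (pathProd Y (z :: l₂)) (Y z t) ≤ K * (q * w) :=
    dr.trans (mul_le_mul_of_nonneg_left (half _ (hω.nonneg z t hz0 hzt ht) hz) hK0)
  have νr : ν (pathProd Y (z :: l₂)) ≤ 1 + 2 * ε := by
    have h1 := hd.size_le (pathProd Y (z :: l₂)) (Y z t)
    have h2 : K * ω z t ^ θ ≤ K * ω 0 T ^ θ := mul_le_mul_of_nonneg_left
      (Real.rpow_le_rpow (hω.nonneg z t hz0 hzt ht) (hω.le_total hz0 hzt ht) hθ.le) hK0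
    linarith [hY z t hz0 hzt ht]
  have νxy := hY x y hs hxy (hyt.trans ht)
  have νyz := hY y z hy0 hyz (hzt.trans ht)
  have νzt := hY z t hz0 hzt ht
  have c1 : d (Y x y * Y y z) (Y x z) ≤ C * w :=
    (hmul x y z hs hxy hyz (hzt.trans ht)).trans (mul_le_mul_of_nonneg_left
      (Real.rpow_le_rpow (hω.nonneg x z hs (hxy.trans hyz) (hzt.trans ht))
        (hω.left_le hs (hxy.trans hyz) hzt ht) hθ.le) hC)
  have c2 := hmul x z t hs (hxy.trans hyz) hzt ht
  rw [pathProd_append, pathProd]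
  set Pl := pathProd Y (l₁ ++ [y])
  set Pr := pathProd Y (z :: l₂)
  have hq0 : 0 ≤ q := by positivity
  have e1 : d (Pl * (Y y z * Pr)) (Y x y * (Y y z * Pr)) ≤
      K * (q * w) * (1 + 2 * ε) ^ 2 := by
    rw [← mul_assoc, ← mul_assoc]
    refine (hd.mul_right _ _ _).trans ?_
    refine (mul_le_mul_of_nonneg_right (hd.mul_right _ _ _) (hd.size_nonneg _)).trans ?_
    rw [mul_assoc]
    refine mul_le_mul dl' ?_ (mul_nonneg (hd.size_nonneg _) (hd.size_nonneg _)) (by positivity)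
    rw [sq]
    exact mul_le_mul (by linarith) νr (hd.size_nonneg _) (by linarith)
  have e2 : d (Y x y * (Y y z * Pr)) (Y x y * (Y y z * Y z t)) ≤
      K * (q * w) * (1 + 2 * ε) ^ 2 := by
    refine (hd.mul_left _ _ _).trans ?_
    refine (mul_le_mul_of_nonneg_left (hd.mul_left _ _ _) (hd.size_nonneg _)).trans ?_
    rw [← mul_assoc, mul_comm]
    refine mul_le_mul dr' ?_ (mul_nonneg (hd.size_nonneg _) (hd.size_nonneg _)) (by positivity)
    rw [sq]
    exact mul_le_mul (by linarith) (by linarith) (hd.size_nonneg _) (by linarith)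
  have e3 : d (Y x y * (Y y z * Y z t)) (Y x z * Y z t) ≤ 2 * (C * w) := by
    rw [← mul_assoc]
    refine (hd.mul_right _ _ _).trans ?_
    rw [mul_comm]
    exact mul_le_mul (by linarith) c1 (hd.nonneg _ _) (by norm_num)
  have t1 := hd.triangle (Pl * (Y y z * Pr)) (Y x y * (Y y z * Pr)) (Y x t)
  have t2 := hd.triangle (Y x y * (Y y z * Pr)) (Y x y * (Y y z * Y z t)) (Y x t)
  have t3 := hd.triangle (Y x y * (Y y z * Y z t)) (Y x z * Y z t) (Y x t)
  have := mul_le_mul_of_nonneg_right hK hw0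
  linarith

/-- A multiplicative functional `L` close to `Y` is close to the products of `Y` over fine
partitions. The factors of the product are replaced by values of `L` one after the other, from
right to left; `B` bounds the factors that are left untouched. -/
theorem dist_pathProd_mul_le (hd : IsSubmulDist d ν) (hω : IsControl T ω) {Y L : ℝ → ℝ → A}
    {B c η : ℝ} (hB : 0 ≤ B) (hc : 0 ≤ c)
    (hYB : ∀ s t l, IsTimes T s t l → ν (pathProd Y l) ≤ B)
    (hLB : ∀ s t, 0 ≤ s → s ≤ t → t ≤ T → ν (L s t) ≤ B)
    (hone : ∀ t, 0 ≤ t → t ≤ T → d 1 (L t t) = 0)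
    (hmul : ∀ s u t, 0 ≤ s → s ≤ u → u ≤ t → t ≤ T → d (L s u * L u t) (L s t) = 0)
    (hYL : ∀ s t, 0 ≤ s → s ≤ t → t ≤ T → t - s < η → d (Y s t) (L s t) ≤ c * ω s t)
    (l : List ℝ) : ∀ (l₀ : List ℝ) (s x t : ℝ), IsTimes T s t (l₀ ++ x :: l) →
      (x :: l).IsChain (fun y z => z - y < η) →
      d (pathProd Y (l₀ ++ x :: l)) (pathProd Y (l₀ ++ [x]) * L x t) ≤
        B * B * c * ω x t := by
  induction l with
  | nil =>
    intro l₀ s x t h _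
    obtain rfl : x = t := by simpa using h.last
    obtain ⟨hs, hsx, -, ht⟩ := h.le_of_append
    have h1 := hd.mul_left 1 (L x x) (pathProd Y (l₀ ++ [x]))
    rw [hone x (hs.trans hsx) ht, mul_one, mul_zero] at h1
    rw [hω.diag x (hs.trans hsx) ht, mul_zero]
    exact h1
  | cons y l ih =>
    intro l₀ s x t h hch
    rw [List.isChain_cons_cons] at hch
    obtain ⟨hs, hsx, hxt, ht⟩ := h.le_of_append
    obtain ⟨-, hxy, hyt, -⟩ := IsTimes.le_of_append (l₁ := [x]) h.right
    have hx0 := hs.trans hsx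
    have h1 := ih (l₀ ++ [x]) s y t (by simpa using h) hch.2
    have e : pathProd Y (l₀ ++ [x] ++ [y]) = pathProd Y (l₀ ++ [x]) * Y x y := by
      rw [List.append_assoc, List.singleton_append, pathProd_append]
      simp [pathProd]
    rw [e] at h1
    simp only [List.append_assoc, List.singleton_append] at h1
    have h2 : d (Y x y * L y t) (L x t) ≤ c * ω x y * B := by
      have h3 := hd.triangle (Y x y * L y t) (L x y * L y t) (L x t)
      rw [hmul x y t hx0 hxy hyt ht, add_zero] at h3
      refine h3.trans ((hd.mul_right _ _ _).trans ?_)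
      exact mul_le_mul (hYL x y hx0 hxy (hyt.trans ht) hch.1) (hLB y t (hx0.trans hxy) hyt ht) (hd.size_nonneg _)
        (mul_nonneg hc (hω.nonneg x y hx0 hxy (hyt.trans ht)))
    have h4 : d (pathProd Y (l₀ ++ [x]) * Y x y * L y t) (pathProd Y (l₀ ++ [x]) * L x t) ≤
        B * (c * ω x y * B) := by
      rw [mul_assoc]
      exact (hd.mul_left _ _ _).trans (mul_le_mul (hYB s x _ h.left) h2 (hd.nonneg _ _) hB)
    have h5 := hd.triangle (pathProd Y (l₀ ++ x :: y :: l))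
      (pathProd Y (l₀ ++ [x]) * Y x y * L y t) (pathProd Y (l₀ ++ [x]) * L x t)
    have h6 := mul_le_mul_of_nonneg_left (hω.superadditive x y t hx0 hxy hyt ht)
      (show 0 ≤ B * B * c by positivity)
    linarith

/-- The control of short intervals is uniformly small. -/
theorem IsControl.exists_small (hω : IsControl T ω) {δ : ℝ} (hδ : 0 < δ) :
    ∃ η > 0, ∀ s t, 0 ≤ s → s ≤ t → t ≤ T → t - s < η → ω s t ≤ δ := by
  have hcl : IsClosed (simplex T) :=
    (isClosed_le continuous_const continuous_fst).inter
      ((isClosed_le continuous_fst continuous_snd).inter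
        (isClosed_le continuous_snd continuous_const))
  have hcpt : IsCompact (simplex T) := by
    refine (isCompact_Icc (a := ((0 : ℝ), (0 : ℝ))) (b := (T, T))).of_isClosed_subset hcl ?_
    rintro ⟨a, c⟩ ⟨h1, h2, h3⟩
    exact ⟨⟨h1, h1.trans h2⟩, ⟨h2.trans h3, h3⟩⟩
  obtain ⟨η, hη, h⟩ := Metric.uniformContinuousOn_iff.1
    (hcpt.uniformContinuousOn_of_continuous hω.continuousOn) δ hδ
  refine ⟨η, hη, fun s t hs hst ht hlt => ?_⟩
  have h1 := h (s, t) ⟨hs, hst, ht⟩ (s, s) ⟨hs, le_rfl, hst.trans ht⟩ (by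
    rw [Prod.dist_eq, dist_self, Real.dist_eq, abs_of_nonneg (by linarith)]
    simpa using ⟨hη, hlt⟩)
  rw [hω.diag s hs (hst.trans ht), Real.dist_eq, sub_zero] at h1
  exact (le_abs_self _).trans h1.le

/-- `ω^θ` with `θ > 1` is `o(ω)` on short intervals. -/
theorem IsControl.exists_rpow_le (hω : IsControl T ω) {θ c : ℝ} (hθ : 1 < θ) (hc : 0 < c) :
    ∃ η > 0, ∀ s t, 0 ≤ s → s ≤ t → t ≤ T → t - s < η → ω s t ^ θ ≤ c * ω s t := by
  obtain ⟨η, hη, h⟩ := hω.exists_small (Real.rpow_pos_of_pos hc (1 / (θ - 1)))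
  refine ⟨η, hη, fun s t hs hst ht hlt => ?_⟩
  have h0 := hω.nonneg s t hs hst ht
  have h1 := Real.rpow_le_rpow h0 (h s t hs hst ht hlt) (show 0 ≤ θ - 1 by linarith)
  rw [← Real.rpow_mul hc.le, one_div_mul_cancel (by linarith), Real.rpow_one] at h1
  have h2 : ω s t ^ θ = ω s t ^ (θ - 1) * ω s t := by
    rw [← Real.rpow_add_one' h0 (by linarith), sub_add_cancel]
  rw [h2]
  exact mul_le_mul_of_nonneg_right h1 h0

/-- An additive functional of order `O(ω^θ)`, with `θ > 1`, vanishes. -/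
theorem eq_zero_of_additive_of_le (hω : IsControl T ω) {θ C : ℝ} (hθ : 1 < θ) {f : ℝ → ℝ → ℝ}
    (hadd : ∀ s u t, 0 ≤ s → s ≤ u → u ≤ t → t ≤ T → f s t = f s u + f u t)
    (hf : ∀ s t, 0 ≤ s → s ≤ t → t ≤ T → |f s t| ≤ C * ω s t ^ θ)
    {s t : ℝ} (hs : 0 ≤ s) (hst : s ≤ t) (ht : t ≤ T) : f s t = 0 := by
  have key : ∀ c > 0, |f s t| ≤ c * ω s t := by
    intro c hc
    have hC : 0 < |C| + 1 := by positivity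
    obtain ⟨η, hη, h⟩ := hω.exists_rpow_le hθ (div_pos hc hC)
    have small : ∀ s t, 0 ≤ s → s ≤ t → t ≤ T → t - s < η → |f s t| ≤ c * ω s t := by
      intro s t hs hst ht hlt
      have h1 : C * ω s t ^ θ ≤ (|C| + 1) * ω s t ^ θ := mul_le_mul_of_nonneg_right
        (by linarith [le_abs_self C]) (Real.rpow_nonneg (hω.nonneg s t hs hst ht) _)
      have h2 := mul_le_mul_of_nonneg_left (h s t hs hst ht hlt) hC.le
      rw [← mul_assoc, mul_div_cancel₀ _ hC.ne'] at h2
      exact (hf s t hs hst ht).trans (h1.trans h2)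
    have all : ∀ n : ℕ, ∀ s t, 0 ≤ s → s ≤ t → t ≤ T → t - s ≤ n * (η / 2) →
        |f s t| ≤ c * ω s t := by
      intro n
      induction n with
      | zero =>
        intro s t hs hst ht h
        exact small s t hs hst ht (by simp at h; linarith)
      | succ n ih =>
        intro s t hs hst ht h
        push_cast at h
        rcases le_or_gt (t - s) (η / 2) with h' | h'
        · exact small s t hs hst ht (by linarith)
        · have h1 := small s (s + η / 2) hs (by linarith) (by linarith) (by linarith)
          have h2 := ih (s + η / 2) t (by linarith) (by linarith) ht (by linarith)
          have h3 := hω.superadditive s (s + η / 2) t hs (by linarith) (by linarith) ht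
          rw [hadd s (s + η / 2) t hs (by linarith) (by linarith) ht]
          have h4 := mul_le_mul_of_nonneg_left h3 hc.le
          exact (abs_add_le _ _).trans (by linarith)
    obtain ⟨n, hn⟩ := exists_nat_ge ((t - s) / (η / 2))
    exact all n s t hs hst ht ((div_le_iff₀ (by positivity)).1 hn)
  have h0 := hω.nonneg s t hs hst ht
  by_contra hne
  have hpos : 0 < |f s t| := abs_pos.2 hne
  have h1 := key (|f s t| / (2 * (ω s t + 1))) (by positivity)
  rw [div_mul_eq_mul_div, le_div_iff₀ (by positivity)] at h1
  nlinarith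

end Sewing

/-! ### Weighted norms on coordinates -/

section WeightedNorm

variable {α : Type*}

theorem deconcSum_mono {w : List α} {q q' : List α → List α → ℝ}
    (h : ∀ v u, v ++ u = w → q v u ≤ q' v u) : deconcSum w q ≤ deconcSum w q' := by
  induction w generalizing q q' with
  | nil => exact h _ _ rfl
  | cons x w ih => exact add_le_add (h _ _ rfl) (ih fun v u hvu => h _ _ (by simp [hvu]))

theorem abs_deconcSum_le (w : List α) (q : List α → List α → ℝ) :
    |deconcSum w q| ≤ deconcSum w fun v u => |q v u| := by
  induction w generalizing q with
  | nil => exact le_rfl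
  | cons x w ih => exact (abs_add_le _ _).trans (add_le_add le_rfl (ih _))

theorem abs_shuffleSum_le {K L : List α} {y : List α → ℝ} {c : ℝ}
    (h : ∀ M, M.length = K.length + L.length → |y M| ≤ c) :
    |shuffleSum K L y| ≤ 2 ^ (K.length + L.length) * c := by
  have hc : ∀ {M}, |y M| ≤ c → 0 ≤ c := fun h => (abs_nonneg _).trans h
  induction hn : K.length + L.length generalizing K L y with
  | zero =>
    obtain ⟨hK, hL⟩ := Nat.add_eq_zero_iff.1 hn
    rw [List.length_eq_zero_iff] at hK hL
    subst hK hL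
    simpa [shuffleSum_nil_left] using h [] rfl
  | succ n ih =>
    have one_le : (1 : ℝ) ≤ 2 ^ (n + 1) := one_le_pow₀ (by norm_num)
    rcases K with _ | ⟨k, K⟩
    · have h1 := h L (by simp)
      rw [shuffleSum_nil_left]
      nlinarith [hc h1]
    rcases L with _ | ⟨l, L⟩
    · have h1 := h (k :: K) (by simp)
      rw [shuffleSum_nil_right]
      nlinarith [hc h1]
    simp only [List.length_cons] at hn h ih
    have h1 := ih (K := K) (L := l :: L) (y := fun M => y (k :: M))
      (fun M hM => h _ (by simp at hM ⊢; omega)) (fun h => (abs_nonneg _).trans h)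
      (by simp; omega)
    have h2 := ih (K := k :: K) (L := L) (y := fun M => y (l :: M))
      (fun M hM => h _ (by simp at hM ⊢; omega)) (fun h => (abs_nonneg _).trans h)
      (by simp; omega)
    rw [shuffleSum_cons_cons, pow_succ]
    exact (abs_add_le _ _).trans (by linarith)

theorem tendsto_deconcSum {β : Type*} {F : Filter β} (w : List α)
    {q : List α → List α → β → ℝ} {r : List α → List α → ℝ}
    (hq : ∀ v u, v ++ u = w → Filter.Tendsto (q v u) F (nhds (r v u))) :
    Filter.Tendsto (fun t => deconcSum w fun v u => q v u t) F (nhds (deconcSum w r)) := by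
  induction w generalizing q r with
  | nil => exact hq _ _ rfl
  | cons x w ih => exact (hq _ _ rfl).add (ih fun v u hvu => hq _ _ (by simp [hvu]))

variable {κ U : Type*} [Fintype κ] [AddCommGroup U] [Module ℝ U]

/-- The weighted `ℓ¹` norm on coordinates indexed by words of length at most `N`, with weight
`lam ^ n` on the words of length `n`. -/
def weightedNorm (κ : Type*) [Fintype κ] (N : ℕ) (lam : ℝ) (f : List κ → ℝ) : ℝ :=
  ∑ w ∈ wordsLE κ N, lam ^ w.length * |f w|

theorem weightedNorm_nonneg (N : ℕ) {lam : ℝ} (hl : 0 ≤ lam) (f : List κ → ℝ) :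
    0 ≤ weightedNorm κ N lam f :=
  Finset.sum_nonneg fun _ _ => by positivity

theorem weightedNorm_eq_zero {N : ℕ} {lam : ℝ} {f : List κ → ℝ}
    (h : ∀ w, w.length ≤ N → f w = 0) : weightedNorm κ N lam f = 0 :=
  Finset.sum_eq_zero fun w hw => by rw [h w (mem_wordsLE.1 hw), abs_zero, mul_zero]

theorem weightedNorm_add_le (N : ℕ) {lam : ℝ} (hl : 0 ≤ lam) (f g : List κ → ℝ) :
    weightedNorm κ N lam (fun w => f w + g w) ≤ weightedNorm κ N lam f + weightedNorm κ N lam g := by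
  rw [weightedNorm, weightedNorm, weightedNorm, ← Finset.sum_add_distrib]
  refine Finset.sum_le_sum fun w _ => ?_
  rw [← mul_add]
  exact mul_le_mul_of_nonneg_left (abs_add_le _ _) (by positivity)

/-- The weighted norm is submultiplicative, because deconcatenation preserves total length. -/
theorem weightedNorm_deconcSum_le (N : ℕ) {lam : ℝ} (hl : 0 ≤ lam) (f g : List κ → ℝ) :
    weightedNorm κ N lam (fun w => deconcSum w fun v u => f u * g v) ≤
      weightedNorm κ N lam f * weightedNorm κ N lam g := by
  have h1 : ∀ w : List κ, lam ^ w.length * |deconcSum w fun v u => f u * g v| ≤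
      deconcSum w fun v u => (lam ^ u.length * |f u|) * (lam ^ v.length * |g v|) := by
    intro w
    refine (mul_le_mul_of_nonneg_left (abs_deconcSum_le _ _) (by positivity)).trans ?_
    rw [mul_comm, deconcSum_mul_right]
    refine deconcSum_mono fun v u hvu => le_of_eq ?_
    rw [← hvu, List.length_append, pow_add, abs_mul]
    ring
  refine (Finset.sum_le_sum fun w _ => h1 w).trans ?_
  rw [sum_deconcSum, weightedNorm, weightedNorm, Finset.sum_mul_sum]
  refine Finset.sum_le_sum fun u _ => Finset.sum_le_sum fun v _ => ?_
  split_ifs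
  · exact le_rfl
  · positivity

theorem le_weightedNorm {N : ℕ} {lam : ℝ} (hl : 0 < lam) (hl1 : lam ≤ 1) (f : List κ → ℝ)
    {w : List κ} (hw : w.length ≤ N) : |f w| ≤ (lam ^ N)⁻¹ * weightedNorm κ N lam f := by
  have h1 : lam ^ w.length * |f w| ≤ weightedNorm κ N lam f :=
    Finset.single_le_sum (f := fun w => lam ^ w.length * |f w|)
      (fun v _ => by positivity) (mem_wordsLE.2 hw)
  have h2 : lam ^ N * |f w| ≤ lam ^ w.length * |f w| :=
    mul_le_mul_of_nonneg_right (pow_le_pow_of_le_one hl.le hl1 hw) (abs_nonneg _)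
  rw [inv_mul_eq_div, le_div_iff₀ (by positivity), mul_comm]
  exact h2.trans h1

/-- If the value at the empty word is at most `a`, then the weighted norm exceeds `a` by
`O(lam)`. -/
theorem weightedNorm_le {N : ℕ} {lam : ℝ} (hl : 0 ≤ lam) (hl1 : lam ≤ 1) {f : List κ → ℝ}
    {a c : ℝ} (hc : 0 ≤ c) (h0 : |f []| ≤ a) (h : ∀ w, w.length ≤ N → |f w| ≤ c) :
    weightedNorm κ N lam f ≤ a + lam * ((wordsLE κ N).card * c) := by
  classical
  have h1 : ∀ w ∈ wordsLE κ N, lam ^ w.length * |f w| ≤ (if w = [] then a else 0) + lam * c := by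
    intro w hw
    rcases w with _ | ⟨x, w⟩
    · simpa using h0.trans (le_add_of_nonneg_right (mul_nonneg hl hc))
    · rw [if_neg (by simp), zero_add]
      refine mul_le_mul ?_ (h _ (mem_wordsLE.1 hw)) (abs_nonneg _) hl
      exact pow_le_of_le_one hl hl1 (by simp)
  refine (Finset.sum_le_sum h1).trans (le_of_eq ?_)
  rw [Finset.sum_add_distrib, Finset.sum_ite_eq' (wordsLE κ N) [] fun _ => a,
    if_pos (mem_wordsLE.2 (by simp)), Finset.sum_const, nsmul_eq_mul]
  ring

/-- The weighted norms of coordinates make the tensor algebra a monoid with a pseudo-distance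
for which multiplication is Lipschitz. -/
theorem isSubmulDist_weightedNorm (b : Module.Basis κ ℝ U) (N : ℕ) {lam : ℝ} (hl : 0 ≤ lam) :
    IsSubmulDist (fun a c : TAlg U => weightedNorm κ N lam fun w => wordCoord b w a - wordCoord b w c)
      (fun a => weightedNorm κ N lam fun w => wordCoord b w a) where
  nonneg _ _ := weightedNorm_nonneg N hl _
  symm a c := by simp only [weightedNorm, abs_sub_comm]
  triangle a c e := by
    refine le_trans (le_of_eq ?_) (weightedNorm_add_le N hl _ _)
    simp only [sub_add_sub_cancel]
  size_nonneg _ := weightedNorm_nonneg N hl _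
  size_le a c := by
    refine le_trans (le_of_eq ?_) (weightedNorm_add_le N hl _ _)
    simp only [add_sub_cancel]
  mul_left a c e := by
    refine le_trans (le_of_eq ?_) (weightedNorm_deconcSum_le N hl _ _)
    congr 1
    funext w
    rw [wordCoord_mul, wordCoord_mul, sub_eq_add_neg, ← neg_one_mul, mul_comm (-1),
      deconcSum_mul_right, ← deconcSum_add]
    exact deconcSum_congr fun v u _ => by ring
  mul_right a c e := by
    refine le_trans (le_of_eq ?_) (weightedNorm_deconcSum_le N hl _ _)
    congr 1
    funext w
    rw [wordCoord_mul, wordCoord_mul, sub_eq_add_neg, ← neg_one_mul, mul_comm (-1),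
      deconcSum_mul_right, ← deconcSum_add]
    exact deconcSum_congr fun v u _ => by ring

end WeightedNorm

/-! ### The sewing lemma in the truncated tensor algebra -/

section SewingLimit

/-- The list consisting of `s` and of the points of `D` in `(s, t]`, in increasing order. -/
def gridPoints (D : Finset ℝ) (s t : ℝ) : List ℝ :=
  s :: (D.filter fun x => s < x ∧ x ≤ t).sort

theorem isTimes_gridPoints {T s t : ℝ} (hs : 0 ≤ s) (hst : s ≤ t) (ht : t ≤ T) {D : Finset ℝ}
    (hD : t ∈ D) : IsTimes T s t (gridPoints D s t) := by
  have hmem : ∀ x ∈ (D.filter fun x => s < x ∧ x ≤ t).sort, s < x ∧ x ≤ t := fun x hx => by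
    simpa using ((Finset.mem_sort _).1 hx |> Finset.mem_filter.1).2
  have hpw : (gridPoints D s t).Pairwise (· ≤ ·) :=
    List.pairwise_cons.2 ⟨fun x hx => (hmem x hx).1.le, Finset.pairwise_sort _ _⟩
  have hle : ∀ x ∈ gridPoints D s t, s ≤ x ∧ x ≤ t := by
    intro x hx
    rcases List.mem_cons.1 hx with rfl | hx
    · exact ⟨le_rfl, hst⟩
    · exact ⟨(hmem x hx).1.le, (hmem x hx).2⟩
  refine ⟨hpw, fun x hx => ⟨hs.trans (hle x hx).1, (hle x hx).2.trans ht⟩, rfl, ?_⟩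
  have hne : gridPoints D s t ≠ [] := by simp [gridPoints]
  have htm : t ∈ gridPoints D s t := by
    rcases hst.eq_or_lt with rfl | h
    · simp [gridPoints]
    · exact List.mem_cons_of_mem _ ((Finset.mem_sort _).2 (by simp [hD, h]))
  obtain ⟨l₁, l₂, h⟩ := List.append_of_mem htm
  rw [List.getLast?_eq_some_getLast hne, Option.some_inj]
  refine le_antisymm (hle _ (List.getLast_mem hne)).2 ?_
  have h1 : (gridPoints D s t).getLast hne ∈ t :: l₂ := by
    simp only [h]
    rw [List.getLast_append_of_ne_nil _ (by simp)]
    exact List.getLast_mem _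
  rw [h] at hpw
  rcases List.mem_cons.1 h1 with h2 | h2
  · exact h2.ge
  · exact (List.pairwise_cons.1 (List.pairwise_append.1 hpw).2.1).1 _ h2

/-- Products over subdivision points are multiplicative as soon as the intermediate time is one of
the points. -/
theorem pathProd_gridPoints {A : Type*} [Monoid A] (Y : ℝ → ℝ → A) {T s u t : ℝ} (hs : 0 ≤ s)
    (hsu : s ≤ u) (hut : u ≤ t) (hu : u ≤ T) {D : Finset ℝ} (hD : u ∈ D) :
    pathProd Y (gridPoints D s t) =
      pathProd Y (gridPoints D s u) * pathProd Y (gridPoints D u t) := by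
  have h1 : (D.filter fun x => s < x ∧ x ≤ t).sort =
      (D.filter fun x => s < x ∧ x ≤ u).sort ++ (D.filter fun x => u < x ∧ x ≤ t).sort := by
    refine List.Perm.eq_of_pairwise' (r := (· ≤ ·)) (Finset.pairwise_sort _ _)
      (List.pairwise_append.2 ⟨Finset.pairwise_sort _ _, Finset.pairwise_sort _ _,
        fun x hx y hy => ?_⟩) ?_
    · simp only [Finset.mem_sort, Finset.mem_filter] at hx hy
      linarith
    · refine (List.perm_ext_iff_of_nodup (Finset.sort_nodup _ _) ?_).2 fun x => ?_
      · refine List.nodup_append'.2 ⟨Finset.sort_nodup _ _, Finset.sort_nodup _ _, ?_⟩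
        intro x hx hy
        simp only [Finset.mem_sort, Finset.mem_filter] at hx hy
        linarith
      · simp only [List.mem_append, Finset.mem_sort, Finset.mem_filter]
        constructor
        · rintro ⟨h1, h2, h3⟩
          rcases le_or_gt x u with h | h
          · exact Or.inl ⟨h1, h2, h⟩
          · exact Or.inr ⟨h1, h, h3⟩
        · rintro (⟨h1, h2, h3⟩ | ⟨h1, h2, h3⟩)
          · exact ⟨h1, h2, h3.trans hut⟩
          · exact ⟨h1, hsu.trans_lt h2, h3⟩
  have h2 := (isTimes_gridPoints hs hsu hu hD).last
  obtain ⟨l, hl⟩ : ∃ l, gridPoints D s u = l ++ [u] := by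
    obtain ⟨l, hl⟩ := List.getLast?_eq_some_iff.1 h2
    exact ⟨l, hl⟩
  have h3 : gridPoints D s t = l ++ u :: (D.filter fun x => u < x ∧ x ≤ t).sort := by
    rw [gridPoints, h1, ← List.cons_append, ← gridPoints, hl, List.append_assoc,
      List.singleton_append]
  rw [h3, pathProd_append, hl, gridPoints]

/-- Finitely many estimates have a common constant. -/
theorem exists_uniform_bound {α β : Type*} {S : Finset β} {P : α → Prop} {f : β → α → ℝ}
    {g : α → ℝ} (hg : ∀ a, P a → 0 ≤ g a) (h : ∀ w ∈ S, ∃ C, ∀ a, P a → |f w a| ≤ C * g a) :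
    ∃ C, 0 ≤ C ∧ ∀ w ∈ S, ∀ a, P a → |f w a| ≤ C * g a := by
  choose! C hC using h
  refine ⟨∑ w ∈ S, |C w|, Finset.sum_nonneg fun _ _ => abs_nonneg _, fun w hw a ha => ?_⟩
  refine (hC w hw a ha).trans (mul_le_mul_of_nonneg_right ((le_abs_self _).trans ?_) (hg a ha))
  exact Finset.single_le_sum (f := fun w => |C w|) (fun _ _ => abs_nonneg _) hw

theorem exists_tendsto_of_bounded {α : Type*} (F : Ultrafilter α) {f : α → ℝ} {C : ℝ}
    (h : ∀ᶠ a in (F : Filter α), |f a| ≤ C) :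
    ∃ x, Filter.Tendsto f F (nhds x) := by
  obtain ⟨x, -, hx⟩ := (isCompact_Icc (a := -C) (b := C)).ultrafilter_le_nhds (F.map f)
    (Filter.le_principal_iff.2 (h.mono fun a ha => abs_le.1 ha))
  exact ⟨x, hx⟩

variable {κ U : Type*} [Fintype κ] [AddCommGroup U] [Module ℝ U] {T : ℝ} {ω : ℝ → ℝ → ℝ}

/-- The products of an almost multiplicative functional over partitions are bounded, and close to
the functional itself. The weight `lam` is chosen so small that the constants of the maximal
inequality are small. -/
theorem exists_maximal_bound (hω : IsControl T ω) (b : Module.Basis κ ℝ U) (N : ℕ) {θ : ℝ}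
    (hθ : 1 < θ) (hT : 0 ≤ T) {Y : ℝ → ℝ → TAlg U}
    (hnil : ∀ s t, 0 ≤ s → s ≤ t → t ≤ T → wordCoord b [] (Y s t) = 1)
    (hdiag : ∀ t, 0 ≤ t → t ≤ T → ∀ w : List κ, w.length ≤ N →
      wordCoord b w (Y t t) = wordCoord b w 1)
    (hbd : ∀ w : List κ, w.length ≤ N → ∃ C, ∀ s t, 0 ≤ s → s ≤ t → t ≤ T →
      |wordCoord b w (Y s t)| ≤ C)
    (hmul : ∀ w : List κ, w.length ≤ N → ∃ C, ∀ s u t, 0 ≤ s → s ≤ u → u ≤ t → t ≤ T →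
      |wordCoord b w (Y s u * Y u t) - wordCoord b w (Y s t)| ≤ C * ω s t ^ θ) :
    ∃ lam K : ℝ, 0 < lam ∧ lam ≤ 1 ∧ 0 ≤ K ∧ ∀ s t l, IsTimes T s t l →
      (weightedNorm κ N lam fun w => wordCoord b w (pathProd Y l)) ≤ 3 ∧
      (weightedNorm κ N lam fun w => wordCoord b w (pathProd Y l) - wordCoord b w (Y s t)) ≤
        K * ω s t ^ θ := by
  have hω0 : 0 ≤ ω 0 T := hω.nonneg 0 T le_rfl hT le_rfl
  -- constants that are uniform over the finitely many words
  obtain ⟨M, hM0, hM⟩ := exists_uniform_bound (S := wordsLE κ N)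
    (P := fun q : ℝ × ℝ => 0 ≤ q.1 ∧ q.1 ≤ q.2 ∧ q.2 ≤ T)
    (f := fun w q => wordCoord b w (Y q.1 q.2)) (g := fun _ => 1) (fun _ _ => zero_le_one)
    (fun w hw => by
      obtain ⟨C, hC⟩ := hbd w (mem_wordsLE.1 hw)
      exact ⟨C, fun q hq => by simpa using hC q.1 q.2 hq.1 hq.2.1 hq.2.2⟩)
  obtain ⟨C₁, hC₁0, hC₁⟩ := exists_uniform_bound (S := wordsLE κ N)
    (P := fun q : ℝ × ℝ × ℝ => 0 ≤ q.1 ∧ q.1 ≤ q.2.1 ∧ q.2.1 ≤ q.2.2 ∧ q.2.2 ≤ T)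
    (f := fun w q => wordCoord b w (Y q.1 q.2.1 * Y q.2.1 q.2.2) - wordCoord b w (Y q.1 q.2.2))
    (g := fun q => ω q.1 q.2.2 ^ θ)
    (fun q hq => Real.rpow_nonneg (hω.nonneg _ _ hq.1 (hq.2.1.trans hq.2.2.1) hq.2.2.2) _)
    (fun w hw => by
      obtain ⟨C, hC⟩ := hmul w (mem_wordsLE.1 hw)
      exact ⟨C, fun q hq => hC q.1 q.2.1 q.2.2 hq.1 hq.2.1 hq.2.2.1 hq.2.2.2⟩)
  obtain ⟨n₀, hn₀⟩ : ∃ n₀ : ℝ, n₀ = ((wordsLE κ N).card : ℝ) := ⟨_, rfl⟩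
  have hn₀0 : 0 ≤ n₀ := hn₀ ▸ Nat.cast_nonneg _
  obtain ⟨W, hW⟩ : ∃ W : ℝ, W = ω 0 T ^ θ := ⟨_, rfl⟩
  have hW0 : 0 ≤ W := hW ▸ Real.rpow_nonneg hω0 _
  obtain ⟨q, hq⟩ : ∃ q : ℝ, q = 2 * (1 / 2) ^ θ := ⟨_, rfl⟩
  have hq0 : 0 ≤ q := by rw [hq]; positivity
  have hq1 : q < 1 := by
    have h1 : ((1 : ℝ) / 2) ^ θ < (1 / 2) ^ (1 : ℝ) :=
      Real.rpow_lt_rpow_of_exponent_gt (by norm_num) (by norm_num) hθ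
    rw [Real.rpow_one] at h1
    linarith
  -- `2 * (1 / 2) ^ θ < 1` leaves room for the factor `(1 + 2 ε)²` in the maximal inequality
  obtain ⟨ε, hε⟩ : ∃ ε : ℝ, ε = (1 - q) / 16 := ⟨_, rfl⟩
  have hε0 : 0 < ε := by rw [hε]; linarith
  have hε1 : ε ≤ 1 := by rw [hε]; linarith
  have hεq : q * (1 + 2 * ε) ^ 2 ≤ (1 + q) / 2 := by
    have h1 : (1 + 2 * ε) ^ 2 ≤ 1 + 8 * ε := by nlinarith
    have h2 : q * ε ≤ ε := mul_le_of_le_one_left hε0.le hq1.le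
    linarith [mul_le_mul_of_nonneg_left h1 hq0]
  obtain ⟨D, hD⟩ : ∃ D : ℝ, D = 1 + n₀ * M + 6 * (n₀ * C₁) / (1 - q) * W := ⟨_, rfl⟩
  have hfrac : 0 ≤ 6 * (n₀ * C₁) / (1 - q) * W :=
    mul_nonneg (div_nonneg (by positivity) (by linarith)) hW0
  have hnM : 0 ≤ n₀ * M := by positivity
  have hD1 : 1 ≤ D := by linarith
  -- the coordinate at the empty word is exactly multiplicative, and all other words carry a factor
  -- `lam`; hence `C`, `K` and the excess of the norms over `1` are of order `lam`
  obtain ⟨lam, hlam⟩ : ∃ lam : ℝ, lam = ε / D := ⟨_, rfl⟩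
  have hl0 : 0 < lam := by rw [hlam]; positivity
  have hlD : lam * D = ε := by rw [hlam]; exact div_mul_cancel₀ _ (by positivity)
  have hl1 : lam ≤ 1 := by rw [hlam]; exact (div_le_one (by positivity)).2 (by linarith)
  obtain ⟨C, hC⟩ : ∃ C : ℝ, C = lam * (n₀ * C₁) := ⟨_, rfl⟩
  have hC0 : 0 ≤ C := by rw [hC]; positivity
  -- the solution of `K * ((1 + q) / 2) + 3 * C = K`
  obtain ⟨K, hK⟩ : ∃ K : ℝ, K = 6 * C / (1 - q) := ⟨_, rfl⟩
  have hK0 : 0 ≤ K := by rw [hK]; exact div_nonneg (by positivity) (by linarith)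
  have hKq : K * (1 - q) = 6 * C := by rw [hK]; exact div_mul_cancel₀ _ (by linarith)
  have hKW : K * W ≤ ε := by
    have h1 : K * W = lam * (6 * (n₀ * C₁) / (1 - q) * W) := by rw [hK, hC]; ring
    rw [h1, ← hlD]
    exact mul_le_mul_of_nonneg_left (by linarith) hl0.le
  have hlM : lam * (n₀ * M) ≤ ε := by
    rw [← hlD]
    exact mul_le_mul_of_nonneg_left (by linarith) hl0.le
  have hd := isSubmulDist_weightedNorm b N hl0.le
  have hY : ∀ s t, 0 ≤ s → s ≤ t → t ≤ T →
      (weightedNorm κ N lam fun w => wordCoord b w (Y s t)) ≤ 1 + ε := fun s t hs hst ht =>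
    (weightedNorm_le hl0.le hl1 hM0 (by rw [hnil s t hs hst ht, abs_one]) fun w hw => by
      simpa using hM w (mem_wordsLE.2 hw) (s, t) ⟨hs, hst, ht⟩).trans (by rw [← hn₀]; linarith)
  have hone : ∀ t, 0 ≤ t → t ≤ T →
      (weightedNorm κ N lam fun w => wordCoord b w 1 - wordCoord b w (Y t t)) = 0 :=
    fun t ht htT => weightedNorm_eq_zero fun w hw => by rw [hdiag t ht htT w hw, sub_self]
  have hYmul : ∀ s u t, 0 ≤ s → s ≤ u → u ≤ t → t ≤ T →
      (weightedNorm κ N lam fun w => wordCoord b w (Y s u * Y u t) - wordCoord b w (Y s t)) ≤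
        C * ω s t ^ θ := by
    intro s u t hs hsu hut ht
    have h0 := Real.rpow_nonneg (hω.nonneg s t hs (hsu.trans hut) ht) θ
    refine (weightedNorm_le (a := 0) hl0.le hl1 (mul_nonneg hC₁0 h0) ?_ fun w hw => ?_).trans
      (le_of_eq ?_)
    · rw [wordCoord_mul, deconcSum, hnil s u hs hsu (hut.trans ht),
        hnil u t (hs.trans hsu) hut ht, hnil s t hs (hsu.trans hut) ht]
      simp
    · exact hC₁ w (mem_wordsLE.2 hw) (s, u, t) ⟨hs, hsu, hut, ht⟩
    · rw [hC, hn₀]; ring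
  have hKC : K * (2 * (1 / 2) ^ θ * (1 + 2 * ε) ^ 2) + 3 * C ≤ K := by
    rw [← hq]
    linarith [mul_le_mul_of_nonneg_left hεq hK0]
  have hsew := dist_pathProd_le hd hω (by linarith) hε0.le hε1 hC0 hK0 hY hone hYmul hKC
    (hW ▸ hKW)
  refine ⟨lam, K, hl0, hl1, hK0, fun s t l hl => ⟨?_, hsew l s t hl⟩⟩
  obtain ⟨hs, hst, ht⟩ := hl.le
  have h1 : K * ω s t ^ θ ≤ ε := by
    refine (mul_le_mul_of_nonneg_left (Real.rpow_le_rpow (hω.nonneg s t hs hst ht)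
      (hω.le_total hs hst ht) (by linarith)) hK0).trans ?_
    rwa [← hW]
  have h2 := hd.size_le (pathProd Y l) (Y s t)
  have h3 := hsew l s t hl
  have h4 := hY s t hs hst ht
  linarith

/-- The sewing lemma in the truncated tensor algebra, in coordinates. The limit `L` is taken along
an ultrafilter of finite sets of subdivision points, which makes its multiplicativity evident; the
products over all fine partitions are then close to `L`. -/
theorem exists_sewing (hω : IsControl T ω) (b : Module.Basis κ ℝ U) (N : ℕ) {θ : ℝ} (hθ : 1 < θ)
    (hT : 0 ≤ T) {Y : ℝ → ℝ → TAlg U}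
    (hnil : ∀ s t, 0 ≤ s → s ≤ t → t ≤ T → wordCoord b [] (Y s t) = 1)
    (hdiag : ∀ t, 0 ≤ t → t ≤ T → ∀ w : List κ, w.length ≤ N →
      wordCoord b w (Y t t) = wordCoord b w 1)
    (hbd : ∀ w : List κ, w.length ≤ N → ∃ C, ∀ s t, 0 ≤ s → s ≤ t → t ≤ T →
      |wordCoord b w (Y s t)| ≤ C)
    (hmul : ∀ w : List κ, w.length ≤ N → ∃ C, ∀ s u t, 0 ≤ s → s ≤ u → u ≤ t → t ≤ T →
      |wordCoord b w (Y s u * Y u t) - wordCoord b w (Y s t)| ≤ C * ω s t ^ θ) :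
    ∃ L : ℝ → ℝ → TAlg U,
      (∀ s t, ∀ w : List κ, N < w.length → wordCoord b w (L s t) = 0) ∧
      (∀ s u t, 0 ≤ s → s ≤ u → u ≤ t → t ≤ T → ∀ w : List κ, w.length ≤ N →
        wordCoord b w (L s u * L u t) = wordCoord b w (L s t)) ∧
      (∃ C, ∀ w : List κ, w.length ≤ N → ∀ s t, 0 ≤ s → s ≤ t → t ≤ T →
        |wordCoord b w (L s t) - wordCoord b w (Y s t)| ≤ C * ω s t ^ θ) ∧
      ∀ δ > 0, ∃ η > 0, ∀ s t l, IsTimes T s t l → l.IsChain (fun x y => y - x < η) →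
        ∀ w : List κ, w.length ≤ N →
          |wordCoord b w (pathProd Y l) - wordCoord b w (L s t)| ≤ δ := by
  have hω0 : 0 ≤ ω 0 T := hω.nonneg 0 T le_rfl hT le_rfl
  obtain ⟨lam, K, hl0, hl1, hK0, hPK⟩ :=
    exists_maximal_bound hω b N hθ hT hnil hdiag hbd hmul
  have hd := isSubmulDist_weightedNorm b N hl0.le
  let F : Ultrafilter (Finset ℝ) := Ultrafilter.of Filter.atTop
  have hF : ∀ x : ℝ, ∀ᶠ D in (F : Filter (Finset ℝ)), x ∈ D := fun x =>
    Ultrafilter.of_le _ ((Filter.eventually_ge_atTop {x}).mono fun D hD => hD (by simp))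
  -- by the maximal inequality the coordinates are bounded, hence they converge along `F`
  have hex : ∀ s t (w : List κ), ∃ x : ℝ, 0 ≤ s → s ≤ t → t ≤ T → w.length ≤ N →
      Filter.Tendsto (fun D => wordCoord b w (pathProd Y (gridPoints D s t))) F (nhds x) := by
    intro s t w
    by_cases h : 0 ≤ s ∧ s ≤ t ∧ t ≤ T ∧ w.length ≤ N
    · obtain ⟨x, hx⟩ := exists_tendsto_of_bounded F (C := (lam ^ N)⁻¹ * 3)
        (f := fun D => wordCoord b w (pathProd Y (gridPoints D s t))) (by
          filter_upwards [hF t] with D hD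
          refine (le_weightedNorm hl0 hl1 (fun w => wordCoord b w (pathProd Y (gridPoints D s t)))
            h.2.2.2).trans (mul_le_mul_of_nonneg_left
              (hPK s t _ (isTimes_gridPoints h.1 h.2.1 h.2.2.1 hD)).1 (by positivity)))
      exact ⟨x, fun _ _ _ _ => hx⟩
    · exact ⟨0, fun h1 h2 h3 h4 => absurd ⟨h1, h2, h3, h4⟩ h⟩
  choose x hx using hex
  obtain ⟨L, hLx⟩ : ∃ L : ℝ → ℝ → TAlg U, ∀ s t (w : List κ),
      wordCoord b w (L s t) = if w.length ≤ N then x s t w else 0 :=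
    ⟨fun s t => ofCoords b N (x s t), fun s t w => wordCoord_ofCoords b N (x s t) w⟩
  have hL : ∀ s t, 0 ≤ s → s ≤ t → t ≤ T → ∀ w : List κ, w.length ≤ N →
      Filter.Tendsto (fun D => wordCoord b w (pathProd Y (gridPoints D s t))) F
        (nhds (wordCoord b w (L s t))) := by
    intro s t hs hst ht w hw
    rw [hLx, if_pos hw]
    exact hx s t w hs hst ht hw
  have hLmul : ∀ s u t, 0 ≤ s → s ≤ u → u ≤ t → t ≤ T → ∀ w : List κ, w.length ≤ N →
      wordCoord b w (L s u * L u t) = wordCoord b w (L s t) := by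
    intro s u t hs hsu hut ht w hw
    refine tendsto_nhds_unique ?_ (hL s t hs (hsu.trans hut) ht w hw)
    rw [wordCoord_mul]
    refine Filter.Tendsto.congr' ?_ (tendsto_deconcSum w (q := fun v v' D =>
      wordCoord b v' (pathProd Y (gridPoints D s u)) *
        wordCoord b v (pathProd Y (gridPoints D u t))) fun v v' h => ?_)
    · filter_upwards [hF u] with D hD
      rw [pathProd_gridPoints Y hs hsu hut (hut.trans ht) hD, wordCoord_mul]
    · have hlen : v.length + v'.length = w.length := by rw [← h, List.length_append]
      exact (hL s u hs hsu (hut.trans ht) v' (by omega)).mul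
        (hL u t (hs.trans hsu) hut ht v (by omega))
  have hLY : ∀ s t, 0 ≤ s → s ≤ t → t ≤ T →
      (weightedNorm κ N lam fun w => wordCoord b w (L s t) - wordCoord b w (Y s t)) ≤
        K * ω s t ^ θ := by
    intro s t hs hst ht
    refine le_of_tendsto (tendsto_finsetSum _ fun w hw =>
      (((hL s t hs hst ht w (mem_wordsLE.1 hw)).sub_const _).abs.const_mul (lam ^ w.length))) ?_
    filter_upwards [hF t] with D hD
    exact (hPK s t _ (isTimes_gridPoints hs hst ht hD)).2
  have hLB : ∀ s t, 0 ≤ s → s ≤ t → t ≤ T →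
      (weightedNorm κ N lam fun w => wordCoord b w (L s t)) ≤ 3 := by
    intro s t hs hst ht
    refine le_of_tendsto (tendsto_finsetSum _ fun w hw =>
      ((hL s t hs hst ht w (mem_wordsLE.1 hw)).abs.const_mul (lam ^ w.length))) ?_
    filter_upwards [hF t] with D hD
    exact (hPK s t _ (isTimes_gridPoints hs hst ht hD)).1
  have hLone : ∀ t, 0 ≤ t → t ≤ T →
      (weightedNorm κ N lam fun w => wordCoord b w 1 - wordCoord b w (L t t)) = 0 := by
    intro t ht htT
    have h1 := hLY t t ht le_rfl htT
    rw [hω.diag t ht htT, Real.zero_rpow (by linarith), mul_zero] at h1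
    refine weightedNorm_eq_zero fun w hw => ?_
    have h2 := le_weightedNorm hl0 hl1
      (fun w => wordCoord b w (L t t) - wordCoord b w (Y t t)) hw
    have h3 := h2.trans (mul_le_mul_of_nonneg_left h1 (by positivity))
    rw [mul_zero, abs_nonpos_iff, hdiag t ht htT w hw, sub_eq_zero] at h3
    rw [h3, sub_self]
  refine ⟨L, fun s t w hw => ?_, hLmul, ⟨(lam ^ N)⁻¹ * K,
    fun w hw s t hs hst ht => ?_⟩, fun δ hδ => ?_⟩
  · rw [hLx, if_neg (by omega)]
  · rw [mul_assoc]
    exact (le_weightedNorm hl0 hl1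
      (fun w => wordCoord b w (L s t) - wordCoord b w (Y s t)) hw).trans
      (mul_le_mul_of_nonneg_left (hLY s t hs hst ht) (by positivity))
  · obtain ⟨c, hc⟩ : ∃ c : ℝ, c = lam ^ N * δ / (9 * (ω 0 T + 1)) := ⟨_, rfl⟩
    have hc0 : 0 < c := by rw [hc]; positivity
    obtain ⟨η, hη, hηc⟩ := hω.exists_rpow_le hθ (div_pos hc0 (show 0 < K + 1 by linarith))
    refine ⟨η, hη, fun s t l hl hch w hw => ?_⟩
    obtain ⟨hs, hst, ht⟩ := hl.le
    rcases l with _ | ⟨y, l⟩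
    · exact absurd hl.head (by simp)
    obtain rfl : y = s := by simpa using hl.head
    have h1 := dist_pathProd_mul_le hd hω (L := L) (B := 3) (c := c) (η := η) (by norm_num) hc0.le
      (fun s t l hl => (hPK s t l hl).1) hLB hLone
      (fun s u t hs hsu hut ht => weightedNorm_eq_zero fun w hw => by
        rw [hLmul s u t hs hsu hut ht w hw, sub_self])
      (fun s t hs hst ht hlt => by
        rw [hd.symm]
        have h2 := mul_le_mul_of_nonneg_left (hηc s t hs hst ht hlt) (show 0 ≤ K + 1 by linarith)
        rw [← mul_assoc, mul_div_cancel₀ _ (show K + 1 ≠ 0 by linarith)] at h2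
        linarith [hLY s t hs hst ht, Real.rpow_nonneg (hω.nonneg s t hs hst ht) θ])
      l [] y y t hl hch
    rw [List.nil_append, List.nil_append, pathProd, one_mul] at h1
    refine (le_weightedNorm hl0 hl1
      (fun w => wordCoord b w (pathProd Y (y :: l)) - wordCoord b w (L y t)) hw).trans ?_
    rw [inv_mul_le_iff₀ (by positivity)]
    refine h1.trans ?_
    have h3 : c * (9 * (ω 0 T + 1)) = lam ^ N * δ := by
      rw [hc]; exact div_mul_cancel₀ _ (by positivity)
    have h4 := mul_le_mul_of_nonneg_left (hω.le_total hs hst ht) hc0.le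
    linarith

end SewingLimit

/-! ### From almost rough paths to rough paths -/

section RoughPathOfAlmostRoughPath

variable {κ U : Type*} [AddCommGroup U] [Module ℝ U] {T p : ℝ} {ω : ℝ → ℝ → ℝ}

theorem partitionProd_eq_pathProd (Y : ℝ → ℝ → TAlg U) {s t : ℝ} (π : IntervalPartition s t) :
    partitionProd Y π = pathProd Y ((List.range (π.size + 1)).map π.point) := by
  rw [List.range_eq_range', pathProd_map_range', ← List.range_eq_range', partitionProd]

theorem IntervalPartition.isTimes {s t : ℝ} (hs : 0 ≤ s) (ht : t ≤ T)
    (π : IntervalPartition s t) : IsTimes T s t ((List.range (π.size + 1)).map π.point) := by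
  have hch : ((List.range (π.size + 1)).map π.point).IsChain (· ≤ ·) :=
    (List.isChain_map _).2 ((List.isChain_range_succ _ _).2 π.mono)
  have hpw := List.isChain_iff_pairwise.1 hch
  have hle : ∀ i ≤ π.size, s ≤ π.point i := by
    intro i
    induction i with
    | zero => intro _; exact π.first.ge
    | succ i ih => exact fun hi => (ih (by omega)).trans (π.mono i (by omega))
  have hge : ∀ j i, i + j = π.size → π.point i ≤ t := by
    intro j
    induction j with
    | zero => rintro i rfl; exact π.last.le
    | succ j ih => exact fun i hi => (π.mono i (by omega)).trans (ih (i + 1) (by omega))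
  refine ⟨hpw, fun x hx => ?_, ?_, ?_⟩
  · obtain ⟨i, hi, rfl⟩ := List.mem_map.1 hx
    rw [List.mem_range] at hi
    exact ⟨hs.trans (hle i (by omega)), (hge (π.size - i) i (by omega)).trans ht⟩
  · rw [List.range_succ_eq_map, List.map_cons, List.head?_cons, π.first]
  · rw [List.range_succ, List.map_append, List.map_singleton, List.getLast?_concat, π.last]

/-- The partition of `[s, t]` into `n + 1` intervals of equal length. -/
def uniformPartition (n : ℕ) {s t : ℝ} (hst : s ≤ t) : IntervalPartition s t where
  size := n + 1
  point i := s + (t - s) * (i / (n + 1))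
  first := by simp
  last := by
    push_cast
    rw [div_self (by positivity)]
    ring
  mono i _ := by
    have h : (i : ℝ) / (n + 1) ≤ ((i + 1 : ℕ) : ℝ) / (n + 1) := by
      push_cast
      gcongr
      linarith
    linarith [mul_le_mul_of_nonneg_left h (sub_nonneg.2 hst)]

theorem uniformPartition_step (n : ℕ) {s t : ℝ} (hst : s ≤ t) (i : ℕ) :
    (uniformPartition n hst).point (i + 1) - (uniformPartition n hst).point i =
      (t - s) / (n + 1) := by
  simp only [uniformPartition]
  push_cast
  field_simp
  ring

theorem continuousOn_wordCoord_list_prod (b : Module.Basis κ ℝ U) {β α : Type*}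
    [TopologicalSpace β] {S : Set β} (f : α → β → TAlg U) (l : List α)
    (hf : ∀ i ∈ l, ∀ w : List κ, ContinuousOn (fun q : β => wordCoord b w (f i q)) S)
    (w : List κ) :
    ContinuousOn (fun q : β => wordCoord b w (l.map fun i => f i q).prod) S := by
  induction l generalizing w with
  | nil => exact continuousOn_const (c := wordCoord b w 1)
  | cons i l ih =>
    simp only [List.map_cons, List.prod_cons, wordCoord_mul]
    exact continuousOn_deconcSum w fun v u _ => (hf i (by simp) u).mul
      (ih (fun j hj => hf j (by simp [hj])) v)

/-- The defect of integration by parts of a multiplicative functional at `(K, L)` is additive, if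
it vanishes at all pairs of shorter words. -/
theorem defect_additive {x y z : List κ → ℝ} {N : ℕ} (hy0 : y [] = 1) (hz0 : z [] = 1)
    (hx : ∀ w : List κ, w.length ≤ N → x w = deconcSum w fun v u => y u * z v) {K L : List κ}
    (hKL : K.length + L.length ≤ N)
    (hy : ∀ K' L' : List κ, K'.length + L'.length < K.length + L.length →
      y K' * y L' = shuffleSum K' L' y)
    (hz : ∀ K' L' : List κ, K'.length + L'.length < K.length + L.length →
      z K' * z L' = shuffleSum K' L' z) :
    x K * x L - shuffleSum K L x =
      (y K * y L - shuffleSum K L y) + (z K * z L - shuffleSum K L z) := by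
  classical
  have e1 : x K * x L = deconcSum K fun K₁ K₂ => deconcSum L fun L₁ L₂ =>
      (y K₂ * y L₂) * (z K₁ * z L₁) := by
    rw [hx K (by omega), hx L (by omega), deconcSum_mul_right]
    refine deconcSum_congr fun K₁ K₂ _ => ?_
    rw [mul_comm, deconcSum_mul_right]
    exact deconcSum_congr fun L₁ L₂ _ => by ring
  have e2 : shuffleSum K L x = deconcSum K fun K₁ K₂ => deconcSum L fun L₁ L₂ =>
      shuffleSum K₂ L₂ y * shuffleSum K₁ L₁ z := by
    rw [shuffleSum_congr (y' := fun M => deconcSum M fun v u => y u * z v)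
      fun M hM => hx M (by omega), shuffleSum_deconcSum]
    refine deconcSum_congr fun K₁ K₂ _ => deconcSum_congr fun L₁ L₂ _ => ?_
    rw [shuffleSum_mul_left]
    refine shuffleSum_congr fun M₁ _ => ?_
    rw [mul_comm, shuffleSum_mul_left]
    exact shuffleSum_congr fun M₂ _ => mul_comm _ _
  have e3 : ∀ K₁ K₂, K₁ ++ K₂ = K → ∀ L₁ L₂, L₁ ++ L₂ = L →
      (y K₂ * y L₂) * (z K₁ * z L₁) = shuffleSum K₂ L₂ y * shuffleSum K₁ L₁ z +
        ((if K₁ = [] ∧ K₂ = K then if L₁ = [] ∧ L₂ = L then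
            y K * y L - shuffleSum K L y else 0 else 0) +
          if K₁ = K ∧ K₂ = [] then if L₁ = L ∧ L₂ = [] then
            z K * z L - shuffleSum K L z else 0 else 0) := by
    rintro K₁ K₂ rfl L₁ L₂ rfl
    by_cases hA : K₁ = [] ∧ L₁ = []
    · obtain ⟨rfl, rfl⟩ := hA
      by_cases hB : K₂ = [] ∧ L₂ = []
      · obtain ⟨rfl, rfl⟩ := hB
        simp [shuffleSum_nil_left, hy0, hz0]
      · rcases not_and_or.1 hB with h | h <;> simp [shuffleSum_nil_left, hz0, h]
    · by_cases hB : K₂ = [] ∧ L₂ = []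
      · obtain ⟨rfl, rfl⟩ := hB
        rcases not_and_or.1 hA with h | h <;> simp [shuffleSum_nil_left, hy0, h]
      · have h1 : K₂.length + L₂.length < (K₁ ++ K₂).length + (L₁ ++ L₂).length := by
          rcases not_and_or.1 hA with h | h <;> have := List.length_pos_iff.2 h <;> simp <;> omega
        have h2 : K₁.length + L₁.length < (K₁ ++ K₂).length + (L₁ ++ L₂).length := by
          rcases not_and_or.1 hB with h | h <;> have := List.length_pos_iff.2 h <;> simp <;> omega
        rw [hy _ _ h1, hz _ _ h2]
        rcases not_and_or.1 hA with h | h <;> rcases not_and_or.1 hB with h' | h' <;> simp [h, h']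
  have e4 : ∀ (v u v' u' : List κ) (c : ℝ), v ++ u = K → v' ++ u' = L →
      (deconcSum K fun K₁ K₂ => deconcSum L fun L₁ L₂ =>
        if K₁ = v ∧ K₂ = u then if L₁ = v' ∧ L₂ = u' then c else 0 else 0) = c := by
    intro v u v' u' c hK hL
    rw [deconcSum_congr (q' := fun K₁ K₂ => if K₁ = v ∧ K₂ = u then c else 0)
      fun K₁ K₂ _ => ?_, deconcSum_single, if_pos hK]
    split_ifs
    · rw [deconcSum_single, if_pos hL]
    · rw [deconcSum_zero]
  rw [e1, e2, deconcSum_congr fun K₁ K₂ hK => deconcSum_congr fun L₁ L₂ hL => e3 K₁ K₂ hK L₁ L₂ hL]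
  simp only [deconcSum_add]
  rw [e4 [] K [] L _ rfl rfl, e4 K [] L [] _ (by simp) (by simp)]
  ring

theorem wordCoord_nil_pathProd (b : Module.Basis κ ℝ U) {Y : ℝ → ℝ → TAlg U}
    (hY : ∀ s t, 0 ≤ s → s ≤ t → t ≤ T → wordCoord b [] (Y s t) = 1) (l : List ℝ) :
    ∀ s t, IsTimes T s t l → wordCoord b [] (pathProd Y l) = 1 := by
  induction l with
  | nil => intro s t _; rw [pathProd, wordCoord_one, if_pos rfl]
  | cons x l ih =>
    intro s t hl
    rcases l with _ | ⟨y, l⟩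
    · rw [pathProd, wordCoord_one, if_pos rfl]
    · have h1 : IsTimes T y t (y :: l) := IsTimes.right (l₁ := [x]) hl
      have h2 : IsTimes T s y [x, y] := IsTimes.left (l₁ := [x]) hl
      obtain rfl : x = s := by simpa using h2.head
      rw [pathProd, wordCoord_mul, deconcSum, ih y t h1, hY x y h2.le.1 h2.le.2.1 h2.le.2.2,
        mul_one]

theorem IsRegularFunctional.wordCoord_bounded {Y : ℝ → ℝ → TAlg U}
    (hY : IsRegularFunctional T p ω Y) (hω : IsControl T ω) (hp : 0 < p)
    (b : Module.Basis κ ℝ U) (w : List κ) :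
    ∃ B, 0 ≤ B ∧ ∀ s t, 0 ≤ s → s ≤ t → t ≤ T → |wordCoord b w (Y s t)| ≤ B := by
  obtain ⟨C, hC⟩ := hY.wordCoord_bound hω b w
  refine ⟨|C| * |(ω 0 T ^ (1 / p)) ^ w.length|, by positivity, fun s t hs hst ht => ?_⟩
  have h0 := hω.nonneg s t hs hst ht
  have h1 : (ω s t ^ (1 / p)) ^ w.length ≤ (ω 0 T ^ (1 / p)) ^ w.length :=
    pow_le_pow_left₀ (Real.rpow_nonneg h0 _)
      (Real.rpow_le_rpow h0 (hω.le_total hs hst ht) (by positivity)) _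
  have h2 : 0 ≤ (ω s t ^ (1 / p)) ^ w.length := pow_nonneg (Real.rpow_nonneg h0 _) _
  exact (hC s t hs hst ht).trans ((mul_le_mul_of_nonneg_right (le_abs_self C) h2).trans
    (mul_le_mul_of_nonneg_left (h1.trans (le_abs_self _)) (abs_nonneg C)))

/-- A uniform limit of products over uniform partitions has continuous coordinates. -/
theorem continuousOn_of_forall_isChain (b : Module.Basis κ ℝ U) {Y : ℝ → ℝ → TAlg U}
    {L : ℝ → ℝ → TAlg U}
    (hY : ∀ w : List κ, ContinuousOn (fun q : ℝ × ℝ => wordCoord b w (Y q.1 q.2)) (simplex T))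
    (w : List κ)
    (hL : ∀ δ > 0, ∃ η > 0, ∀ s t l, IsTimes T s t l → l.IsChain (fun x y => y - x < η) →
      |wordCoord b w (pathProd Y l) - wordCoord b w (L s t)| ≤ δ) :
    ContinuousOn (fun q : ℝ × ℝ => wordCoord b w (L q.1 q.2)) (simplex T) := by
  let pt : ℕ → ℕ → ℝ × ℝ → ℝ := fun n i q => q.1 + (q.2 - q.1) * (i / (n + 1))
  have hpt : ∀ n i, i ≤ n + 1 → ∀ q ∈ simplex T, 0 ≤ pt n i q ∧ pt n i q ≤ T := by
    rintro n i hi ⟨s, t⟩ ⟨hs, hst, ht⟩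
    have h0 : (0 : ℝ) ≤ i / (n + 1) := by positivity
    have h1 : (i : ℝ) / (n + 1) ≤ 1 := (div_le_one (by positivity)).2 (by exact_mod_cast hi)
    have h2 : 0 ≤ t - s := sub_nonneg.2 hst
    have h3 := mul_le_mul_of_nonneg_left h1 h2
    have h4 := mul_nonneg h2 h0
    dsimp only [pt] at hs hst ht ⊢
    constructor <;> linarith
  have hunif : TendstoUniformlyOn
      (fun (n : ℕ) (q : ℝ × ℝ) => wordCoord b w
        ((List.range (n + 1)).map fun i => Y (pt n i q) (pt n (i + 1) q)).prod)
      (fun q : ℝ × ℝ => wordCoord b w (L q.1 q.2)) Filter.atTop (simplex T) := by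
    rw [Metric.tendstoUniformlyOn_iff]
    intro δ hδ
    obtain ⟨η, hη, h⟩ := hL (δ / 2) (half_pos hδ)
    obtain ⟨n₀, hn₀⟩ := exists_nat_gt (T / η)
    filter_upwards [Filter.eventually_ge_atTop n₀] with n hn
    rintro ⟨s, t⟩ ⟨hs, hst, ht⟩
    dsimp only at hs hst ht ⊢
    have hstep : (t - s) / (n + 1) < η := by
      rw [div_lt_iff₀ (by positivity)]
      rw [div_lt_iff₀ hη] at hn₀
      have h1 : (n₀ : ℝ) ≤ n := by exact_mod_cast hn
      nlinarith
    have h1 := h s t _ ((uniformPartition n hst).isTimes hs ht)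
      ((List.isChain_map _).2 ((List.isChain_range_succ _ _).2 fun i _ => by
        rw [uniformPartition_step]; exact hstep))
    rw [← partitionProd_eq_pathProd] at h1
    rw [dist_comm, Real.dist_eq]
    exact h1.trans_lt (by linarith)
  refine hunif.continuousOn (Filter.Eventually.frequently (Filter.Eventually.of_forall fun n => ?_))
  refine continuousOn_wordCoord_list_prod b (fun i q => Y (pt n i q) (pt n (i + 1) q)) _
    (fun i hi v => ?_) w
  rw [List.mem_range] at hi
  have hcont : ∀ i, Continuous (pt n i) := fun i => by fun_prop
  refine ContinuousOn.comp (g := fun q : ℝ × ℝ => wordCoord b v (Y q.1 q.2))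
    (f := fun q => (pt n i q, pt n (i + 1) q)) (hY v)
    ((hcont i).prodMk (hcont (i + 1))).continuousOn fun q hq => ?_
  refine ⟨(hpt n i (by omega) q hq).1, ?_, (hpt n (i + 1) (by omega) q hq).2⟩
  exact (uniformPartition n hq.2.1).mono i hi

/-- Every almost rough path determines a rough path, the limit of its products over partitions,
from which it differs by `O(ω^θ)` with `θ > 1`. -/
theorem IsAlmostRoughPath.exists_isRoughPath [Fintype κ] {Y : ℝ → ℝ → TAlg U}
    (hY : IsAlmostRoughPath T p ω Y) (hω : IsControl T ω) (hT : 0 ≤ T) (hp : 1 ≤ p)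
    (b : Module.Basis κ ℝ U) :
    ∃ L : ℝ → ℝ → TAlg U,
      (∀ s t, 0 ≤ s → s ≤ t → t ≤ T → IsPartitionLimit ⌊p⌋₊ Y s t (L s t)) ∧
      IsRoughPath T p ω L ∧
      ∃ θ C : ℝ, 1 < θ ∧ ∀ w : List κ, w.length ≤ ⌊p⌋₊ → ∀ s t, 0 ≤ s → s ≤ t → t ≤ T →
        |wordCoord b w (L s t) - wordCoord b w (Y s t)| ≤ C * ω s t ^ θ := by
  have hp0 : 0 < p := by linarith
  have hYr := hY.toIsRegularFunctional
  obtain ⟨θ, hθ⟩ : ∃ θ : ℝ, θ = ((⌊p⌋₊ : ℝ) + 1) / p := ⟨_, rfl⟩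
  have hθ1 : 1 < θ := by
    rw [hθ, one_lt_div hp0]
    exact Nat.lt_floor_add_one p
  have hθpow : ∀ s t, 0 ≤ s → s ≤ t → t ≤ T →
      ω s t ^ θ = (ω s t ^ (1 / p)) ^ (⌊p⌋₊ + 1) := fun s t hs hst ht => by
    rw [← rpow_natCast_div _ (hω.nonneg s t hs hst ht), hθ]
    push_cast
    rfl
  have hdiag : ∀ t, 0 ≤ t → t ≤ T → ∀ w : List κ, w.length ≤ ⌊p⌋₊ →
      wordCoord b w (Y t t) = wordCoord b w 1 := by
    intro t ht htT w hw
    rw [wordCoord_one]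
    split_ifs with h
    · rw [h, hYr.wordCoord_nil b ht le_rfl htT]
    · obtain ⟨C, hC⟩ := hYr.wordCoord_bound hω b w
      have h1 := hC t t ht le_rfl htT
      rw [hω.diag t ht htT, Real.zero_rpow (by positivity),
        zero_pow (List.length_pos_iff.2 h).ne', mul_zero] at h1
      exact abs_nonpos_iff.1 h1
  obtain ⟨L, hL0, hLmul, ⟨C, hLC⟩, hLpath⟩ := exists_sewing hω b ⌊p⌋₊ hθ1 hT
    (fun s t hs hst ht => hYr.wordCoord_nil b hs hst ht) hdiag
    (fun w _ => by
      obtain ⟨B, -, hB⟩ := hYr.wordCoord_bounded hω hp0 b w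
      exact ⟨B, hB⟩)
    (fun w hw => by
      obtain ⟨ℓ, hℓ⟩ := exists_dual_eq_wordCoord b w
      obtain ⟨C, hC⟩ := hY.almost_multiplicative _ hw ℓ
      refine ⟨C, fun s u t hs hsu hut ht => ?_⟩
      rw [hℓ, hℓ, ← map_sub, hθ]
      exact hC s u t hs hsu hut ht)
  have hLcont : ∀ w : List κ, w.length ≤ ⌊p⌋₊ →
      ContinuousOn (fun q : ℝ × ℝ => wordCoord b w (L q.1 q.2)) (simplex T) := fun w hw =>
    continuousOn_of_forall_isChain b (fun w => hYr.continuousOn_wordCoord b w) w fun δ hδ => by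
      obtain ⟨η, hη, h⟩ := hLpath δ hδ
      exact ⟨η, hη, fun s t l hl hch => h s t l hl hch w hw⟩
  have hlim : ∀ s t, 0 ≤ s → s ≤ t → t ≤ T → IsPartitionLimit ⌊p⌋₊ Y s t (L s t) := by
    intro s t hs hst ht π hπ n hn ℓ
    simp only [dual_apply_eq_sum b ℓ]
    refine tendsto_finsetSum _ fun K _ => Filter.Tendsto.mul_const _ ?_
    rw [Metric.tendsto_atTop]
    intro δ hδ
    obtain ⟨η, hη, h⟩ := hLpath (δ / 2) (half_pos hδ)
    obtain ⟨k₀, hk₀⟩ := hπ η hη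
    refine ⟨k₀, fun k hk => ?_⟩
    rw [Real.dist_eq, partitionProd_eq_pathProd]
    exact (h s t _ ((π k).isTimes hs ht) ((List.isChain_map _).2
      ((List.isChain_range_succ _ _).2 (hk₀ k hk))) _ (by simpa using hn)).trans_lt (by linarith)
  have hLnil : ∀ s t, 0 ≤ s → s ≤ t → t ≤ T → wordCoord b [] (L s t) = 1 := by
    intro s t hs hst ht
    refine tendsto_nhds_unique (f := fun _ : ℕ => (1 : ℝ)) (l := Filter.atTop) ?_ tendsto_const_nhds
    obtain ⟨ℓ, hℓ⟩ := exists_dual_eq_wordCoord b []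
    have h1 := hlim s t hs hst ht (fun n => uniformPartition n hst) (fun η hη => by
      obtain ⟨n₀, hn₀⟩ := exists_nat_gt ((t - s) / η)
      refine ⟨n₀, fun n hn i _ => ?_⟩
      rw [uniformPartition_step, div_lt_iff₀ (by positivity)]
      rw [div_lt_iff₀ hη] at hn₀
      have h1 : (n₀ : ℝ) ≤ n := by exact_mod_cast hn
      nlinarith) 0 (Nat.zero_le _) ℓ
    rw [hℓ]
    refine h1.congr fun n => ?_
    exact (hℓ _).symm.trans (by
      rw [partitionProd_eq_pathProd]
      exact wordCoord_nil_pathProd b (fun s t hs hst ht => hYr.wordCoord_nil b hs hst ht) _ s t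
        ((uniformPartition n hst).isTimes hs ht))
  have hLr : IsRegularFunctional T p ω L := by
    refine isRegularFunctional_of_wordCoord hω b hLnil (fun s t _ _ _ w hw => hL0 s t w hw) hLcont
      fun w hw => ?_
    obtain ⟨D, hD⟩ := hYr.wordCoord_bound hω b w
    refine ⟨D + |C| * (ω 0 T ^ (1 / p)) ^ (⌊p⌋₊ + 1 - w.length), fun s t hs hst ht => ?_⟩
    have h0 := hω.nonneg s t hs hst ht
    have h1 := hLC w hw s t hs hst ht
    have h2 := hD s t hs hst ht
    have e0 : 0 ≤ ω s t ^ (1 / p) := Real.rpow_nonneg h0 _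
    have h3 : ω s t ^ θ ≤
        (ω 0 T ^ (1 / p)) ^ (⌊p⌋₊ + 1 - w.length) * (ω s t ^ (1 / p)) ^ w.length := by
      rw [hθpow s t hs hst ht, ← Nat.sub_add_cancel (show w.length ≤ ⌊p⌋₊ + 1 by omega), pow_add,
        Nat.sub_add_cancel (show w.length ≤ ⌊p⌋₊ + 1 by omega)]
      exact mul_le_mul_of_nonneg_right (pow_le_pow_left₀ e0
        (Real.rpow_le_rpow h0 (hω.le_total hs hst ht) (by positivity)) _) (pow_nonneg e0 _)
    have h4 : C * ω s t ^ θ ≤ |C| * ω s t ^ θ :=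
      mul_le_mul_of_nonneg_right (le_abs_self C) (Real.rpow_nonneg h0 _)
    have h5 := mul_le_mul_of_nonneg_left h3 (abs_nonneg C)
    have h6 := abs_sub_abs_le_abs_sub (wordCoord b w (L s t)) (wordCoord b w (Y s t))
    linarith
  have hgeom : ∀ n ≤ ⌊p⌋₊, ∀ K M : List κ, K.length + M.length = n →
      ∀ s t, 0 ≤ s → s ≤ t → t ≤ T → wordCoord b K (L s t) * wordCoord b M (L s t) -
        shuffleSum K M (fun w => wordCoord b w (L s t)) = 0 := by
    intro n
    induction n using Nat.strong_induction_on with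
    | _ n ih =>
    rintro hn K M rfl s t hs hst ht
    obtain ⟨D, hD⟩ : ∃ D, ∀ s t, 0 ≤ s → s ≤ t → t ≤ T →
        |wordCoord b K (Y s t) * wordCoord b M (Y s t) -
          shuffleSum K M fun w => wordCoord b w (Y s t)| ≤ D * ω s t ^ θ := by
      obtain ⟨K', hK'⟩ := exists_eq_reverse_ofFn (w := K) rfl
      obtain ⟨M', hM'⟩ := exists_eq_reverse_ofFn (w := M) rfl
      obtain ⟨D, hD⟩ := hY.almost_geometric _ _ hn
        ((tensorBasis b (K.length + M.length)).coord (Fin.append K' M'))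
      refine ⟨D, fun s t hs hst ht => ?_⟩
      have h1 := hD s t hs hst ht
      rw [Module.Basis.coord_apply, repr_geometricDefect, ← hK', ← hM', ← hθ] at h1
      exact h1
    obtain ⟨B₁, hB₁0, hB₁⟩ := hLr.wordCoord_bounded hω hp0 b M
    obtain ⟨B₂, hB₂0, hB₂⟩ := hYr.wordCoord_bounded hω hp0 b K
    refine eq_zero_of_additive_of_le hω hθ1
      (C := D + (C * B₁ + B₂ * C) + 2 ^ (K.length + M.length) * C)
      (f := fun s t => wordCoord b K (L s t) * wordCoord b M (L s t) -
        shuffleSum K M fun w => wordCoord b w (L s t)) ?_ ?_ hs hst ht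
    · intro s u t hs hsu hut ht
      refine defect_additive (x := fun w => wordCoord b w (L s t)) (hLnil s u hs hsu (hut.trans ht)) (hLnil u t (hs.trans hsu) hut ht)
        (fun w hw => ?_) hn
        (fun K' M' h => sub_eq_zero.1 (ih _ h (by omega) K' M' rfl s u hs hsu (hut.trans ht)))
        (fun K' M' h => sub_eq_zero.1 (ih _ h (by omega) K' M' rfl u t (hs.trans hsu) hut ht))
      rw [← wordCoord_mul, hLmul s u t hs hsu hut ht w hw]
    · intro s t hs hst ht
      have h1 := hLC K (by omega) s t hs hst ht
      have h2 := hLC M (by omega) s t hs hst ht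
      have h3 := abs_shuffleSum_le (K := K) (L := M)
        (y := fun w => wordCoord b w (L s t) - wordCoord b w (Y s t)) (c := C * ω s t ^ θ)
        fun w hw => hLC w (by omega) s t hs hst ht
      have h4 : shuffleSum K M (fun w => wordCoord b w (L s t)) =
          shuffleSum K M (fun w => wordCoord b w (Y s t)) + shuffleSum K M fun w =>
            wordCoord b w (L s t) - wordCoord b w (Y s t) := by
        rw [← shuffleSum_add]
        simp only [add_sub_cancel]
      have h5 : wordCoord b K (L s t) * wordCoord b M (L s t) -
          shuffleSum K M (fun w => wordCoord b w (L s t)) =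
          (wordCoord b K (Y s t) * wordCoord b M (Y s t) -
            shuffleSum K M fun w => wordCoord b w (Y s t)) +
          ((wordCoord b K (L s t) - wordCoord b K (Y s t)) * wordCoord b M (L s t) +
            wordCoord b K (Y s t) * (wordCoord b M (L s t) - wordCoord b M (Y s t))) -
          shuffleSum K M fun w => wordCoord b w (L s t) - wordCoord b w (Y s t) := by
        rw [h4]; ring
      have h6 : |(wordCoord b K (L s t) - wordCoord b K (Y s t)) * wordCoord b M (L s t)| ≤
          C * ω s t ^ θ * B₁ := by
        rw [abs_mul]
        exact mul_le_mul h1 (hB₁ s t hs hst ht) (abs_nonneg _) ((abs_nonneg _).trans h1)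
      have h7 : |wordCoord b K (Y s t) * (wordCoord b M (L s t) - wordCoord b M (Y s t))| ≤
          B₂ * (C * ω s t ^ θ) := by
        rw [abs_mul]
        exact mul_le_mul (hB₂ s t hs hst ht) h2 (abs_nonneg _) hB₂0
      rw [h5]
      refine (abs_sub _ _).trans ?_
      refine (add_le_add ((abs_add_le _ _).trans (add_le_add (hD s t hs hst ht)
        ((abs_add_le _ _).trans (add_le_add h6 h7)))) h3).trans (le_of_eq ?_)
      ring
  refine ⟨L, hlim, ⟨hLr, fun s u t hs hsu hut ht n hn => ?_, fun s t hs hst ht i j hij => ?_⟩,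
    θ, C, hθ1, hLC⟩
  · exact apply_eq_of_wordCoord_eq b fun w hw => hLmul s u t hs hsu hut ht w (by omega)
  · refine (tensorBasis b (i + j)).ext_elem fun M => ?_
    obtain ⟨K, K', rfl⟩ := exists_eq_append M
    rw [repr_geometricDefect, map_zero, Finsupp.zero_apply]
    exact hgeom _ hij _ _ (by simp) s t hs hst ht

end RoughPathOfAlmostRoughPath

end

end GeomRough

/-! ### Lifts of controlled paths -/

theorem theorem2p7 {V U : Type*} [AddCommGroup V] [Module ℝ V] [FiniteDimensional ℝ V]
    [AddCommGroup U] [Module ℝ U] [FiniteDimensional ℝ U]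
    (T p : ℝ) (hT : 0 < T) (hp : 1 ≤ p)
    (ω : ℝ → ℝ → ℝ) (hω : GeomRough.IsControl T ω)
    (X : ℝ → ℝ → GeomRough.TAlg V) (hX : GeomRough.IsRoughPath T p ω X)
    (H : ℝ → GeomRough.TAlg V →ₗ[ℝ] U) (hH : GeomRough.IsControlledPath T p ω X H) :
    GeomRough.IsAlmostRoughPath T p ω (GeomRough.partialLift p X H) ∧
      ∃ L : ℝ → ℝ → GeomRough.TAlg U,
        (∀ s t, 0 ≤ s → s ≤ t → t ≤ T →
          GeomRough.IsPartitionLimit ⌊p⌋₊ (GeomRough.partialLift p X H) s t (L s t)) ∧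
        GeomRough.IsRoughPath T p ω L ∧
        ∀ s t, 0 ≤ s → s ≤ t → t ≤ T →
          L s t 1 = GeomRough.vec (GeomRough.trace H t - GeomRough.trace H s) := by
  let e := Module.finBasis ℝ V
  let b := Module.finBasis ℝ U
  have hY := GeomRough.isAlmostRoughPath_partialLift hX hH hω hp e b
  obtain ⟨L, hlim, hL, θ, C, hθ, hLC⟩ := hY.exists_isRoughPath hω hT.le hp b
  refine ⟨hY, L, hlim, hL, fun s t hs hst ht => ?_⟩
  have hN : 1 ≤ ⌊p⌋₊ := Nat.one_le_floor_iff p |>.2 hp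
  -- both first levels are additive in time, and their difference is `O(ω^θ)` with `θ > 1`
  have hfirst : ∀ k, GeomRough.wordCoord b [k] (L s t) =
      b.repr (GeomRough.trace H t - GeomRough.trace H s) k := by
    intro k
    rw [← sub_eq_zero]
    refine GeomRough.eq_zero_of_additive_of_le hω hθ (C := C)
      (f := fun s t => GeomRough.wordCoord b [k] (L s t) -
        b.repr (GeomRough.trace H t - GeomRough.trace H s) k) ?_ ?_ hs hst ht
    · intro s u t hs hsu hut ht
      have hnil := fun s t => hL.toIsRegularFunctional.wordCoord_nil b (s := s) (t := t)
      rw [hL.wordCoord_eq_deconcSum b hs hsu hut ht (by simpa using hN), GeomRough.deconcSum,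
        GeomRough.deconcSum, hnil s u hs hsu (hut.trans ht), hnil u t (hs.trans hsu) hut ht]
      simp only [map_sub, Finsupp.sub_apply]
      ring
    · intro s t hs hst ht
      rw [← GeomRough.wordCoord_singleton_partialLift (p := p) (X := X) b s t k]
      exact hLC [k] (by simpa using hN) s t hs hst ht
  rw [GeomRough.apply_eq_of_wordCoord_eq b (n := 1)
    (a' := GeomRough.incl 1 (GeomRough.vec (GeomRough.trace H t - GeomRough.trace H s)))
    fun w hw => ?_, GeomRough.incl_apply_self]
  obtain ⟨k, rfl⟩ := List.length_eq_one_iff.1 hw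
  rw [hfirst, GeomRough.wordCoord_incl_vec]
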